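/- **Setting.** A *unimodal map* is a continuous surjection $f:[a,b]\to[a,b]$ with $f(b)=a$ which is strictly increasing on $[a,c]$ and strictly decreasing on $[c,b]$ for some $c\in(a,b)$ (so $f(c)=b$). Its *kneading sequence* $\kappa(f)\in\{0,1\}^{\mathbb N}$ has $j$-th symbol $1$ iff $f^j(b)\ge c$. Suppose that $c$ is periodic of least period $N$; label the points of its orbit $1,\dots,N$ from left to right, and let $\pi\in S_N$ be the permutation induced by $f$, so that $c$ has label $\pi^{-1}(N)$ and $\pi(N)=1$. The intervals between adjacent points are the *strips*. Assume that the transition matrix of the strips (entry $(i,j)$ is the number of times the image of strip $j$ crosses strip $i$) is irreducible and aperiodic (some power with positive exponent has only positive entries, and the matrix is not the $1\times1$ matrix $(1)$); equivalently $s=\kappa(f)$ is a periodic kneading sequence of period $N$ in $\mathcal{MIA}$. *Height.* Write $s\prec t$ if, $n$ being the least index with $s_n\ne t_n$, the sum $\sum_{j\le n}s_j$ is even. For $q=m/n\in(0,1/2]$ in lowest terms, $c_q=s_0\dots s_n$ is the word with $s_i=1$ iff the segment from $(0,0)$ to $(n,m)$ meets a line $y=$ integer for some $x\in(i-1,i+1)$;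 $w_q$ is $c_q$ without its last two symbols; $\mathrm{NBT}(q)=(c_q1)^\infty$ and $\mathrm{lhe}(q)=(w_q1)^\infty$. The height of $s$ is $\inf\{q\in\mathbb Q\cap(0,1/2]: q=1/2\text{ or }\mathrm{NBT}(q)\prec s\}$. *Train tracks.* The thick interval associated with $f$ has junctions $1,\dots,N$ (disks, each with one puncture in its interior) joined consecutively by the strips. Junction $1$ has one switch, on its right; junction $N$ has one, on its left; the others (the $2$-junctions) have a left and a right switch. A *generalized train track* $\tau$ is given by a countable family of *infinitesimal edges* in each punctured junction: arcs with ends at the switches, disjoint except at their ends, no two of them parallel (bounding a disk that contains neither the puncture nor another edge). Families are considered up to isotopy in the sense of their combinatorial data: the order of the ends of edges along the boundary of the junction, the pairing of the ends, and the side of each edge on which the puncture lies. The thick interval map $F$ translates the part of the thick interval left of $c$ and turns the part right of $c$ through the angle $\pi$, laying it above the left part. The image $F_*(\tau)$ has in junction $j$ the image of the edges of junction $\pi^{-1}(j)$ (junction $\pi^{-1}(N)$ being folded), and in addition, for each strip whose image passes across junction $j$, an edge joining its two switches, below everything else if the strip is left of $c$ and above everything else if it is right of $c$; then parallel edges are amalgamated.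 $\tau$ is *invariant* if $F_*(\tau)\sim\tau$. *The* invariant generalized train track is the minimal one: it is equivalent to a subfamily of every invariant one. *Configurations.* A loop is an edge whose ends lie at the same switch; a bubble is a loop whose disk contains no other edge; a loop is trivial if its disk does not contain the puncture. Directions are as seen from the switch, looking into the junction. - $\mathrm{BP}$: a single bubble containing the puncture. - $S^+$: trivial bubbles $t_0,t_1,\dots$ at one switch, with $t_{k+1}$ next to $t_k$ on its left. - $W^+$: loops $\ell_0,\ell_1,\dots$ containing the puncture and trivial bubbles $t_0,t_1,\dots$, at one switch, where the disk of $\ell_k$ contains $t_k$ and $\ell_{k+1}$ and all later ones, $t_k$ lies to the right of $\ell_{k+1}$, and $t_k$ lies outside $\ell_{k+1}$. $W^-$ is its mirror image. - $V_3^{\pm}$ (in a $2$-junction): two edges joining the two switches, one above and one below the puncture, with $W^\pm$ between them. The sets $L,R$ are defined by: $\pi(1)\in R$, and for $2\le r\le N-2$, $\pi^r(1)$ lies in the same set as $\pi^{r-1}(1)$ if $\pi^{r-1}(1)<\pi^{-1}(N)$, and in the other set if $\pi^{r-1}(1)>\pi^{-1}(N)$. A junction is *of type* $\mathrm{BP}$,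 $S^+$, $W^\pm$ or $V_3^\pm$ if its infinitesimal edges are, up to equivalence, exactly the following: the loops of that configuration, attached to the only switch for junctions $1$ and $N$, and to the left (right) switch of a $2$-junction in $L$ (in $R$); for $V_3^\pm$ also the two edges of the bigon; and in each $2$-junction not of type $V_3^\pm$ one edge joining the two switches, which passes above everything else (and the puncture) if the junction is in $R$, and below if it is in $L$. **Theorem.** In this setting let $s$ have rational height $m/n>0$ (in lowest terms). Then the invariant generalized train track exists, and: 1. if $s=\mathrm{lhe}(m/n)$, all junctions are of type $S^+$; 2. if $s=\mathrm{NBT}(m/n)$, all junctions are of type $\mathrm{BP}$; 3. otherwise, let $\epsilon=+$ if $\pi^{-1}(N)\in R$ and $\epsilon=-$ if $\pi^{-1}(N)\in L$. Then for $0\le r\le N-1$, junction $\pi^r(N)$ is of type $W^\epsilon$ if $r\le n+1$, and of type $V_3^\epsilon$ if $r>n+1$. -/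

import Mathlib

open scoped Classical

noncomputable section

namespace UnimodalTrack

/-! ### Symbolic dynamics -/

/-- The unimodal order on `{0,1}^ℕ` (`true` is the symbol `1`): at the first place where `s` and `t`
disagree, the initial word of `s` up to and including that place has an even number of `1`s. -/
def UnimodalLT (s t : ℕ → Bool) : Prop :=
  ∃ n, (∀ j < n, s j = t j) ∧ s n ≠ t n ∧ Even (∑ j ∈ Finset.range (n + 1), (s j).toNat)

/-- The periodic sequence `w^∞`. -/
def periodicSeq (w : List Bool) : ℕ → Bool := fun j => w.getD (j % w.length) false

/-- The word `c_q` of length `n + 1`, for `q = m/n` in lowest terms: its `i`-th symbol is `1` if and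
only if the segment from `(0,0)` to `(n,m)` meets a line `y = integer` for some `x ∈ (i-1,i+1)`. -/
def cWord (q : ℚ) : List Bool :=
  (List.range (q.den + 1)).map fun i =>
    decide (∃ x : ℝ, 0 ≤ x ∧ x ≤ q.den ∧ (i : ℝ) - 1 < x ∧ x < (i : ℝ) + 1 ∧
      ∃ k : ℤ, (q : ℝ) * x = k)

/-- The word `w_q`, which is `c_q` with its last two symbols deleted. -/
def wWord (q : ℚ) : List Bool := (cWord q).dropLast.dropLast

/-- The kneading sequence `NBT(q) = (c_q 1)^∞`. -/
def nbt (q : ℚ) : ℕ → Bool := periodicSeq (cWord q ++ [true])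

/-- The kneading sequence `lhe(q) = (w_q 1)^∞`. -/
def lhe (q : ℚ) : ℕ → Bool := periodicSeq (wWord q ++ [true])

/-- The height of a sequence. -/
def height (s : ℕ → Bool) : ℝ :=
  sInf {x : ℝ | ∃ q : ℚ, x = q ∧ 0 < q ∧ q ≤ 1 / 2 ∧ (q = 1 / 2 ∨ UnimodalLT (nbt q) s)}

/-! ### Unimodal maps with periodic turning point -/

/-- A unimodal map of `[a,b]` with turning point `c`. (Surjectivity follows from `f(c) = b`,
`f(b) = a` and continuity.) -/
structure UnimodalMap where
  a : ℝ
  b : ℝ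
  c : ℝ
  toFun : ℝ → ℝ
  a_lt_c : a < c
  c_lt_b : c < b
  mapsTo : Set.MapsTo toFun (Set.Icc a b) (Set.Icc a b)
  continuousOn : ContinuousOn toFun (Set.Icc a b)
  strictMonoOn : StrictMonoOn toFun (Set.Icc a c)
  strictAntiOn : StrictAntiOn toFun (Set.Icc c b)
  map_c : toFun c = b
  map_b : toFun b = a

/-- The kneading sequence: the itinerary of the turning value `b`. -/
def UnimodalMap.kneadingSequence (f : UnimodalMap) : ℕ → Bool :=
  fun j => decide (f.c ≤ f.toFun^[j] f.b)

/-- The turning point of `f` is periodic of least period `N`, and the `N` points of its orbit are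
labelled by `Fin N` from left to right; `perm` is the induced permutation `π` of the labels. All
fields are determined by `f`. The label `i : Fin N` stands for the integer `i + 1`. -/
structure CriticalOrbit (f : UnimodalMap) (N : ℕ) where
  point : Fin N → ℝ
  strictMono : StrictMono point
  range_eq : Set.range point = {x | ∃ k : ℕ, x = f.toFun^[k] f.c}
  perm : Equiv.Perm (Fin N)
  map_point : ∀ i, f.toFun (point i) = point (perm i)
  crit : Fin N
  point_crit : point crit = f.c

/-- The left-hand endpoint of the `k`-th strip. -/
def stripL {N : ℕ} (k : Fin (N - 1)) : Fin N := ⟨k, by omega⟩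

/-- The right-hand endpoint of the `k`-th strip. -/
def stripR {N : ℕ} (k : Fin (N - 1)) : Fin N := ⟨k + 1, by omega⟩

namespace CriticalOrbit

variable {f : UnimodalMap} {N : ℕ} (P : CriticalOrbit f N)

/-- The rightmost label (the integer `N`): the label of `b = f(c)`. -/
def last : Fin N := P.perm P.crit

/-- The leftmost label (the integer `1`): the label of `a = f(b)`. -/
def first : Fin N := P.perm P.last

/-- The transition matrix: the entry `(i,j)` is the number of times that the image of the `j`-th
strip crosses the `i`-th strip. It is `0` or `1`, because the turning point is an endpoint of
strips and so `f` is monotone on each strip. -/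
def transitionMatrix : Matrix (Fin (N - 1)) (Fin (N - 1)) ℕ := fun i j =>
  if Set.Icc (P.point (stripL i)) (P.point (stripR i)) ⊆
      f.toFun '' Set.Icc (P.point (stripL j)) (P.point (stripR j)) then 1 else 0

/-- The transition matrix is irreducible and aperiodic, and is not the `1 × 1` matrix `(1)`. -/
def IsMIA : Prop :=
  P.transitionMatrix ≠ 1 ∧ ∃ k : ℕ, 0 < k ∧ ∀ i j, 0 < (P.transitionMatrix ^ k) i j

end CriticalOrbit

/-! ### Infinitesimal edges in one junction -/

/-- The two possible switches of a junction. -/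
inductive Side
  | left
  | right

/-- The other side. -/
def Side.flip : Side → Side
  | .left => .right
  | .right => .left

/-- The combinatorial (isotopy) data of a family of infinitesimal edges in a junction. The junction
is a closed disk with one puncture in its interior, with a switch in the middle of its left and/or
right boundary arc; the edges are arcs in the disk minus the puncture, with ends at the switches
and disjoint except at their ends.

* `Dart` is the set of ends of edges (each edge has two), and `pair` exchanges the two ends of each
  edge;
* `side d` is the switch at which the end `d` lies;
* `lt` is the order in which the ends are met when the boundary of the disk is traversed
  counterclockwise, starting from the bottom (so it lists the ends at the right switch from bottom to
  top, and then the ends at the left switch from top to bottom);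
* `enc d` says that the puncture lies on the side of the edge of `d` which does not contain the bottom
  of the junction. So for a loop it says that the disk bounded by the loop contains the puncture, and
  for an edge joining the two switches it says that the edge passes below the puncture. -/
structure JunctionTrack where
  Dart : Type
  pair : Dart → Dart
  side : Dart → Side
  lt : Dart → Dart → Prop
  enc : Dart → Prop

namespace JunctionTrack

/-- The data come from a countable family of arcs in the punctured disk, disjoint except at their
ends. -/
structure IsPlanar (G : JunctionTrack) : Prop where
  countable : Countable G.Dart
  order : IsStrictTotalOrder G.Dart G.lt
  pair_pair : ∀ d, G.pair (G.pair d) = d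
  pair_ne : ∀ d, G.pair d ≠ d
  right_lt_left : ∀ d e, G.side d = .right → G.side e = .left → G.lt d e
  enc_pair : ∀ d, G.enc (G.pair d) ↔ G.enc d
  /-- edges do not cross -/
  noncrossing : ∀ d e, ¬ (G.lt d e ∧ G.lt e (G.pair d) ∧ G.lt (G.pair d) (G.pair e))
  /-- the position of the puncture is consistent for nested edges -/
  enc_nested : ∀ d e, G.lt d e → G.lt e (G.pair e) → G.lt (G.pair e) (G.pair d) → G.enc e → G.enc d
  /-- the position of the puncture is consistent for edges that are not nested -/
  enc_disjoint : ∀ d e, G.lt d (G.pair d) → G.lt (G.pair d) e → G.lt e (G.pair e) →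
    ¬ (G.enc d ∧ G.enc e)

/-- The end `x` lies strictly between the ends `d` and `e`. -/
def Between (G : JunctionTrack) (x d e : G.Dart) : Prop :=
  (G.lt d x ∧ G.lt x e) ∨ (G.lt e x ∧ G.lt x d)

/-- The edges of `d` and `e` are distinct and parallel, with the end `d` corresponding to the end `e`:
they bound a disk between them which contains neither the puncture nor any other edge. -/
def Parallel (G : JunctionTrack) (d e : G.Dart) : Prop :=
  d ≠ e ∧ e ≠ G.pair d ∧ G.side d = G.side e ∧ G.side (G.pair d) = G.side (G.pair e) ∧
  (G.enc d ↔ G.enc e) ∧ (G.lt d e ↔ G.lt (G.pair e) (G.pair d)) ∧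
  ∀ x, ¬ G.Between x d e ∧ ¬ G.Between x (G.pair d) (G.pair e)

/-- `φ` identifies `H`, up to isotopy, with a subfamily of the edges of `G`. -/
structure IsEmbedding (H G : JunctionTrack) (φ : H.Dart → G.Dart) : Prop where
  injective : Function.Injective φ
  pair : ∀ d, φ (H.pair d) = G.pair (φ d)
  side : ∀ d, G.side (φ d) = H.side d
  lt : ∀ d e, G.lt (φ d) (φ e) ↔ H.lt d e
  enc : ∀ d, G.enc (φ d) ↔ H.enc d

/-- Equivalence: isotopy in the punctured disk, fixed on the boundary. -/
def Equivalent (H G : JunctionTrack) : Prop :=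
  ∃ φ : H.Dart → G.Dart, IsEmbedding H G φ ∧ Function.Surjective φ

/-- `H` is obtained from `G`, up to equivalence, by amalgamating parallel edges: exactly one edge is
kept from each class of the equivalence relation generated by parallelism. -/
def IsAmalgamation (H G : JunctionTrack) : Prop :=
  ∃ φ : H.Dart → G.Dart, IsEmbedding H G φ ∧ ∀ d, ∃! x, Relation.EqvGen G.Parallel d (φ x)

/-- Rotation of the junction through the angle `π`. -/
def rotate (G : JunctionTrack) : JunctionTrack where
  Dart := G.Dart
  pair := G.pair
  side d := (G.side d).flip
  lt d e := if G.side d = G.side e then G.lt d e else G.side d = .left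
  enc d := if G.side d = G.side (G.pair d) then G.enc d else ¬ G.enc d

/-- Folding of a junction into a junction with one boundary arc, on its left: the left-hand boundary
arc is carried to the lower part of that arc, and the right-hand boundary arc, turned through the
angle `π`, to the upper part. So the ends at the right switch, from bottom to top, and then the ends
at the left switch, from top to bottom, become ends at the single switch, from top to bottom. -/
def fold (G : JunctionTrack) : JunctionTrack where
  Dart := G.Dart
  pair := G.pair
  side _ := .left
  lt := G.lt
  enc := G.enc

/-- Reflection of the junction in a vertical line. -/
def reflect (G : JunctionTrack) : JunctionTrack where
  Dart := G.Dart
  pair := G.pair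
  side d := (G.side d).flip
  lt d e := G.lt e d
  enc := G.enc

end JunctionTrack

/-- The two places at which an edge joining the two switches can be added outside a given family:
below all its edges and the puncture, or above them. -/
inductive Level
  | lower
  | upper

/-- Position of the end, on the given side, of an edge added at the given level; the ends of the given
family have positions `1` (right switch) and `4` (left switch). -/
def Level.block : Level → Side → ℕ
  | .lower, .right => 0
  | .upper, .right => 2
  | .upper, .left => 3
  | .lower, .left => 5

/-- Position of the ends of a family of edges among those of the edges that are added to it. -/
def Side.block : Side → ℕ
  | .right => 1
  | .left => 4

namespace JunctionTrack

/-- Add to the family `G` an edge joining the two switches and passing below all edges of `G` and the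
puncture (if `has lower`), and one passing above them (if `has upper`). -/
def addThrough (G : JunctionTrack) (has : Level → Prop) : JunctionTrack where
  Dart := G.Dart ⊕ ({l : Level // has l} × Side)
  pair
    | .inl d => .inl (G.pair d)
    | .inr x => .inr (x.1, x.2.flip)
  side
    | .inl d => G.side d
    | .inr x => x.2
  lt
    | .inl d, .inl e => G.lt d e
    | .inl d, .inr y => (G.side d).block < y.1.1.block y.2
    | .inr x, .inl e => x.1.1.block x.2 < (G.side e).block
    | .inr x, .inr y => x.1.1.block x.2 < y.1.1.block y.2
  enc
    | .inl d => G.enc d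
    | .inr x => x.1.1 = .lower

end JunctionTrack

/-! ### Generalized train tracks and the action of the thick interval map -/

/-- A generalized train track of the thick interval with `N` junctions, labelled from left to right, is
given by its infinitesimal edges in each junction. -/
abbrev Track (N : ℕ) := Fin N → JunctionTrack

namespace CriticalOrbit

variable {f : UnimodalMap} {N : ℕ} (P : CriticalOrbit f N)

/-- The leftmost and the rightmost junction are `1`-junctions, with one switch, on their right and on
their left respectively; the other junctions are `2`-junctions. No two edges are parallel. -/
structure IsTrack (τ : Track N) : Prop where
  planar : ∀ i, (τ i).IsPlanar
  first_side : ∀ d, (τ P.first).side d = .right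
  last_side : ∀ d, (τ P.last).side d = .left
  not_parallel : ∀ i d e, ¬ (τ i).Parallel d e

/-- The image of the family of edges in junction `i` under the thick interval map `F` restricted to
that junction, in the junction `π i`, after the image of the strips has been squashed onto the real
edges. The part of the thick interval to the left of the junction of the turning point is
translated, and the part to the right of it is turned through the angle `π` and laid above. -/
def push (i : Fin N) (G : JunctionTrack) : JunctionTrack :=
  if i < P.crit then G else if i = P.crit then G.fold else G.rotate

/-- The image of a strip (of a real edge) to the left of the turning point (`lower`) or to the right of
it (`upper`) passes across junction `j`. The strips to the left of the turning point have their
images below everything else, and those to the right of it above everything else. -/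
def passes (j : Fin N) : Level → Prop
  | .lower => ∃ k : Fin (N - 1), stripR k ≤ P.crit ∧
      P.perm (stripL k) < j ∧ j < P.perm (stripR k)
  | .upper => ∃ k : Fin (N - 1), P.crit ≤ stripL k ∧
      P.perm (stripR k) < j ∧ j < P.perm (stripL k)

/-- The image `F(τ)`, before parallel edges are amalgamated: it consists in junction `j` of the image of
the infinitesimal edges of junction `π⁻¹ j`, and of the pieces of the images of the real edges that
pass across junction `j`. -/
def rawImage (τ : Track N) : Track N := fun j =>
  ((P.push (P.perm.symm j) (τ (P.perm.symm j))).addThrough (P.passes j))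

/-- `F`-invariance: the image `F_*(τ)`, obtained by amalgamating parallel edges, is equivalent
to `τ`. -/
def IsInvariant (τ : Track N) : Prop :=
  P.IsTrack τ ∧ ∀ j, (τ j).IsAmalgamation (P.rawImage τ j)

/-- `τ` is *the* invariant generalized train track: it is invariant, and it is minimal, in the sense
that every invariant generalized train track has a subfamily of infinitesimal edges which defines a
train track equivalent to `τ`. -/
def IsTheInvariantTrack (τ : Track N) : Prop :=
  P.IsInvariant τ ∧ ∀ τ' : Track N, P.IsInvariant τ' →
    ∀ i, ∃ φ : (τ i).Dart → (τ' i).Dart, (τ i).IsEmbedding (τ' i) φ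

end CriticalOrbit

/-! ### The basic configurations -/

inductive Sgn
  | plus
  | minus

/-- A single bubble containing the puncture, at the switch `s`. -/
def bubbleBP (s : Side) : JunctionTrack where
  Dart := Bool
  pair := not
  side _ := s
  lt d e := d = false ∧ e = true
  enc _ := True

/-- The semi-infinite bouquet `S⁺` of homotopically trivial bubbles at the switch `s`: bubble number
`k + 1` follows bubble number `k` clockwise along the boundary of the junction (at a left
switch: it lies above it). -/
def bouquetS (s : Side) : JunctionTrack where
  Dart := ℕ × Bool
  pair d := (d.1, !d.2)
  side _ := s
  lt d e := e.1 < d.1 ∨ (d.1 = e.1 ∧ d.2 = false ∧ e.2 = true)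
  enc _ := False

/-- The ends of the configurations `W^±`: the `k`-th non-trivial loop, and the `k`-th homotopically
trivial bubble (`k : ℕ`), have two ends each. -/
inductive WDart
  | loop (k : ℕ) (e : Bool)
  | bubble (k : ℕ) (e : Bool)

/-- The order of the ends of `W⁺`, as the lexicographic order of the keys: first come the first ends of
loops `0, 1, 2, …`; and then, in decreasing order of `k`, the two ends of bubble `k` followed
by the second end of loop `k`. -/
def WDart.key : WDart → ℕ × ℤ
  | .loop k false => (0, k)
  | .bubble k false => (1, -(3 * k + 2))
  | .bubble k true => (1, -(3 * k + 1))
  | .loop k true => (1, -(3 * k))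

/-- The configuration `W⁺` at the switch `s`: loop `k` contains the puncture, bubble `k` and loop
`k + 1`, and bubble `k` comes after loop `k + 1` counterclockwise (at a left switch: it lies
below it). -/
def loopsWPlus (s : Side) : JunctionTrack where
  Dart := WDart
  pair
    | .loop k e => .loop k (!e)
    | .bubble k e => .bubble k (!e)
  side _ := s
  lt d e := Prod.Lex (· < ·) (· < ·) d.key e.key
  enc
    | .loop _ _ => True
    | .bubble _ _ => False

/-- `W⁻` is the mirror image of `W⁺`. -/
def loopsW : Sgn → Side → JunctionTrack
  | .plus, s => loopsWPlus s
  | .minus, s => (loopsWPlus s.flip).reflect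

/-- The symbols of the basic configurations. -/
inductive BasicType
  | BP
  | S
  | W (ε : Sgn)
  | V3 (ε : Sgn)

/-- The loops of a basic configuration, attached to the switch `s`. -/
def BasicType.loops : BasicType → Side → JunctionTrack
  | .BP, s => bubbleBP s
  | .S, s => bouquetS s
  | .W ε, s => loopsW ε s
  | .V3 ε, s => loopsW ε s

/-- The edges joining the two switches in a `2`-junction of the given type with the loops attached to
the switch `s`: both edges of the bigon for `V₃`; otherwise one edge, which passes above everything
else if the junction is of type `R` and below everything else if it is of type `L`. -/
def BasicType.through : BasicType → Side → Level → Prop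
  | .V3 _, _, _ => True
  | _, .right, l => l = .upper
  | _, .left, l => l = .lower

/-- All infinitesimal edges of a `2`-junction of the given basic type, with loops at the switch `s`. -/
def BasicType.twoJunction (t : BasicType) (s : Side) : JunctionTrack :=
  (t.loops s).addThrough (t.through s)

namespace CriticalOrbit

variable {f : UnimodalMap} {N : ℕ} (P : CriticalOrbit f N)

/-- The type `L` or `R` of `π^r(1)`: it changes after each label to the right of the turning point. It
starts with `R` at `π(1)`; equivalently, as `1` is to the left of the turning point, with `R`
at `1`. (It is used only for `1 ≤ r ≤ N - 2`.) -/
def lrType : ℕ → Side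
  | 0 => .right
  | r + 1 => if (P.perm ^ r) P.first < P.crit then lrType r else (lrType r).flip

/-- The set `R` (for `s = right`) or `L` (for `s = left`) of labels of `2`-junctions. -/
def sideSet (s : Side) : Set (Fin N) :=
  {i | ∃ r, 1 ≤ r ∧ r ≤ N - 2 ∧ i = (P.perm ^ r) P.first ∧ P.lrType r = s}

/-- The infinitesimal edges of `τ` in junction `i` are those of the basic configuration `t`, attached
to the only switch if `i` is a `1`-junction, and to the left or right switch according as `i ∈ L`
or `i ∈ R` if it is a `2`-junction, together with the additional edge in the latter case if
`t` is not `V₃`. (The configurations `V₃` exist in `2`-junctions only.) -/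
def HasType (τ : Track N) (i : Fin N) (t : BasicType) : Prop :=
  (i = P.first ∧ (∀ ε, t ≠ .V3 ε) ∧ (τ i).Equivalent (t.loops .right)) ∨
  (i = P.last ∧ (∀ ε, t ≠ .V3 ε) ∧ (τ i).Equivalent (t.loops .left)) ∨
  (i ∈ P.sideSet .right ∧ (τ i).Equivalent (t.twoJunction .right)) ∨
  (i ∈ P.sideSet .left ∧ (τ i).Equivalent (t.twoJunction .left))

end CriticalOrbit

end UnimodalTrack

end

open UnimodalTrack

/-!
Follow the junctions along the orbit of the turning value `b`: `P.orbit r` is the junction of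
`f^r(b)`, so `P.orbit 0` is the last junction, `P.orbit 1` the first one, and `P.orbit (N - 1)`
the junction of the turning point. Everywhere except at the turning point the map carries a
junction to the next one by a translation or a rotation, and adds at most one edge below and one
edge above everything else. So an invariant track amounts to a family `X` of loops in the last
junction. In the junction `P.orbit r` one sees `X` at the switch `P.sideAt r`, together with edges
joining the switches at the levels `P.edgesAt r`; and folding the junction of the turning point
must give `X` back, up to amalgamation of parallel edges (`IsMinimalReturn`,
`isInvariant_modelTrack`). Two things have to be determined: the data `P.sideAt r` and `P.edgesAt
r`, and the minimal solution `X` of this equation.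

*The edges.* The switch `P.sideAt r` is given by the parity of the number of `1`s among the first
`r` symbols of the kneading sequence `s`. The edge accompanying loops at that switch (above them
at a right switch, below them at a left one) is present for all `r ≥ 2` (`edgesAt_outer`); the
second edge appears at the first time at which a certain `Event` occurs, which is a condition on
`s` (`edgesAt_inner_iff`). A sequence of height `m/n` lies between `lhe(m/n)` (`lowerSeq`) and a
greatest sequence (`upperSeq`), of which `c_q` is the initial word. After the first symbol, the
`1`s in both come in pairs of consecutive ones, and the number of pairs which begin before the
place `i` is `⌊i m/n⌋` in the first and `⌈i m/n⌉ - 1` in the second (`i ≥ 1`). These counting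
functions are additive up to an error of `1`, and this excludes events (`not_event`). So there is
no event if `s = lhe(m/n)`. Otherwise `s` begins with `c_q`, `N` is at least `n + 2`, and the
first event takes place at time `n + 2` (`IsKneading.event`, `IsKneading.not_event_of_le`). That
is in time for the junction of the turning point unless `N = n + 2`, that is, `s = NBT(m/n)`.

*The loops.* If an edge passing above the puncture is present in the junction of the turning
point, then the minimal solution is the union `tower` of what arises from the empty family by
iteration: every iteration adds a trivial bubble, and a loop around the puncture if there is also
an edge below. With the edge above only this is `S⁺`; with both edges it is `W⁺` or `W⁻`,
according to the switch at which the old loops are. With the edge below only, the new loop is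
parallel to the old one, and the solution is a single loop, `BP`. Every invariant track `τ`
receives a map from the solution, because each end of the solution is named by the step at which
it is created. No ends are identified by it, since the bubbles separate them
(`IsWeakMap.inl_ne_inr`); so the solution is minimal. That a minimal `τ` is equivalent to it is
not formal, as infinite families may be equivalent to proper subfamilies of each other. But an end
of `τ` which is not created at any step has infinitely many ends on a side on which its image in
the tower has only finitely many (`IsWeakMap.unfold_surjective`).
-/

noncomputable section

namespace UnimodalTrack

/-! ### The unimodal order -/

/-- The number of symbols `1` among the first `r` symbols of `s`. -/
def ones (s : ℕ → Bool) (r : ℕ) : ℕ := ∑ j ∈ Finset.range r, (s j).toNat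

/-- The first place at which `s` and `t` disagree is `n`. -/
def FirstDiff (s t : ℕ → Bool) (n : ℕ) : Prop := (∀ j < n, s j = t j) ∧ s n ≠ t n

theorem ones_succ (s : ℕ → Bool) (r : ℕ) : ones s (r + 1) = ones s r + (s r).toNat :=
  Finset.sum_range_succ _ _

theorem ones_congr {s t : ℕ → Bool} {r : ℕ} (h : ∀ j < r, s j = t j) : ones s r = ones t r :=
  Finset.sum_congr rfl fun j hj => by rw [h j (Finset.mem_range.1 hj)]

theorem ones_add (s : ℕ → Bool) (k r : ℕ) :
    ones s (k + r) = ones s k + ones (fun j => s (j + k)) r := by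
  induction r with
  | zero => simp [ones]
  | succ r ih => rw [← add_assoc, ones_succ, ones_succ, ih, add_comm k r, add_assoc]

theorem exists_firstDiff {s t : ℕ → Bool} (h : s ≠ t) : ∃ n, FirstDiff s t n := by
  have h' : ∃ n, s n ≠ t n := by
    by_contra! h'
    exact h (funext h')
  exact ⟨Nat.find h', fun j hj => not_not.1 (Nat.find_min h' hj), Nat.find_spec h'⟩

theorem FirstDiff.symm {s t : ℕ → Bool} {n : ℕ} (h : FirstDiff s t n) : FirstDiff t s n :=
  ⟨fun j hj => (h.1 j hj).symm, h.2.symm⟩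

theorem FirstDiff.eq {s t : ℕ → Bool} {m n : ℕ} (h : FirstDiff s t m) (h' : FirstDiff s t n) :
    m = n := by
  rcases lt_trichotomy m n with hmn | hmn | hmn
  · exact absurd (h'.1 m hmn) h.2
  · exact hmn
  · exact absurd (h.1 n hmn) h'.2

theorem FirstDiff.ones_eq {s t : ℕ → Bool} {n : ℕ} (h : FirstDiff s t n) :
    ones s n = ones t n := ones_congr h.1

theorem FirstDiff.unimodalLT_iff {s t : ℕ → Bool} {n : ℕ} (h : FirstDiff s t n) :
    UnimodalLT s t ↔ Even (ones s (n + 1)) := by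
  refine ⟨fun ⟨m, h1, h2, h3⟩ => ?_, fun h' => ⟨n, h.1, h.2, h'⟩⟩
  rw [h.eq ⟨h1, h2⟩]
  exact h3

theorem FirstDiff.even_iff {s t : ℕ → Bool} {n : ℕ} (h : FirstDiff s t n) :
    Even (ones s (n + 1)) ↔ ¬ Even (ones t (n + 1)) := by
  rw [ones_succ, ones_succ, h.ones_eq]
  have := h.2
  cases hs : s n <;> cases ht : t n <;> simp_all [Nat.even_add_one]

theorem FirstDiff.unimodalLT_iff_not {s t : ℕ → Bool} {n : ℕ} (h : FirstDiff s t n) :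
    UnimodalLT s t ↔ ¬ UnimodalLT t s := by
  rw [h.unimodalLT_iff, h.symm.unimodalLT_iff, h.even_iff]

theorem unimodalLT_exists {s t : ℕ → Bool} (h : UnimodalLT s t) : ∃ n, FirstDiff s t n := by
  obtain ⟨n, h1, h2, _⟩ := h
  exact ⟨n, h1, h2⟩

theorem UnimodalLT.asymm {s t : ℕ → Bool} (h : UnimodalLT s t) : ¬ UnimodalLT t s := by
  obtain ⟨n, hn⟩ := unimodalLT_exists h
  exact hn.unimodalLT_iff_not.1 h

theorem unimodalLT_or_gt {s t : ℕ → Bool} (h : s ≠ t) : UnimodalLT s t ∨ UnimodalLT t s := by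
  obtain ⟨n, hn⟩ := exists_firstDiff h
  by_cases h' : UnimodalLT t s
  · exact .inr h'
  · exact .inl (hn.unimodalLT_iff_not.2 h')

/-- If the first difference of `s` and `t` is at `n`, then the order between `s` and `t` is
determined by the first `n + 1` symbols of `t`. -/
theorem FirstDiff.congr_right {s t t' : ℕ → Bool} {n : ℕ} (h : FirstDiff s t n)
    (ht : ∀ j ≤ n, t j = t' j) :
    FirstDiff s t' n ∧ (UnimodalLT s t' ↔ UnimodalLT s t) := by
  have h' : FirstDiff s t' n :=
    ⟨fun j hj => (h.1 j hj).trans (ht j hj.le), by rw [← ht n le_rfl]; exact h.2⟩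
  exact ⟨h', by rw [h.unimodalLT_iff, h'.unimodalLT_iff]⟩

theorem FirstDiff.shift {s t : ℕ → Bool} {n k : ℕ} (h : FirstDiff s t (n + k)) :
    FirstDiff (fun j => s (j + k)) (fun j => t (j + k)) n :=
  ⟨fun j hj => h.1 _ (by omega), h.2⟩

/-- Deleting a common initial word preserves or reverses the order according as the number of `1`s
in the word is even or odd. -/
theorem FirstDiff.shift_unimodalLT {s t : ℕ → Bool} {n k : ℕ} (h : FirstDiff s t (n + k)) :
    UnimodalLT (fun j => s (j + k)) (fun j => t (j + k)) ↔
      (Even (ones s k) ↔ UnimodalLT s t) := by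
  rw [h.shift.unimodalLT_iff, h.unimodalLT_iff, show n + k + 1 = k + (n + 1) by ring,
    ones_add s k (n + 1), Nat.even_add]
  tauto

/-- A sequence which lies between two sequences with a common initial word has the same
initial word. -/
theorem eq_of_between {u s v : ℕ → Bool} {L : ℕ} (huv : ∀ j < L, u j = v j)
    (h1 : ¬ UnimodalLT s u) (h2 : ¬ UnimodalLT v s) : ∀ j < L, s j = u j := by
  by_contra! hc
  obtain ⟨j, hj, hne⟩ := hc
  obtain ⟨n, hn⟩ := exists_firstDiff (s := s) (t := u) (fun h => hne (by rw [h]))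
  have hnL : n < L := by
    by_contra hnL
    exact hne (hn.1 j (by omega))
  obtain ⟨h3, h4⟩ := hn.congr_right (t' := v) (fun j hj => huv j (by omega))
  exact h1 (h4.1 (h3.unimodalLT_iff_not.2 h2))

/-! ### Sequences of pairs of `1`s -/

/-- The counting function of a sequence of pairwise disjoint pairs of consecutive places, all of
them after the place `0`: `g i` is the number of pairs whose first place is less than `i`. -/
structure IsPairCount (g : ℕ → ℕ) : Prop where
  zero : g 0 = 0
  one : g 1 = 0
  mono : ∀ i, g i ≤ g (i + 1)
  two : ∀ i, g (i + 2) ≤ g i + 1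

/-- The sequence with symbol `1` at the place `0` and at the places of the pairs counted by `g`. -/
def pairSeq (g : ℕ → ℕ) : ℕ → Bool := fun i => decide (i = 0 ∨ g (i - 1) < g (i + 1))

theorem pairSeq_zero (g : ℕ → ℕ) : pairSeq g 0 = true := by simp [pairSeq]

theorem pairSeq_succ (g : ℕ → ℕ) (i : ℕ) : pairSeq g (i + 1) = decide (g i < g (i + 2)) := by
  simp [pairSeq]

theorem IsPairCount.toNat {g : ℕ → ℕ} (h : IsPairCount g) (i : ℕ) :
    g (i + 2) = g i + (pairSeq g (i + 1)).toNat := by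
  have h1 := h.mono i
  have h2 : g (i + 1) ≤ g (i + 2) := h.mono (i + 1)
  have h3 := h.two i
  rw [pairSeq_succ]
  by_cases h4 : g i < g (i + 2) <;> simp [h4] <;> omega

theorem IsPairCount.ones {g : ℕ → ℕ} (h : IsPairCount g) (i : ℕ) :
    ones (pairSeq g) (i + 1) = 1 + g (i + 1) + g i := by
  induction i with
  | zero => simp [UnimodalTrack.ones, pairSeq_zero, h.zero, h.one]
  | succ i ih => rw [ones_succ, ih, h.toNat i]; ring

theorem toNat_eq_one_iff (b : Bool) : b.toNat = 1 ↔ b = true := by cases b <;> simp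
theorem toNat_eq_zero_iff (b : Bool) : b.toNat = 0 ↔ b = false := by cases b <;> simp

/-- The event, in terms of the kneading sequence `s`, that the image of a strip gives the junction
of `f^r(b)` an edge below the loops, if these are at the right switch, or above them, if they are
at the left switch (see `edgesAt_inner_iff`). The parity of `ones s r` determines the switch, and
`s (r - 1)` tells on which side of the turning point the preceding junction lies. -/
def Event (s : ℕ → Bool) (r : ℕ) : Prop :=
  (s (r - 1) = false ∧ Even (ones s r)) ∨
    (s (r - 1) = true ∧ ¬ Even (ones s r) ∧ UnimodalLT (fun j => s (j + 2)) fun j => s (j + r))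

/-- Within a sequence of pairs whose counting function is almost additive there are no events. It is
enough that `s` is such a sequence up to the first difference of the sequences to be compared. -/
theorem not_event {g : ℕ → ℕ} (h : IsPairCount g) (hsub : ∀ x y, g (x + y) ≤ g x + g y + 1)
    {s : ℕ → Bool} (hs1 : s 1 = false) {r : ℕ} (hr : 2 ≤ r) (hs : ∀ j < r, s j = pairSeq g j)
    (hd : ∀ D, g (r - 1) = g (r - 2) + 1 → g r = g (r - 1) →
      FirstDiff (fun j => s (j + 2)) (fun j => s (j + r)) D →
      ∀ j ≤ r + D, s j = pairSeq g j) : ¬ Event s r := by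
  obtain ⟨r, rfl⟩ := Nat.exists_eq_add_of_le' hr
  have hO := h.ones (r + 1)
  have ht := h.toNat r
  have hm := h.mono (r + 1)
  have hm' := h.mono r
  have hO' : ones s (r + 2) = ones (pairSeq g) (r + 2) := ones_congr hs
  have hlast : s (r + 1) = pairSeq g (r + 1) := hs _ (by omega)
  simp only [add_assoc, Nat.reduceAdd] at hO hm
  rintro (⟨h1, h2⟩ | ⟨h1, h2, h3⟩)
  -- The place `r + 1` belongs to no pair, so the number of `1`s is `1` more than twice that of
  -- pairs.
  · replace h1 : s (r + 1) = false := h1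
    rw [hlast, ← toNat_eq_zero_iff] at h1
    rw [hO', hO] at h2
    have : g (r + 2) = g r := by omega
    obtain ⟨a, ha⟩ := h2
    omega
  -- A pair ends at the place `r + 1`. The order at the first difference forces a pair to come
  -- earlier in the sequence shifted by `r + 2` than in that shifted by `2`, against almost
  -- additivity.
  · replace h1 : s (r + 1) = true := h1
    rw [hlast, ← toNat_eq_one_iff] at h1
    rw [hO', hO, Nat.not_even_iff_odd] at h2
    obtain ⟨D, hD⟩ := unimodalLT_exists h3
    have hg1 : g (r + 2) = g (r + 1) := by obtain ⟨a, ha⟩ := h2; omega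
    have hg2 : g (r + 1) = g r + 1 := by omega
    have hd' := hd D hg2 hg1 hD
    have e1 : ones s (2 + D) = ones s 2 + ones (fun j => s (j + 2)) D := ones_add _ _ _
    have e2 : ones s (r + 2 + D) = ones s (r + 2) + ones (fun j => s (j + (r + 2))) D :=
      ones_add _ _ _
    rw [← hD.ones_eq] at e2
    have e3 : ones s 2 = 1 := by
      simp [ones, Finset.sum_range_succ, hs1, hs 0 (by omega), pairSeq_zero]
    rw [hD.unimodalLT_iff, ones_succ] at h3
    have e4 : ones s (2 + D) = 1 + g (D + 2) + g (D + 1) := by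
      rw [ones_congr fun j hj => hd' j (by omega), show 2 + D = D + 1 + 1 by ring, h.ones]
    have e5 : ones s (r + 2 + D) = 1 + g (r + D + 2) + g (r + D + 1) := by
      rw [ones_congr fun j hj => hd' j (by omega), show r + 2 + D = r + D + 1 + 1 by ring, h.ones]
    have e6 := h.toNat (D + 1)
    have e7 := h.toNat (r + D + 1)
    rw [show D + 1 + 1 = D + 2 by ring, ← hd' _ (by omega)] at e6
    rw [show r + D + 1 + 1 = D + (r + 2) by ring, ← hd' _ (by omega)] at e7
    have e8 : g (D + 1) ≤ g (D + 2) := h.mono _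
    have e9 : g (r + D + 1) ≤ g (r + D + 2) := h.mono _
    have e10 : g (D + 2) ≤ g (D + 1 + 2) := h.mono (D + 2)
    have e11 : g (r + D + 2) ≤ g (r + D + 1 + 2) := h.mono (r + D + 2)
    have e12 := hsub r (D + 1 + 2)
    rw [show r + (D + 1 + 2) = r + D + 1 + 2 by ring] at e12
    obtain ⟨a, ha⟩ := h3
    have hne := hD.2
    simp only at hne ha
    cases hx : s (D + 2) <;> cases hy : s (D + (r + 2)) <;> rw [hx, hy] at hne <;>
      simp only [hx, hy, Bool.toNat_true, Bool.toNat_false, ne_eq, not_true_eq_false] at * <;>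
      omega

/-! ### The extremal sequences of height `m/n` -/

/-- The number of integers `k ≥ 1` with `k ≤ i * (m / n)`. -/
def lowerCount (m n i : ℕ) : ℕ := i * m / n

/-- The number of integers `k ≥ 1` with `k < i * (m / n)`. (For `i = 0` the truncated subtraction
gives the correct value `0`.) -/
def upperCount (m n i : ℕ) : ℕ := (i * m - 1) / n

theorem add_add_one_div_le {n : ℕ} (hn : 0 < n) (a b : ℕ) :
    (a + b + 1) / n ≤ a / n + b / n + 1 := by
  rw [← Nat.lt_succ_iff, Nat.div_lt_iff_lt_mul hn]
  have h1 := Nat.lt_div_mul_add (a := a) hn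
  have h2 := Nat.lt_div_mul_add (a := b) hn
  have : (a / n + b / n + 1).succ * n = a / n * n + b / n * n + n + n := by
    rw [Nat.succ_eq_add_one]; ring
  omega

theorem succ_le_upperCount {m n : ℕ} (hn : 0 < n) (k i : ℕ) :
    k + 1 ≤ upperCount m n i ↔ (k + 1) * n < i * m := by
  rw [upperCount, Nat.le_div_iff_mul_le hn]
  have : 0 < (k + 1) * n := by positivity
  omega

theorem lowerCount_sub {m n : ℕ} (hn : 0 < n) (x y : ℕ) :
    lowerCount m n (x + y) ≤ lowerCount m n x + lowerCount m n y + 1 := by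
  refine le_trans (Nat.div_le_div_right ?_) (add_add_one_div_le hn (x * m) (y * m))
  rw [add_mul]
  exact Nat.le_succ _

theorem upperCount_sub {m n : ℕ} (hn : 0 < n) (x y : ℕ) :
    upperCount m n (x + y) ≤ upperCount m n x + upperCount m n y + 1 := by
  refine le_trans (Nat.div_le_div_right ?_) (add_add_one_div_le hn (x * m - 1) (y * m - 1))
  rw [add_mul]
  omega

theorem upperCount_super (m n x y : ℕ) :
    upperCount m n x + upperCount m n y ≤ upperCount m n (x + y) := by
  refine le_trans Nat.div_add_div_le_add_div (Nat.div_le_div_right ?_)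
  rw [add_mul]
  omega

theorem isPairCount_lowerCount {m n : ℕ} (hm : 0 < m) (hmn : 2 * m ≤ n) :
    IsPairCount (lowerCount m n) where
  zero := by simp [lowerCount]
  one := by simp only [lowerCount]; exact Nat.div_eq_of_lt (by omega)
  mono i := Nat.div_le_div_right (Nat.mul_le_mul_right _ (by omega))
  two i := by
    rw [lowerCount, lowerCount, ← Nat.add_div_right _ (by omega : 0 < n)]
    exact Nat.div_le_div_right (by rw [add_mul]; omega)

theorem isPairCount_upperCount {m n : ℕ} (hm : 0 < m) (hmn : 2 * m ≤ n) :
    IsPairCount (upperCount m n) where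
  zero := by simp [upperCount]
  one := by simp only [upperCount]; exact Nat.div_eq_of_lt (by omega)
  mono i := Nat.div_le_div_right (Nat.sub_le_sub_right (Nat.mul_le_mul_right _ (by omega)) _)
  two i := by
    rw [upperCount, upperCount]
    rcases Nat.eq_zero_or_pos i with rfl | hi
    · simp only [zero_add, zero_mul, zero_tsub, Nat.zero_div]
      rw [Nat.div_eq_of_lt (by omega)]; omega
    rw [← Nat.add_div_right _ (by omega : 0 < n)]
    have : 0 < i * m := by positivity
    exact Nat.div_le_div_right (by rw [add_mul]; omega)

theorem upperCount_two {m n : ℕ} (hm : 0 < m) (hmn : 2 * m ≤ n) : upperCount m n 2 = 0 :=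
  Nat.div_eq_of_lt (by omega)

theorem upperCount_n {m n : ℕ} (hm : 0 < m) (hmn : 2 * m ≤ n) : upperCount m n n = m - 1 := by
  rw [upperCount, Nat.div_eq_iff (by omega)]
  obtain ⟨m, rfl⟩ := Nat.exists_eq_add_of_le' hm
  simp only [Nat.add_sub_cancel, mul_add, mul_comm m n]
  omega

theorem upperCount_n_sub_one {m n : ℕ} (hm : 0 < m) (hmn : 2 * m ≤ n) :
    upperCount m n (n - 1) = m - 1 := by
  rw [upperCount, Nat.div_eq_iff (by omega)]
  obtain ⟨m, rfl⟩ := Nat.exists_eq_add_of_le' hm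
  obtain ⟨n, rfl⟩ := Nat.exists_eq_add_of_le' (by omega : 1 ≤ n)
  simp only [Nat.add_sub_cancel, mul_add, mul_one, mul_comm m n]
  omega

theorem upperCount_add_n {m n : ℕ} (hm : 0 < m) (hmn : 2 * m ≤ n) {i : ℕ} (hi : 0 < i) :
    upperCount m n (i + n) = upperCount m n i + m := by
  have hpos : 0 < i * m := by positivity
  rw [upperCount, upperCount, add_mul, show i * m + n * m - 1 = i * m - 1 + m * n by
    rw [mul_comm n m]; omega, Nat.add_mul_div_right _ _ (by omega)]

theorem lowerCount_add_n {m n : ℕ} (hmn : 0 < n) (i : ℕ) :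
    lowerCount m n (i + n) = lowerCount m n i + m := by
  rw [lowerCount, lowerCount, add_mul, mul_comm n m, Nat.add_mul_div_right _ _ hmn]

theorem lowerCount_eq_upperCount {m n : ℕ} (hm : 0 < m) (hc : Nat.Coprime m n) {i : ℕ}
    (hi : i < n) : lowerCount m n i = upperCount m n i := by
  rcases Nat.eq_zero_or_pos i with rfl | hi0
  · simp [lowerCount, upperCount]
  have hnd : ¬ n ∣ i * m := fun h =>
    absurd (Nat.le_of_dvd hi0 (hc.symm.dvd_of_dvd_mul_right h)) (by omega)
  have hpos : 0 < i * m := by positivity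
  rw [lowerCount, upperCount]
  obtain ⟨k, hk⟩ : ∃ k, i * m = k + 1 := ⟨i * m - 1, by omega⟩
  rw [hk] at hnd ⊢
  rw [Nat.succ_div_of_not_dvd hnd, Nat.add_sub_cancel]

/-- The least sequence of height `m/n`. -/
def lowerSeq (m n : ℕ) : ℕ → Bool := pairSeq (lowerCount m n)

/-- The greatest sequence of height `m/n`. -/
def upperSeq (m n : ℕ) : ℕ → Bool := pairSeq (upperCount m n)

theorem lowerSeq_eq_upperSeq {m n : ℕ} (hm : 0 < m) (hc : Nat.Coprime m n) {j : ℕ}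
    (hj : j + 1 < n) : lowerSeq m n j = upperSeq m n j := by
  rw [lowerSeq, upperSeq, pairSeq, pairSeq, lowerCount_eq_upperCount hm hc hj,
    lowerCount_eq_upperCount hm hc (by omega)]

theorem upperSeq_one {m n : ℕ} (hm : 0 < m) (hmn : 2 * m ≤ n) : upperSeq m n 1 = false := by
  rw [upperSeq, pairSeq_succ, upperCount_two hm hmn]
  simp

theorem upperSeq_n_sub_one {m n : ℕ} (hm : 0 < m) (hmn : 2 * m ≤ n)
    (hc : Nat.Coprime m n) : upperSeq m n (n - 1) = false := by
  rcases Nat.lt_or_ge n 3 with hn | hn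
  · obtain rfl : n = 2 := by omega
    exact upperSeq_one hm hmn
  have h := (isPairCount_upperCount hm hmn).toNat (n - 2)
  have h1 := (isPairCount_upperCount hm hmn).mono (n - 2)
  have h3 := upperCount_n hm hmn
  rw [← toNat_eq_zero_iff, upperSeq]
  rw [show n - 2 + 2 = n by omega, show n - 2 + 1 = n - 1 by omega] at h
  rw [show n - 2 + 1 = n - 1 by omega, upperCount_n_sub_one hm hmn] at h1
  have h4 : m - 1 ≤ upperCount m n (n - 2) := by
    rcases Nat.lt_or_ge m 2 with hm2 | hm2
    · omega
    have hne : 2 * m ≠ n := fun h => by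
      have := Nat.Coprime.eq_one_of_dvd hc (Dvd.intro_left 2 h)
      omega
    have := (succ_le_upperCount (m := m) (by omega : 0 < n) (m - 2) (n - 2)).2 (by
      obtain ⟨m, rfl⟩ := Nat.exists_eq_add_of_le' hm2
      obtain ⟨n, rfl⟩ := Nat.exists_eq_add_of_le' (by omega : 2 ≤ n)
      have e1 : (m + 2 - 2 + 1) * (n + 2) = m * n + 2 * m + n + 2 := by
        rw [Nat.add_sub_cancel]; ring
      have e2 : (n + 2 - 2) * (m + 2) = m * n + 2 * n := by rw [Nat.add_sub_cancel]; ring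
      omega)
    omega
  omega

theorem upperSeq_n {m n : ℕ} (hm : 0 < m) (hmn : 2 * m ≤ n) : upperSeq m n n = true := by
  have h := (isPairCount_upperCount hm hmn).toNat (n - 1)
  rw [show n - 1 + 2 = 1 + n by omega, upperCount_add_n hm hmn one_pos,
    (isPairCount_upperCount hm hmn).one, upperCount_n_sub_one hm hmn,
    show n - 1 + 1 = n by omega] at h
  rw [← toNat_eq_one_iff, upperSeq]
  omega

theorem upperSeq_add_n {m n : ℕ} (hm : 0 < m) (hmn : 2 * m ≤ n) {j : ℕ} (hj : 2 ≤ j) :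
    upperSeq m n (j + n) = upperSeq m n j := by
  obtain ⟨j, rfl⟩ := Nat.exists_eq_add_of_le' hj
  rw [upperSeq, show j + 2 + n = j + 1 + n + 1 by ring, pairSeq_succ, pairSeq_succ,
    upperCount_add_n hm hmn (by omega), show j + 1 + n + 2 = j + 1 + 2 + n by ring,
    upperCount_add_n hm hmn (by omega), decide_eq_decide]
  omega

theorem upperSeq_n_add_one {m n : ℕ} (hm : 0 < m) (hmn : 2 * m ≤ n) :
    upperSeq m n (n + 1) = true := by
  have h := (isPairCount_upperCount hm hmn).toNat n
  rw [show n + 2 = 2 + n by omega, upperCount_add_n hm hmn two_pos,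
    upperCount_two hm hmn, upperCount_n hm hmn] at h
  rw [← toNat_eq_one_iff, upperSeq]
  omega

theorem ones_upperSeq_n {m n : ℕ} (hm : 0 < m) (hmn : 2 * m ≤ n) :
    ones (upperSeq m n) n = 2 * m - 1 := by
  have h := (isPairCount_upperCount hm hmn).ones (n - 1)
  rw [show n - 1 + 1 = n by omega, upperCount_n hm hmn, upperCount_n_sub_one hm hmn] at h
  rw [upperSeq]
  omega

theorem lowerSeq_add_n {m n : ℕ} (hm : 0 < m) (hmn : 2 * m ≤ n)
    (j : ℕ) : lowerSeq m n (j + n) = lowerSeq m n j := by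
  have hn : 0 < n := by omega
  rcases Nat.eq_zero_or_pos j with rfl | hj
  · have h : lowerCount m n n = lowerCount m n 0 + m := by
      rw [← lowerCount_add_n hn, zero_add]
    have h1 := (isPairCount_lowerCount hm hmn).two (n - 1)
    have h2 := lowerCount_add_n (m := m) hn 1
    have h3 := (isPairCount_lowerCount hm hmn).one
    have h4 : lowerCount m n (n - 1) < m := (Nat.div_lt_iff_lt_mul hn).2 (by
      obtain ⟨n, rfl⟩ := Nat.exists_eq_add_of_le' (by omega : 1 ≤ n)
      rw [Nat.add_sub_cancel, mul_add, mul_comm n m]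
      omega)
    rw [zero_add, lowerSeq, pairSeq_zero, pairSeq, decide_eq_true_iff, add_comm n 1]
    omega
  · obtain ⟨j, rfl⟩ := Nat.exists_eq_add_of_le' hj
    rw [lowerSeq, show j + 1 + n = j + n + 1 by ring, pairSeq_succ, pairSeq_succ,
      lowerCount_add_n hn, show j + n + 2 = j + 2 + n by ring, lowerCount_add_n hn,
      decide_eq_decide]
    omega

theorem lowerSeq_n_sub_one {m n : ℕ} (hm : 0 < m) (hmn : 2 * m ≤ n) :
    lowerSeq m n (n - 1) = true := by
  have hn : 0 < n := by omega
  have h : lowerCount m n n = lowerCount m n 0 + m := by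
      rw [← lowerCount_add_n hn, zero_add]
  rw [lowerSeq, pairSeq, decide_eq_true_iff, show n - 1 + 1 = n by omega, h,
    (isPairCount_lowerCount hm hmn).zero]
  rw [lowerCount, zero_add, Nat.div_lt_iff_lt_mul hn]
  obtain ⟨n, rfl⟩ := Nat.exists_eq_add_of_le' (by omega : 2 ≤ n)
  right
  rw [show n + 2 - 1 - 1 = n by omega, mul_add, mul_comm n m]
  omega

theorem ones_lowerSeq_n {m n : ℕ} (hm : 0 < m) (hmn : 2 * m ≤ n)
    (hc : Nat.Coprime m n) : ones (lowerSeq m n) n = 2 * m := by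
  have h1 : n = n - 1 + 1 := by omega
  have h2 := ones_upperSeq_n hm hmn
  rw [h1, ones_succ] at h2 ⊢
  rw [← h1] at h2 ⊢
  rw [upperSeq_n_sub_one hm hmn hc] at h2
  rw [lowerSeq_n_sub_one hm hmn,
    ones_congr (t := upperSeq m n) fun j hj => lowerSeq_eq_upperSeq hm hc (by omega : j + 1 < n)]
  simp at h2 ⊢
  omega

/-! ### Periodic kneading sequences of height `m/n` -/

/-- A sequence with the properties of the kneading sequence of a unimodal map whose turning point
has period `N`, which lies between the extremal sequences of height `m/n`. -/
structure IsKneading (s : ℕ → Bool) (N m n : ℕ) : Prop where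
  m_pos : 0 < m
  le : 2 * m ≤ n
  coprime : Nat.Coprime m n
  three_le : 3 ≤ N
  periodic : ∀ j, s (j + N) = s j
  zero : s 0 = true
  one : s 1 = false
  last : s (N - 1) = true
  maximal : ∀ k, ¬ UnimodalLT s fun j => s (j + k)
  lower : ¬ UnimodalLT s (lowerSeq m n)
  upper : ¬ UnimodalLT (upperSeq m n) s

namespace IsKneading

variable {s : ℕ → Bool} {N m n : ℕ}

theorem eq_lowerSeq_of_lt (h : IsKneading s N m n) : ∀ j < n - 1, s j = lowerSeq m n j :=
  eq_of_between (fun _ hj => lowerSeq_eq_upperSeq h.m_pos h.coprime (by omega)) h.lower h.upper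

/-- The greatest sequence of height `m/n` is not purely periodic. -/
theorem ne_upperSeq (h : IsKneading s N m n) : s ≠ upperSeq m n := by
  intro he
  have h1 := h.three_le
  have h2 : s (1 + N + n) = s (1 + N) := by
    rw [he]; exact upperSeq_add_n h.m_pos h.le (by omega)
  rw [show 1 + N + n = n + 1 + N by ring, h.periodic, h.periodic, h.one, he,
    upperSeq_n_add_one h.m_pos h.le] at h2
  exact absurd h2 (by simp)

/-- If the symbol at the place `n - 1` is that of the least sequence of height `m/n`, then
maximality forces `s` to be this sequence. -/
theorem eq_lowerSeq (h : IsKneading s N m n) (hs : s (n - 1) = true) : s = lowerSeq m n := by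
  by_contra hne
  have hle := h.le
  have hm := h.m_pos
  obtain ⟨D, hD⟩ := exists_firstDiff hne
  have hDn : n ≤ D := by
    by_contra hDn
    rcases Nat.lt_or_ge D (n - 1) with h1 | h1
    · exact hD.2 (h.eq_lowerSeq_of_lt D h1)
    · obtain rfl : D = n - 1 := by omega
      exact hD.2 (by rw [hs, lowerSeq_n_sub_one hm hle])
  obtain ⟨d, rfl⟩ := Nat.exists_eq_add_of_le' hDn
  have h1 : ¬ UnimodalLT s (lowerSeq m n) := h.lower
  have h2 := hD.shift_unimodalLT
  have h3 : Even (ones s n) := by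
    rw [ones_congr (t := lowerSeq m n) fun j hj => hD.1 j (by omega),
      ones_lowerSeq_n hm hle h.coprime]
    exact even_two_mul m
  have hper : (fun j => lowerSeq m n (j + n)) = lowerSeq m n :=
    funext (lowerSeq_add_n hm hle)
  have h4 := hD.shift
  rw [hper] at h2 h4
  obtain ⟨h5, h6⟩ := h4.congr_right (t' := s) fun j hj => (hD.1 j (by omega)).symm
  refine h.maximal n (h5.unimodalLT_iff_not.not_left.1 ?_)
  rw [h6, h2]
  tauto

/-- Apart from the least sequence, all sequences of height `m/n` begin with the word `c_q`. -/
theorem eq_upperSeq_of_le (h : IsKneading s N m n) (hne : s ≠ lowerSeq m n) :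
    ∀ j ≤ n, s j = upperSeq m n j := by
  have hle := h.le
  have hm := h.m_pos
  have h1 : ∀ j < n, s j = upperSeq m n j := by
    intro j hj
    rcases Nat.lt_or_ge j (n - 1) with h1 | h1
    · rw [h.eq_lowerSeq_of_lt j h1, lowerSeq_eq_upperSeq hm h.coprime (by omega)]
    · obtain rfl : j = n - 1 := by omega
      rw [upperSeq_n_sub_one hm hle h.coprime]
      by_contra h2
      exact hne (h.eq_lowerSeq (by simpa using h2))
  intro j hj
  rcases Nat.lt_or_eq_of_le hj with h2 | rfl
  · exact h1 j h2
  by_contra h2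
  have hD : FirstDiff (upperSeq m j) s j := ⟨fun i hi => (h1 i hi).symm, Ne.symm h2⟩
  refine h.upper (hD.unimodalLT_iff.2 ?_)
  rw [ones_succ, ones_upperSeq_n hm hle, upperSeq_n hm hle]
  exact ⟨m, by simp; omega⟩

theorem exists_firstDiff_upperSeq (h : IsKneading s N m n) (hne : s ≠ lowerSeq m n) :
    ∃ D, n < D ∧ FirstDiff s (upperSeq m n) D ∧
    UnimodalLT s (upperSeq m n) := by
  obtain ⟨D, hD⟩ := exists_firstDiff h.ne_upperSeq
  refine ⟨D, ?_, hD, hD.unimodalLT_iff_not.2 h.upper⟩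
  by_contra h1
  exact hD.2 (h.eq_upperSeq_of_le hne D (by omega))

theorem not_even_ones_n (h : IsKneading s N m n) (hne : s ≠ lowerSeq m n) :
    ¬ Even (ones s n) := by
  have := h.m_pos
  rw [ones_congr (t := upperSeq m n) fun j hj => h.eq_upperSeq_of_le hne j (by omega),
    ones_upperSeq_n h.m_pos h.le, Nat.not_even_iff_odd]
  exact ⟨m - 1, by omega⟩

theorem even_ones_n_add_one (h : IsKneading s N m n) (hne : s ≠ lowerSeq m n) :
    Even (ones s (n + 1)) := by
  rw [ones_succ, h.eq_upperSeq_of_le hne n le_rfl, upperSeq_n h.m_pos h.le]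
  simpa [Nat.even_add_one] using h.not_even_ones_n hne

/-- At time `n + 2` there is an event: the comparison of `s` with the greatest sequence of height
`m/n` is carried, by deleting the first `n + 2` symbols, to the comparison required. -/
theorem event (h : IsKneading s N m n) (hne : s ≠ lowerSeq m n) :
    Event s (n + 2) := by
  have he := h.even_ones_n_add_one hne
  rw [Event, show n + 2 - 1 = n + 1 by omega, ones_succ]
  cases hs : s (n + 1)
  · exact .inl ⟨rfl, by simpa using he⟩
  refine .inr ⟨rfl, by simpa [Nat.even_add_one] using he, ?_⟩
  obtain ⟨D, hDn, hD, hlt⟩ := h.exists_firstDiff_upperSeq hne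
  have hD1 : D ≠ n + 1 := by
    rintro rfl
    exact hD.2 (by rw [hs, upperSeq_n_add_one h.m_pos h.le])
  obtain ⟨d, rfl⟩ := Nat.exists_eq_add_of_le' (by omega : n + 2 ≤ D)
  have h1 := hD.shift_unimodalLT
  have h2 : ¬ Even (ones s (n + 2)) := by
    rw [ones_succ, hs]
    simpa [Nat.even_add_one] using he
  have hper : (fun j => upperSeq m n (j + (n + 2))) = fun j => upperSeq m n (j + 2) :=
    funext fun j => by
      rw [show j + (n + 2) = j + 2 + n by ring, upperSeq_add_n h.m_pos h.le (by omega)]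
  have h3 := hD.shift
  have hn := h.le
  have hm := h.m_pos
  rw [hper] at h1 h3
  obtain ⟨h4, h5⟩ := h3.congr_right (t' := fun j => s (j + 2))
    fun j hj => (hD.1 (j + 2) (by omega)).symm
  refine h4.symm.unimodalLT_iff_not.2 ?_
  rw [h5, h1]
  tauto

/-- There is no earlier event: `s` agrees with the greatest sequence of height `m/n` up to the place
`n`, which is far enough for the comparisons in question. -/
theorem not_event_of_le (h : IsKneading s N m n) (hne : s ≠ lowerSeq m n)
    {r : ℕ} (hr : 2 ≤ r) (hrn : r ≤ n + 1) : ¬ Event s r := by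
  have hle := h.le
  have hm := h.m_pos
  have hs := h.eq_upperSeq_of_le hne
  refine not_event (isPairCount_upperCount h.m_pos h.le) (upperCount_sub (by omega)) h.one hr
    (fun j hj => hs j (by omega)) fun D hg1 hg2 hD j hj => hs j ?_
  -- The pair at `r - 2, r - 1` corresponds, under the symmetry `i ↦ n - i`, to a pair that begins
  -- at `n - r + 1`. Hence the two sequences differ when the second of them reaches the place `n -
  -- 1`.
  by_contra hjn
  obtain ⟨r, rfl⟩ := Nat.exists_eq_add_of_le' hr
  have hD' := hD.1
  have hr0 : r ≠ 0 := by
    rintro rfl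
    have := (isPairCount_upperCount hm hle).one
    have := (isPairCount_upperCount hm hle).zero
    simp at hg1
    omega
  have hc : r * m ≠ upperCount m n (r + 1) * n := fun h1 =>
    absurd (Nat.le_of_dvd (by omega)
      (h.coprime.symm.dvd_of_dvd_mul_right (Dvd.intro_left _ h1.symm))) (by omega)
  simp only [Nat.add_succ_sub_one, Nat.add_sub_cancel] at hg1 hg2
  have hz := upperSeq_n_sub_one hm hle h.coprime
  have hrn2 : r + 3 ≤ n := by
    by_contra hcon
    rcases (by omega : r = n - 1 ∨ r = n - 2) with rfl | rfl
    · rw [show n - 1 + 1 = n by omega, upperCount_n hm hle, upperCount_n_sub_one hm hle] at hg1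
      omega
    · have h1 := (isPairCount_upperCount hm hle).toNat (n - 2)
      rw [show n - 2 + 1 = n - 1 by omega] at hg1 hg2 h1
      have h2 : (pairSeq (upperCount m n) (n - 1)).toNat = 0 := by
        rw [toNat_eq_zero_iff]; exact hz
      omega
  obtain ⟨d, rfl⟩ := Nat.exists_eq_add_of_le' hrn2
  have h1 : s (d + 2) = s (d + (r + 2)) := hD' d (by omega)
  rw [hs _ (by omega), hs _ (by omega), show d + (r + 2) = d + (r + 3) - 1 by omega, hz,
    upperSeq, pairSeq_succ, decide_eq_false_iff_not] at h1
  have h2 : ¬ upperCount m (d + (r + 3)) r + 1 ≤ upperCount m (d + (r + 3)) r := by omega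
  rw [succ_le_upperCount (by omega), ← hg1] at h2
  have h3 := hg1.ge
  rw [succ_le_upperCount (by omega), ← hg1] at h3
  obtain ⟨j, hmj⟩ : ∃ j, m = upperCount m (d + (r + 3)) (r + 1) + (j + 1) := by
    refine ⟨m - upperCount m (d + (r + 3)) (r + 1) - 1, ?_⟩
    suffices upperCount m (d + (r + 3)) (r + 1) < m by omega
    exact Nat.lt_of_mul_lt_mul_right (h3.trans_le (Nat.mul_le_mul (by omega) le_rfl) |>.trans_eq
      (mul_comm (d + (r + 3)) m))
  generalize upperCount m (d + (r + 3)) (r + 1) = k at h2 h3 hc hmj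
  subst hmj
  have h4 := (succ_le_upperCount (m := k + (j + 1)) (by omega : 0 < d + (r + 3)) j (d + 1 + 2)).2
    (by rcases Nat.lt_or_gt_of_ne hc with hc | hc <;> nlinarith)
  have h5 : ¬ j + 1 ≤ upperCount (k + (j + 1)) (d + (r + 3)) (d + 1) := by
    rw [succ_le_upperCount (by omega)]
    nlinarith
  omega

/-- The period of `s` is at least `n + 2`. -/
theorem n_add_two_le (h : IsKneading s N m n) (hne : s ≠ lowerSeq m n) :
    n + 2 ≤ N := by
  by_contra hN
  have hle := h.le
  have hm := h.m_pos
  have h3 := h.three_le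
  have hg := isPairCount_upperCount hm hle
  have hs := h.eq_upperSeq_of_le hne
  -- The places `N - 1` and `N` form a pair.
  have hN1 : upperCount m n N = upperCount m n (N - 1) + 1 := by
    rcases (by omega : N = n + 1 ∨ N = n ∨ N + 1 ≤ n) with rfl | rfl | hN1
    · rw [add_comm n 1, upperCount_add_n hm hle one_pos, hg.one, show 1 + n - 1 = n by omega,
        upperCount_n hm hle]
      omega
    · have := h.last
      rw [hs _ (by omega), upperSeq_n_sub_one hm hle h.coprime] at this
      exact absurd this (by simp)
    · have h4 : (upperSeq m n (N + 1)).toNat = 0 := by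
        rw [← hs _ hN1, add_comm, h.periodic, h.one]; rfl
      have h5 : (upperSeq m n N).toNat = 1 := by
        rw [← hs _ (by omega), ← zero_add N, h.periodic, h.zero]; rfl
      have h6 := hg.toNat N
      have h7 := hg.toNat (N - 1)
      rw [show N - 1 + 1 = N by omega, show N - 1 + 2 = N + 1 by omega] at h7
      have h8 := hg.mono N
      have h9 : upperCount m n (N + 1) ≤ upperCount m n (N + 2) := hg.mono (N + 1)
      rw [upperSeq] at h4 h5
      omega
  obtain ⟨D, hDn, hD, hlt⟩ := h.exists_firstDiff_upperSeq hne
  obtain ⟨d, rfl⟩ := Nat.exists_eq_add_of_le' (by omega : N ≤ D)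
  have hO : ones (pairSeq (upperCount m n)) N = 2 * upperCount m n N := by
    have := hg.ones (N - 1)
    rw [show N - 1 + 1 = N by omega] at this
    omega
  have h4 := hD.shift_unimodalLT
  have h5 := hD.shift
  have hev : Even (ones s N) := by
    rw [ones_congr (t := upperSeq m n) fun j hj => hs j (by omega), upperSeq, hO]
    exact even_two_mul _
  rw [show (fun j => s (j + N)) = s from funext h.periodic] at h4 h5
  have h6 : UnimodalLT s fun j => upperSeq m n (j + N) := by tauto
  -- Hence the greatest sequence would be less than one of its own shifts.
  obtain ⟨h7, h8⟩ := h5.symm.congr_right (t' := upperSeq m n) fun j hj => hD.1 j (by omega)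
  have h9 := h7.symm.unimodalLT_iff_not.2 fun h9 => (h8.1 h9).asymm h6
  rw [h7.symm.unimodalLT_iff] at h9
  have h10 : upperSeq m n (d + N) ≠ upperSeq m n d := h7.2
  have h11 := h7.symm.ones_eq
  have h12 : d ≠ 0 := by
    rintro rfl
    rw [zero_add, upperSeq, pairSeq_zero, pairSeq] at h10
    have := hg.mono N
    exact h10 (decide_eq_true (.inr (by omega)))
  obtain ⟨d, rfl⟩ := Nat.exists_eq_succ_of_ne_zero h12
  have h13 : ones (upperSeq m n) (N + (d + 1)) = ones (upperSeq m n) N + _ := ones_add _ _ _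
  have h14 := hg.ones d
  have h15 := hg.ones (N + d)
  have h16 := hg.toNat d
  have h17 := hg.toNat (N + d)
  have h18 := upperCount_super m n N (d + 2)
  have h19 := hg.mono d
  have h20 := hg.mono (N + d)
  have h21 : upperCount m n (d + 1) ≤ upperCount m n (d + 2) := hg.mono (d + 1)
  have h22 : upperCount m n (N + d + 1) ≤ upperCount m n (N + d + 2) := hg.mono (N + d + 1)
  rw [ones_succ] at h9
  rw [show d.succ + N = N + d + 1 by omega] at h10
  simp only [Nat.succ_eq_add_one, upperSeq] at *
  rw [← add_assoc] at h13 h18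
  obtain ⟨a, ha⟩ := h9
  cases hx : pairSeq (upperCount m n) (d + 1) <;>
    cases hy : pairSeq (upperCount m n) (N + d + 1) <;> rw [hx, hy] at h10 <;>
    simp only [hx, hy, Bool.toNat_true, Bool.toNat_false, ne_eq, not_true_eq_false] at * <;>
    omega

theorem not_event_lowerSeq (h : IsKneading s N m n) (he : s = lowerSeq m n) {r : ℕ}
    (hr : 2 ≤ r) : ¬ Event s r := by
  have hle := h.le
  have hm := h.m_pos
  exact not_event (isPairCount_lowerCount hm hle) (lowerCount_sub (by omega)) h.one hr
    (fun j _ => by rw [he, lowerSeq]) fun _ _ _ _ j _ => by rw [he, lowerSeq]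

theorem not_even_ones_lowerSeq (h : IsKneading s N m n) (he : s = lowerSeq m n) :
    ¬ Even (ones s (N - 1)) := by
  have h3 := h.three_le
  have hg := isPairCount_lowerCount h.m_pos h.le
  have h4 : (lowerSeq m n (N + 1)).toNat = 0 := by
    rw [← he, add_comm, h.periodic, h.one]; rfl
  have h5 : (lowerSeq m n N).toNat = 1 := by
    rw [← he, ← zero_add N, h.periodic, h.zero]; rfl
  have h6 := hg.toNat N
  have h7 := hg.toNat (N - 1)
  rw [show N - 1 + 1 = N by omega, show N - 1 + 2 = N + 1 by omega] at h7
  have h8 := hg.mono N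
  have h9 : lowerCount m n (N + 1) ≤ lowerCount m n (N + 2) := hg.mono (N + 1)
  have h10 := hg.ones (N - 1)
  have h11 := ones_succ s (N - 1)
  have h12 := hg.mono (N - 1)
  rw [h.last, he] at h11
  rw [lowerSeq] at h4 h5 h11
  rw [show N - 1 + 1 = N by omega] at h10 h11 h12
  rw [Bool.toNat_true] at h11
  rw [he, lowerSeq, Nat.not_even_iff_odd]
  exact ⟨lowerCount m n (N - 1), by omega⟩

end IsKneading

/-! ### The words `c_q` and the height -/

theorem upperCount_lt_iff {m n : ℕ} (hn : 0 < n) (i j : ℕ) :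
    upperCount m n i < upperCount m n j ↔ ∃ k, 0 < k ∧ k * n < j * m ∧ ¬ k * n < i * m := by
  constructor
  · intro h
    refine ⟨upperCount m n i + 1, by omega, (succ_le_upperCount hn _ _).1 h, fun h' => ?_⟩
    have := (succ_le_upperCount hn _ _).2 h'
    omega
  · rintro ⟨k, hk, h1, h2⟩
    obtain ⟨k, rfl⟩ := Nat.exists_eq_add_of_le' hk
    have h3 := (succ_le_upperCount hn _ _).2 h1
    have h4 := mt (succ_le_upperCount hn k i).1 h2
    omega

theorem cast_toNat_num {q : ℚ} (hq : 0 < q) : ((q.num.toNat : ℕ) : ℤ) = q.num :=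
  Int.toNat_of_nonneg (Rat.num_nonneg.2 hq.le)

theorem eq_div {q : ℚ} (hq : 0 < q) : q = (q.num.toNat : ℚ) / (q.den : ℚ) := by
  have h : ((q.num.toNat : ℕ) : ℚ) = (q.num : ℚ) := by exact_mod_cast cast_toNat_num hq
  rw [h]
  exact (Rat.num_div_den q).symm

theorem toNat_num_pos {q : ℚ} (hq : 0 < q) : 0 < q.num.toNat := by
  have := Rat.num_pos.2 hq
  omega

theorem two_mul_num_le {q : ℚ} (hq : 0 < q) (hq2 : q ≤ 1 / 2) : 2 * q.num.toNat ≤ q.den := by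
  have hd : (0 : ℚ) < q.den := by exact_mod_cast q.den_pos
  rw [eq_div hq, div_le_div_iff₀ hd two_pos] at hq2
  have : (q.num.toNat * 2 : ℚ) ≤ q.den := by linarith
  have : q.num.toNat * 2 ≤ q.den := by exact_mod_cast this
  omega

theorem coprime_num {q : ℚ} (hq : 0 < q) : Nat.Coprime q.num.toNat q.den := by
  have h := Rat.num_pos.2 hq
  have := q.reduced
  rwa [show q.num.natAbs = q.num.toNat by omega] at this

/-- In the definition of `cWord` the index `i` is a real number, taken from a list of natural
numbers by coercion; here it is a natural number. -/
theorem cWord_eq (q : ℚ) : cWord q = (List.range (q.den + 1)).map fun i : ℕ =>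
    decide (∃ x : ℝ, 0 ≤ x ∧ x ≤ q.den ∧ (i : ℝ) - 1 < x ∧ x < (i : ℝ) + 1 ∧
      ∃ k : ℤ, (q : ℝ) * x = k) := by
  rw [cWord]
  simp only [List.pure_def, List.bind_eq_flatMap, ← List.map_eq_flatMap, List.map_map]
  rfl

/-- The symbols of `c_q` mark the pairs of the greatest sequence of height `q`: there is a
multiple of `1/q` in the interval `(i - 1, i + 1)` if and only if the number of positive multiples
less than `i + 1` is greater than that of those less than `i - 1`. (Multiples of `1/q` equal to `i
- 1` occur within the first `q.den + 1` places only for `i = 1`.) -/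
theorem cWord_getD {q : ℚ} (hq : 0 < q) (hq2 : q ≤ 1 / 2) {i : ℕ} (hi : i ≤ q.den) :
    (cWord q).getD i false = upperSeq q.num.toNat q.den i := by
  have hm := toNat_num_pos hq
  have hle := two_mul_num_le hq hq2
  have hc := coprime_num hq
  have hr : (q : ℝ) = (q.num.toNat : ℝ) / (q.den : ℝ) := by
    have := congrArg (Rat.cast : ℚ → ℝ) (eq_div hq)
    push_cast at this
    exact this
  rw [cWord_eq, List.getD_eq_getElem _ _ (by simpa using Nat.lt_succ_of_le hi), List.getElem_map,
    List.getElem_range, upperSeq, pairSeq, decide_eq_decide, hr]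
  generalize q.num.toNat = m at *
  generalize q.den = n at *
  have hn : (0 : ℝ) < n := by exact_mod_cast (by omega : 0 < n)
  have hm' : (0 : ℝ) < m := by exact_mod_cast hm
  constructor
  · rintro ⟨x, hx0, hxn, hx1, hx2, k, hk⟩
    by_cases hi0 : i = 0
    · exact .inl hi0
    obtain ⟨i, rfl⟩ := Nat.exists_eq_succ_of_ne_zero hi0
    right
    rw [upperCount_lt_iff (by omega)]
    have hx : x = k * n / m := by rw [← hk]; field_simp
    push_cast at hx1 hx2
    have hxpos : 0 < x := by
      have : (0 : ℝ) ≤ i := Nat.cast_nonneg i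
      linarith
    have hk0 : 0 < k := by
      have : (0 : ℝ) < k := by rw [← hk]; positivity
      exact_mod_cast this
    lift k to ℕ using hk0.le
    rw [hx] at hx1 hx2
    rw [div_lt_iff₀ hm'] at hx2
    rw [lt_div_iff₀ hm'] at hx1
    refine ⟨k, by exact_mod_cast hk0, ?_, ?_⟩
    · have : (k * n : ℝ) < (i + 1 + 1 : ℕ) * m := by push_cast at hx2 ⊢; linarith
      exact_mod_cast this
    · have : (i * m : ℝ) < (k * n : ℝ) := by push_cast at hx1 ⊢; linarith
      have : i * m < k * n := by exact_mod_cast this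
      simp only [Nat.succ_eq_add_one, Nat.add_sub_cancel]
      omega
  · rintro (rfl | h)
    · exact ⟨0, le_rfl, hn.le, by norm_num, by norm_num, 0, by simp⟩
    · rw [upperCount_lt_iff (by omega)] at h
      obtain ⟨k, hk, h1, h2⟩ := h
      have hkm : k ≤ m := by
        by_contra hkm
        have : (m + 1) * n ≤ k * n := Nat.mul_le_mul_right _ (by omega)
        have : (i + 1) * m ≤ (n + 1) * m := Nat.mul_le_mul_right _ (by omega)
        nlinarith
      have h3 : (i - 1) * m ≠ k * n := fun h3 => by
        rcases Nat.eq_zero_or_pos (i - 1) with h4 | h4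
        · rw [h4, zero_mul] at h3
          have : 0 < k * n := Nat.mul_pos hk (by omega)
          omega
        · have := Nat.le_of_dvd h4 (hc.symm.dvd_of_dvd_mul_right (Dvd.intro_left _ h3.symm))
          omega
      have h5 : ((i : ℝ) - 1) * m < k * n := by
        rcases Nat.eq_zero_or_pos i with rfl | hi0
        · have : (0 : ℝ) ≤ k * n := by positivity
          push_cast; linarith
        · have h6 : (i - 1) * m < k * n := by omega
          have : (((i - 1 : ℕ) : ℝ)) * m < k * n := by exact_mod_cast h6
          rwa [Nat.cast_sub hi0, Nat.cast_one] at this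
      refine ⟨k * n / m, by positivity, ?_, ?_, ?_, k, ?_⟩
      · rw [div_le_iff₀ hm', mul_comm]
        exact mul_le_mul_of_nonneg_left (by exact_mod_cast hkm) hn.le
      · rwa [lt_div_iff₀ hm']
      · rw [div_lt_iff₀ hm']
        exact_mod_cast h1
      · push_cast
        field_simp

theorem length_cWord (q : ℚ) : (cWord q).length = q.den + 1 := by simp [cWord]

theorem nbt_eq_upperSeq {q : ℚ} (hq : 0 < q) (hq2 : q ≤ 1 / 2) {j : ℕ} (hj : j ≤ q.den) :
    nbt q j = upperSeq q.num.toNat q.den j := by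
  rw [nbt, periodicSeq, List.length_append, length_cWord, List.length_singleton,
    Nat.mod_eq_of_lt (by omega), List.getD_append _ _ _ _ (by rw [length_cWord]; omega),
    cWord_getD hq hq2 hj]

theorem nbt_den_add_one (q : ℚ) : nbt q (q.den + 1) = true := by
  rw [nbt, periodicSeq, List.length_append, length_cWord, List.length_singleton,
    Nat.mod_eq_of_lt (by omega), List.getD_append_right _ _ _ _ (by rw [length_cWord]),
    length_cWord]
  simp

theorem periodicSeq_add_length (w : List Bool) (j : ℕ) :
    periodicSeq w (j + w.length) = periodicSeq w j := by
  simp [periodicSeq]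

theorem nbt_add (q : ℚ) (j : ℕ) : nbt q (j + (q.den + 2)) = nbt q j := by
  have := periodicSeq_add_length (cWord q ++ [true]) j
  rwa [List.length_append, length_cWord] at this

/-- Two sequences with the same period that agree on a period are equal. -/
theorem eq_of_periodic {s t : ℕ → Bool} {p : ℕ} (hp : 0 < p) (hs : ∀ j, s (j + p) = s j)
    (ht : ∀ j, t (j + p) = t j) (h : ∀ j < p, s j = t j) : s = t := by
  funext j
  induction j using Nat.strong_induction_on with
  | _ j ih =>
    rcases Nat.lt_or_ge j p with hj | hj
    · exact h j hj
    · obtain ⟨i, rfl⟩ := Nat.exists_eq_add_of_le' hj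
      rw [hs, ht, ih i (by omega)]

theorem lhe_eq_lowerSeq {q : ℚ} (hq : 0 < q) (hq2 : q ≤ 1 / 2) :
    lhe q = lowerSeq q.num.toNat q.den := by
  have hm := toNat_num_pos hq
  have hle := two_mul_num_le hq hq2
  have hlen : (wWord q).length = q.den - 1 := by simp [wWord, length_cWord]
  have hlen' : (wWord q ++ [true]).length = q.den := by
    rw [List.length_append, hlen, List.length_singleton]; omega
  refine eq_of_periodic q.den_pos (fun j => ?_) (lowerSeq_add_n hm hle) fun j hj => ?_
  · have := periodicSeq_add_length (wWord q ++ [true]) j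
    rwa [hlen'] at this
  · rw [lhe, periodicSeq, hlen', Nat.mod_eq_of_lt hj]
    rcases Nat.lt_or_ge j (q.den - 1) with h | h
    · rw [List.getD_append _ _ _ _ (by omega), lowerSeq_eq_upperSeq hm (coprime_num hq) (by omega),
        ← cWord_getD hq hq2 hj.le, wWord, List.dropLast_eq_take, List.dropLast_eq_take,
        List.getD_eq_getElem?_getD, List.getD_eq_getElem?_getD, List.getElem?_take_of_lt,
        List.getElem?_take_of_lt]
      · rw [length_cWord]; omega
      · rw [List.length_take, length_cWord]; omega
    · obtain rfl : j = q.den - 1 := by omega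
      rw [List.getD_append_right _ _ _ _ hlen.le, hlen, lowerSeq_n_sub_one hm hle]
      simp

/-- Just to the left of `m/n`, the counting functions agree with that of `m/n` on an initial part.
-/
theorem upperCount_eq_of_lt {m n m' n' e L i : ℕ} (hn : 0 < n) (hn' : 0 < n')
    (he : m * n' = m' * n + e) (heL : e * L < n') (hi : i ≤ L) :
    upperCount m' n' i = upperCount m n i := by
  have key (k : ℕ) : k * n' < i * m' ↔ k * n < i * m := by
    have hei : e * i < n' := (Nat.mul_le_mul_left e hi).trans_lt heL
    constructor <;> intro h
    · refine Nat.lt_of_mul_lt_mul_right (a := n') ?_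
      calc k * n * n' = k * n' * n := by ring
        _ < i * m' * n := Nat.mul_lt_mul_of_pos_right h hn
        _ ≤ i * m * n' := by nlinarith
    · refine Nat.lt_of_mul_lt_mul_right (a := n) ?_
      have := Nat.mul_le_mul_right n' (Nat.succ_le_of_lt h)
      rw [Nat.succ_eq_add_one] at this
      nlinarith
  refine eq_of_forall_le_iff fun k => ?_
  rcases Nat.eq_zero_or_pos k with rfl | hk
  · simp
  · obtain ⟨k, rfl⟩ := Nat.exists_eq_add_of_le' hk
    rw [succ_le_upperCount hn', succ_le_upperCount hn, key]

/-- Just to the right of `m/n`, the counting functions agree with the lower one of `m/n` on an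
initial part. -/
theorem upperCount_eq_of_gt {m n m' n' e L i : ℕ} (hn : 0 < n) (hn' : 0 < n')
    (he : m' * n = m * n' + e) (he0 : 0 < e) (heL : e * L < n') (hi : i ≤ L) :
    upperCount m' n' i = lowerCount m n i := by
  rcases Nat.eq_zero_or_pos i with rfl | hi0
  · simp [upperCount, lowerCount]
  have key (k : ℕ) : k * n' < i * m' ↔ k * n ≤ i * m := by
    have hei : e * i < n' := (Nat.mul_le_mul_left e hi).trans_lt heL
    have hei0 : 0 < e * i := Nat.mul_pos he0 hi0
    constructor <;> intro h
    · refine Nat.le_of_not_lt fun h' => ?_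
      have := Nat.mul_le_mul_right n' (Nat.succ_le_of_lt h')
      have h2 := Nat.mul_lt_mul_of_pos_right h hn
      rw [Nat.succ_eq_add_one] at this
      nlinarith
    · refine Nat.lt_of_mul_lt_mul_right (a := n) ?_
      have := Nat.mul_le_mul_right n' h
      nlinarith
  refine eq_of_forall_le_iff fun k => ?_
  rcases Nat.eq_zero_or_pos k with rfl | hk
  · simp
  · obtain ⟨k, rfl⟩ := Nat.exists_eq_add_of_le' hk
    rw [succ_le_upperCount hn', key, lowerCount, Nat.le_div_iff_mul_le hn]

theorem pairSeq_congr {g g' : ℕ → ℕ} {L : ℕ} (h : ∀ i ≤ L, g i = g' i) {j : ℕ} (hj : j < L) :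
    pairSeq g j = pairSeq g' j := by
  rw [pairSeq, pairSeq, h _ (by omega), h _ (by omega)]

/-- Closeness of two fractions in terms of their numerators and denominators. -/
theorem exists_cross_eq {q q' : ℚ} (hq : 0 < q) (hq' : 0 < q') (hlt : q' < q) {L M : ℕ}
    (h : (q - q') * (M * L) < 1) :
    ∃ e : ℕ, 0 < e ∧ q.num.toNat * q'.den = q'.num.toNat * q.den + e ∧
      e * L * M < q.den * q'.den := by
  have hd : (0 : ℚ) < q.den := by exact_mod_cast q.den_pos
  have hd' : (0 : ℚ) < q'.den := by exact_mod_cast q'.den_pos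
  have h1 := hlt
  rw [eq_div hq, eq_div hq', div_lt_div_iff₀ hd' hd] at h1
  rw [eq_div hq, eq_div hq'] at h
  generalize q.num.toNat = m at *
  generalize q.den = n at *
  generalize q'.num.toNat = m' at *
  generalize q'.den = n' at *
  have h2 : m' * n < m * n' := by exact_mod_cast h1
  obtain ⟨e, he⟩ := Nat.exists_eq_add_of_lt h2
  refine ⟨e + 1, by omega, he, ?_⟩
  have he' : (m * n' : ℚ) = m' * n + e + 1 := by exact_mod_cast he
  have h3 : (m : ℚ) / n - m' / n' = (e + 1) / (n * n') := by
    rw [div_sub_div _ _ hd.ne' hd'.ne', mul_comm (n : ℚ) m', he']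
    ring
  rw [h3, div_mul_eq_mul_div, div_lt_one (by positivity)] at h
  have : ((e + 1) * L * M : ℚ) < n * n' := by linarith
  exact_mod_cast this

/-- For `q'` less than `q` and close to it, `NBT(q')` begins like the greatest sequence of
height `q`. -/
theorem nbt_eq_of_lt {q q' : ℚ} (hq' : 0 < q') (hq2 : q ≤ 1 / 2) (hlt : q' < q) {L : ℕ}
    (h : (q - q') * (q.den * L) < 1) {j : ℕ} (hj : j < L) :
    nbt q' j = upperSeq q.num.toNat q.den j := by
  obtain ⟨e, he0, he, heL⟩ := exists_cross_eq (hq'.trans hlt) hq' hlt h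
  have heL' : e * L < q'.den :=
    Nat.lt_of_mul_lt_mul_right (a := q.den) (by rwa [mul_comm q'.den])
  have hj' : j ≤ q'.den := by nlinarith
  rw [nbt_eq_upperSeq hq' (hlt.le.trans hq2) hj', upperSeq, upperSeq]
  exact pairSeq_congr (fun i hi => upperCount_eq_of_lt q.den_pos q'.den_pos he heL' hi) hj

/-- For `q'` greater than `q` and close to it, `NBT(q')` begins like the least sequence of
height `q`. -/
theorem nbt_eq_of_gt {q q' : ℚ} (hq : 0 < q) (hq2 : q' ≤ 1 / 2) (hlt : q < q') {L : ℕ}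
    (h : (q' - q) * (q.den * L) < 1) {j : ℕ} (hj : j < L) :
    nbt q' j = lowerSeq q.num.toNat q.den j := by
  obtain ⟨e, he0, he, heL⟩ := exists_cross_eq (hq.trans hlt) hq hlt h
  have heL' : e * L < q'.den := Nat.lt_of_mul_lt_mul_right (a := q.den) heL
  have hj' : j ≤ q'.den := by nlinarith
  rw [nbt_eq_upperSeq (hq.trans hlt) hq2 hj', upperSeq, lowerSeq]
  exact pairSeq_congr (fun i hi => upperCount_eq_of_gt q.den_pos q'.den_pos he he0 heL' hi) hj

section Height

variable {s : ℕ → Bool} {q : ℚ}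

theorem height_bddBelow (s : ℕ → Bool) : BddBelow {x : ℝ | ∃ q : ℚ, x = q ∧ 0 < q ∧ q ≤ 1 / 2 ∧
    (q = 1 / 2 ∨ UnimodalLT (nbt q) s)} :=
  ⟨0, by rintro _ ⟨q, rfl, hq, -⟩; exact_mod_cast hq.le⟩

theorem height_nonempty (s : ℕ → Bool) : Set.Nonempty {x : ℝ | ∃ q : ℚ, x = q ∧ 0 < q ∧
    q ≤ 1 / 2 ∧ (q = 1 / 2 ∨ UnimodalLT (nbt q) s)} :=
  ⟨((1 / 2 : ℚ) : ℝ), 1 / 2, rfl, by norm_num, by norm_num, .inl rfl⟩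

theorem le_half_of_height (hh : height s = (q : ℝ)) : q ≤ 1 / 2 := by
  have : (q : ℝ) ≤ ((1 / 2 : ℚ) : ℝ) := by
    rw [← hh]
    exact csInf_le (height_bddBelow s) ⟨1 / 2, rfl, by norm_num, by norm_num, .inl rfl⟩
  exact_mod_cast this

/-- If `s` were greater than the greatest sequence of height `q`, it would be greater than
`NBT(q')` for some `q' < q`. -/
theorem not_upperSeq_lt_of_height (hq : 0 < q) (hh : height s = (q : ℝ)) :
    ¬ UnimodalLT (upperSeq q.num.toNat q.den) s := by
  intro hlt
  obtain ⟨D, hD⟩ := unimodalLT_exists hlt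
  have hpos : (0 : ℚ) < q.den * (D + 1 : ℕ) := by
    have := q.den_pos
    positivity
  obtain ⟨q', h1, h2⟩ := exists_between
    (max_lt hq (sub_lt_self q (one_div_pos.2 hpos)))
  rw [max_lt_iff] at h1
  have hq2 := le_half_of_height hh
  have hn (j : ℕ) (hj : j < D + 1) := nbt_eq_of_lt h1.1 hq2 h2 (L := D + 1) (j := j) (by
    have : q - q' < 1 / (q.den * (D + 1 : ℕ)) := by linarith [h1.2]
    rwa [lt_div_iff₀ hpos] at this) hj
  obtain ⟨h3, h4⟩ := hD.symm.congr_right (t' := nbt q') fun j hj => (hn j (by omega)).symm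
  have h5 : UnimodalLT (nbt q') s :=
    h3.symm.unimodalLT_iff_not.2 fun h => (h4.1 h).asymm hlt
  have h6 : height s ≤ (q' : ℝ) :=
    csInf_le (height_bddBelow s) ⟨q', rfl, h1.1, (h2.le.trans hq2), .inr h5⟩
  rw [hh] at h6
  have : q ≤ q' := by exact_mod_cast h6
  linarith

theorem upperSeq_gt_lowerSeq {m n : ℕ} (hm : 0 < m) (hmn : 2 * m ≤ n) (hc : Nat.Coprime m n) :
    FirstDiff (lowerSeq m n) (upperSeq m n) (n - 1) ∧
      UnimodalLT (lowerSeq m n) (upperSeq m n) := by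
  have h : FirstDiff (lowerSeq m n) (upperSeq m n) (n - 1) :=
    ⟨fun j hj => lowerSeq_eq_upperSeq hm hc (by omega), by
      rw [lowerSeq_n_sub_one hm hmn, upperSeq_n_sub_one hm hmn hc]; simp⟩
  refine ⟨h, h.unimodalLT_iff.2 ?_⟩
  rw [show n - 1 + 1 = n by omega, ones_lowerSeq_n hm hmn hc]
  exact even_two_mul m

/-- If `s` were less than the least sequence of height `q`, then it would be less than `NBT(q')`
for all `q' > q` that are close to `q`, and so the height would be greater than `q`. -/
theorem not_lt_lowerSeq_of_height (h0 : s 0 = true) (h1 : s 1 = false) (hq : 0 < q)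
    (hh : height s = (q : ℝ)) : ¬ UnimodalLT s (lowerSeq q.num.toNat q.den) := by
  intro hlt
  have hq2 := le_half_of_height hh
  have hm := toNat_num_pos hq
  have hle := two_mul_num_le hq hq2
  have hc := coprime_num hq
  obtain ⟨D, hD⟩ := unimodalLT_exists hlt
  have hpos : (0 : ℚ) < q.den * (D + 1 : ℕ) := by
    have := q.den_pos
    positivity
  obtain ⟨δ, hδ, hδ1, hδ2⟩ : ∃ δ : ℚ, 0 < δ ∧ δ ≤ 1 / (q.den * (D + 1 : ℕ)) ∧
      (q < 1 / 2 → δ ≤ 1 / 2 - q) := by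
    by_cases h : q < 1 / 2
    · exact ⟨_, lt_min (one_div_pos.2 hpos) (sub_pos.2 h), min_le_left _ _,
        fun _ => min_le_right _ _⟩
    · exact ⟨_, one_div_pos.2 hpos, le_rfl, fun h' => absurd h' h⟩
  have hlt' : sInf {x : ℝ | ∃ q : ℚ, x = q ∧ 0 < q ∧ q ≤ 1 / 2 ∧
      (q = 1 / 2 ∨ UnimodalLT (nbt q) s)} < ((q + δ : ℚ) : ℝ) := by
    change height s < _
    rw [hh]
    exact_mod_cast lt_add_of_pos_right q hδ
  obtain ⟨_, ⟨q', rfl, hq', hq'2, h⟩, hlt''⟩ := exists_lt_of_csInf_lt (height_nonempty s) hlt'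
  have hqq : (q : ℝ) ≤ (q' : ℝ) := by
    rw [← hh]
    exact csInf_le (height_bddBelow s) ⟨q', rfl, hq', hq'2, h⟩
  have hqq : q ≤ q' := by exact_mod_cast hqq
  have hlt'' : q' < q + δ := by exact_mod_cast hlt''
  rcases lt_or_eq_of_le hq2 with hq3 | rfl
  · have h3 := hδ2 hq3
    have h4 : UnimodalLT (nbt q') s := h.resolve_left (by linarith)
    rcases eq_or_lt_of_le hqq with rfl | hqq
    · -- `NBT(q)` and the least sequence of height `q` first differ at the place `q.den - 1`
      obtain ⟨h5, h6⟩ := upperSeq_gt_lowerSeq hm hle hc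
      obtain ⟨h7, h8⟩ := h5.congr_right (t' := nbt q)
        fun j hj => (nbt_eq_upperSeq hq hq2 (by omega)).symm
      have hn := eq_of_between (L := q.den - 1) (u := nbt q) (s := s) (v := lowerSeq _ _)
        (fun j hj => (h7.1 j hj).symm) h4.asymm hlt.asymm
      rcases hn' : s (q.den - 1) with _ | _
      · have h9 : FirstDiff (lowerSeq q.num.toNat q.den) s (q.den - 1) :=
          ⟨fun j hj => by rw [hn j hj, h7.1 j hj], by
            rw [lowerSeq_n_sub_one hm hle, hn']; simp⟩
        have := h9.unimodalLT_iff.2 (by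
          rw [← h5.unimodalLT_iff]
          exact (upperSeq_gt_lowerSeq hm hle hc).2)
        exact this.asymm hlt
      · have h9 : FirstDiff s (nbt q) (q.den - 1) :=
          ⟨hn, by
            rw [nbt_eq_upperSeq hq hq2 (by omega), upperSeq_n_sub_one hm hle hc, hn']; simp⟩
        have h10 := h9.unimodalLT_iff.2 (by
          rw [show q.den - 1 + 1 = q.den by omega, ones_congr (t := lowerSeq q.num.toNat q.den),
            ones_lowerSeq_n hm hle hc]
          · exact even_two_mul _
          · intro j hj
            rcases Nat.lt_or_ge j (q.den - 1) with hj | hj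
            · rw [hn j hj, h7.1 j hj]
            · obtain rfl : j = q.den - 1 := by omega
              rw [hn', lowerSeq_n_sub_one hm hle])
        exact h10.asymm h4
    · have hn (j : ℕ) (hj : j < D + 1) := nbt_eq_of_gt hq hq'2 hqq (L := D + 1) (j := j) (by
        have : q' - q < 1 / (q.den * (D + 1 : ℕ)) := by linarith
        rwa [lt_div_iff₀ hpos] at this) hj
      obtain ⟨h5, h6⟩ := hD.congr_right (t' := nbt q') fun j hj => (hn j (by omega)).symm
      exact (h6.2 hlt).asymm h4
  · -- the least sequence of height `1/2` is `1^∞`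
    have h5 : lowerSeq (1 / 2 : ℚ).num.toNat (1 / 2 : ℚ).den 1 = true := by
      have := lowerSeq_n_sub_one hm hle
      have hden : (1 / 2 : ℚ).den = 2 := by norm_num
      rwa [show (1 / 2 : ℚ).den - 1 = 1 by rw [hden]] at this
    have h6 : FirstDiff s (lowerSeq (1 / 2 : ℚ).num.toNat (1 / 2 : ℚ).den) 1 :=
      ⟨fun j hj => by
        obtain rfl : j = 0 := by omega
        rw [h0, lowerSeq, pairSeq_zero], by rw [h1, h5]; simp⟩
    rw [h6.unimodalLT_iff] at hlt
    simp [ones, Finset.sum_range_succ, h0, h1] at hlt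

end Height

/-! ### The orbit of the turning point -/

namespace CriticalOrbit

variable {f : UnimodalMap} {N : ℕ} (P : CriticalOrbit f N)

/-- The label of `f^r(b)`. -/
def orbit (r : ℕ) : Fin N := (P.perm ^ r) P.last

/-- The itinerary of a label. -/
def itin (i : Fin N) : ℕ → Bool := fun k => decide (P.crit ≤ (P.perm ^ k) i)

theorem orbit_zero : P.orbit 0 = P.last := rfl

theorem orbit_one : P.orbit 1 = P.first := rfl

theorem orbit_succ (r : ℕ) : P.orbit (r + 1) = P.perm (P.orbit r) := by
  rw [orbit, pow_succ', Equiv.Perm.mul_apply, orbit]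

theorem orbit_add (r k : ℕ) : P.orbit (r + k) = (P.perm ^ k) (P.orbit r) := by
  rw [orbit, orbit, add_comm, pow_add, Equiv.Perm.mul_apply]

theorem perm_crit : P.perm P.crit = P.last := rfl

theorem point_iterate (i : Fin N) (k : ℕ) : P.point ((P.perm ^ k) i) = f.toFun^[k] (P.point i) := by
  induction k with
  | zero => rfl
  | succ k ih =>
    rw [pow_succ', Equiv.Perm.mul_apply, ← P.map_point, ih, Function.iterate_succ_apply']

theorem point_last : P.point P.last = f.b := by
  rw [last, ← P.map_point, P.point_crit, f.map_c]

theorem point_first : P.point P.first = f.a := by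
  rw [first, ← P.map_point, P.point_last, f.map_b]

theorem point_mem (i : Fin N) : P.point i ∈ Set.Icc f.a f.b := by
  have h : P.point i ∈ Set.range P.point := ⟨i, rfl⟩
  rw [P.range_eq] at h
  obtain ⟨k, hk⟩ := h
  rw [hk]
  exact f.mapsTo.iterate k ⟨f.a_lt_c.le, f.c_lt_b.le⟩

theorem le_last (i : Fin N) : i ≤ P.last :=
  P.strictMono.le_iff_le.1 (by rw [P.point_last]; exact (P.point_mem i).2)

theorem first_le (i : Fin N) : P.first ≤ i :=
  P.strictMono.le_iff_le.1 (by rw [P.point_first]; exact (P.point_mem i).1)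

theorem crit_lt_last : P.crit < P.last :=
  P.strictMono.lt_iff_lt.1 (by rw [P.point_last, P.point_crit]; exact f.c_lt_b)

theorem first_lt_crit : P.first < P.crit :=
  P.strictMono.lt_iff_lt.1 (by rw [P.point_first, P.point_crit]; exact f.a_lt_c)

theorem val_last : (P.last : ℕ) = N - 1 := by
  have h := P.last.2
  have := P.le_last ⟨N - 1, by omega⟩
  rw [Fin.le_def] at this
  simp only at this
  omega

theorem three_le {f : UnimodalMap} {N : ℕ} (P : CriticalOrbit f N) : 3 ≤ N := by
  have h1 := P.crit_lt_last
  have h2 := P.first_lt_crit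
  have h3 := P.last.2
  rw [Fin.lt_def] at h1 h2
  omega

theorem perm_lt_perm {i j : Fin N} (hj : j ≤ P.crit) : P.perm i < P.perm j ↔ i < j ∨ P.crit < i ∧
    P.perm i < P.perm j := by
  refine ⟨fun h => ?_, ?_⟩
  · rcases lt_or_ge P.crit i with h1 | h1
    · exact .inr ⟨h1, h⟩
    · left
      by_contra h2
      rw [← P.strictMono.lt_iff_lt, ← P.map_point, ← P.map_point] at h
      refine absurd h (not_lt.2 (f.strictMonoOn.monotoneOn ⟨(P.point_mem _).1, ?_⟩
        ⟨(P.point_mem _).1, ?_⟩ (P.strictMono.le_iff_le.2 (not_lt.1 h2))))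
      · rw [← P.point_crit]; exact P.strictMono.le_iff_le.2 hj
      · rw [← P.point_crit]; exact P.strictMono.le_iff_le.2 h1
  · rintro (h | h)
    · rw [← P.strictMono.lt_iff_lt, ← P.map_point, ← P.map_point]
      refine f.strictMonoOn ⟨(P.point_mem _).1, ?_⟩ ⟨(P.point_mem _).1, ?_⟩
        (P.strictMono.lt_iff_lt.2 h)
      · rw [← P.point_crit]; exact P.strictMono.le_iff_le.2 (h.le.trans hj)
      · rw [← P.point_crit]; exact P.strictMono.le_iff_le.2 hj
    · exact h.2

theorem perm_lt_perm_left {i j : Fin N} (hi : i ≤ P.crit) (hj : j ≤ P.crit) :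
    P.perm i < P.perm j ↔ i < j := by
  rw [P.perm_lt_perm hj]
  exact ⟨fun h => h.resolve_right fun h => absurd h.1 (not_lt.2 hi), .inl⟩

theorem perm_lt_perm_right {i j : Fin N} (hi : P.crit ≤ i) (hj : P.crit ≤ j) :
    P.perm i < P.perm j ↔ j < i := by
  rw [← P.strictMono.lt_iff_lt, ← P.map_point, ← P.map_point, ← P.strictMono.lt_iff_lt (a := j)]
  exact f.strictAntiOn.lt_iff_gt
    ⟨by rw [← P.point_crit]; exact P.strictMono.le_iff_le.2 hi, (P.point_mem _).2⟩
    ⟨by rw [← P.point_crit]; exact P.strictMono.le_iff_le.2 hj, (P.point_mem _).2⟩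

theorem isCycleOn : P.perm.IsCycleOn (Finset.univ : Finset (Fin N)) := by
  have h (i : Fin N) : P.perm.SameCycle P.crit i := by
    have h : P.point i ∈ Set.range P.point := ⟨i, rfl⟩
    rw [P.range_eq] at h
    obtain ⟨k, hk⟩ := h
    refine ⟨k, P.strictMono.injective ?_⟩
    rw [hk, zpow_natCast, P.point_iterate, P.point_crit]
  exact ⟨by simp [Set.bijOn_univ], fun i _ j _ => (h i).symm.trans (h j)⟩

theorem perm_pow_apply_eq {i : Fin N} {k : ℕ} : (P.perm ^ k) i = i ↔ N ∣ k := by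
  rw [P.isCycleOn.pow_apply_eq (Finset.mem_univ i), Finset.card_univ, Fintype.card_fin]

theorem orbit_inj {r k : ℕ} (hr : r < N) (hk : k < N) (h : P.orbit r = P.orbit k) : r = k := by
  wlog hrk : r ≤ k generalizing r k
  · exact (this hk hr h.symm (by omega)).symm
  obtain ⟨d, rfl⟩ := Nat.exists_eq_add_of_le hrk
  rw [P.orbit_add r d] at h
  have h1 := Nat.eq_zero_of_dvd_of_lt (P.perm_pow_apply_eq.1 h.symm) (by omega)
  omega

theorem exists_orbit (i : Fin N) : ∃ r, r < N ∧ P.orbit r = i := by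
  obtain ⟨n, hn, h⟩ := P.isCycleOn.exists_pow_eq (Finset.mem_univ P.last) (Finset.mem_univ i)
  rw [Finset.card_univ, Fintype.card_fin] at hn
  exact ⟨n, hn, h⟩

theorem orbit_N : P.orbit N = P.last := P.perm_pow_apply_eq.2 dvd_rfl

theorem orbit_N_sub_one : P.orbit (N - 1) = P.crit := by
  apply P.perm.injective
  have := P.three_le
  rw [← P.orbit_succ, show N - 1 + 1 = N by omega, P.orbit_N, perm_crit]

theorem orbit_add_N (r : ℕ) : P.orbit (r + N) = P.orbit r := by
  rw [add_comm, P.orbit_add, P.orbit_N]; rfl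

theorem itin_perm (i : Fin N) (j : ℕ) : P.itin i (j + 1) = P.itin (P.perm i) j := by
  rw [itin, itin, pow_succ, Equiv.Perm.mul_apply]

theorem itin_orbit (r : ℕ) : P.itin (P.orbit r) = fun j => P.itin P.last (j + r) := by
  funext j
  rw [itin, itin, ← P.orbit_add, add_comm, orbit]

theorem kneadingSequence_eq : f.kneadingSequence = P.itin P.last := by
  funext j
  rw [UnimodalMap.kneadingSequence, itin, decide_eq_decide, ← P.point_last, ← P.point_iterate,
    ← P.point_crit, P.strictMono.le_iff_le]

/-- The order of two labels is the unimodal order of their itineraries, if these are different. -/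
theorem lt_iff_of_firstDiff {n : ℕ} {i j : Fin N} (h : FirstDiff (P.itin i) (P.itin j) n) :
    Even (ones (P.itin i) (n + 1)) ↔ i < j := by
  induction n generalizing i j with
  | zero =>
    have h2 := h.2
    simp only [itin, pow_zero, Equiv.Perm.one_apply, ne_eq, decide_eq_decide] at h2
    have h3 : ones (P.itin i) (0 + 1) = (decide (P.crit ≤ i)).toNat := by
      simp [ones, itin]
    rw [h3]
    by_cases h4 : P.crit ≤ i
    · have : ¬ P.crit ≤ j := by tauto
      simp only [h4, decide_true, Bool.toNat_true, Nat.not_even_one, false_iff, not_lt]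
      exact (not_le.1 this).le.trans h4
    · have : P.crit ≤ j := by tauto
      simp only [h4, decide_false, Bool.toNat_false, Even.zero, true_iff]
      exact (not_le.1 h4).trans_le this
  | succ n ih =>
    have h1 : FirstDiff (P.itin (P.perm i)) (P.itin (P.perm j)) n :=
      ⟨fun k hk => by rw [← itin_perm, ← itin_perm]; exact h.1 _ (by omega),
        by rw [← itin_perm, ← itin_perm]; exact h.2⟩
    have h0 : P.itin i 0 = P.itin j 0 := h.1 0 (by omega)
    have h2 := ih h1
    have h3 : ones (P.itin i) (n + 1 + 1) =
        (P.itin i 0).toNat + ones (P.itin (P.perm i)) (n + 1) := by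
      rw [add_comm (n + 1) 1, ones_add]
      congr 1
    have h4 : P.perm i ≠ P.perm j := fun h => h1.2 (by rw [h])
    rw [h3]
    simp only [itin, pow_zero, Equiv.Perm.one_apply, decide_eq_decide] at h0
    by_cases h5 : P.crit ≤ i
    · rw [P.perm_lt_perm_right h5 (h0.1 h5)] at h2
      have h6 : i ≠ j := fun h => h4 (by rw [h])
      have h7 : (P.itin i 0).toNat = 1 := by simp [itin, h5]
      rw [h7, add_comm, Nat.even_add_one, h2]
      exact ⟨fun h => lt_of_le_of_ne (not_lt.1 h) h6, fun h => h.asymm⟩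
    · have h6 : ¬ P.crit ≤ j := fun h => h5 (h0.2 h)
      rw [P.perm_lt_perm_left (not_le.1 h5).le (not_le.1 h6).le] at h2
      have h7 : (P.itin i 0).toNat = 0 := by simp [itin, h5]
      rw [h7, zero_add, h2]

theorem lt_of_unimodalLT {i j : Fin N} (h : UnimodalLT (P.itin i) (P.itin j)) : i < j := by
  obtain ⟨n, hn⟩ := unimodalLT_exists h
  rw [hn.unimodalLT_iff] at h
  exact (P.lt_iff_of_firstDiff hn).1 h

/-- A strip that crosses another strip does so within the interval spanned by the images of
its ends. -/
theorem transitionMatrix_pos {k l : Fin (N - 1)} (h : 0 < P.transitionMatrix k l) :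
    (stripR l ≤ P.crit → P.perm (stripL l) ≤ stripL k ∧ stripR k ≤ P.perm (stripR l)) ∧
    (P.crit ≤ stripL l → P.perm (stripR l) ≤ stripL k ∧ stripR k ≤ P.perm (stripL l)) := by
  have hsub : Set.Icc (P.point (stripL k)) (P.point (stripR k)) ⊆
      f.toFun '' Set.Icc (P.point (stripL l)) (P.point (stripR l)) := by
    by_contra hc
    simp [transitionMatrix, hc] at h
  have hlt (j : Fin (N - 1)) : P.point (stripL j) ≤ P.point (stripR j) :=
    P.strictMono.le_iff_le.2 (by rw [Fin.le_def]; simp [stripL, stripR])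
  obtain ⟨x, ⟨hx1, hx2⟩, hx⟩ := hsub ⟨le_rfl, hlt k⟩
  obtain ⟨y, ⟨hy1, hy2⟩, hy⟩ := hsub ⟨hlt k, le_rfl⟩
  have hL := (P.point_mem (stripL l)).1
  have hR := (P.point_mem (stripR l)).2
  refine ⟨fun hc => ?_, fun hc => ?_⟩
  · have hc' : P.point (stripR l) ≤ f.c := by
      rw [← P.point_crit]; exact P.strictMono.le_iff_le.2 hc
    rw [← P.strictMono.le_iff_le, ← P.strictMono.le_iff_le, ← P.map_point, ← P.map_point, ← hx,
      ← hy]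
    exact ⟨f.strictMonoOn.monotoneOn ⟨hL, (hlt l).trans hc'⟩ ⟨hL.trans hx1, hx2.trans hc'⟩ hx1,
      f.strictMonoOn.monotoneOn ⟨hL.trans hy1, hy2.trans hc'⟩ ⟨hL.trans (hlt l), hc'⟩ hy2⟩
  · have hc' : f.c ≤ P.point (stripL l) := by
      rw [← P.point_crit]; exact P.strictMono.le_iff_le.2 hc
    rw [← P.strictMono.le_iff_le, ← P.strictMono.le_iff_le, ← P.map_point, ← P.map_point, ← hx,
      ← hy]
    exact ⟨f.strictAntiOn.antitoneOn ⟨hc'.trans hx1, hx2.trans hR⟩ ⟨hc'.trans (hlt l), hR⟩ hx2,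
      f.strictAntiOn.antitoneOn ⟨hc', (hlt l).trans hR⟩ ⟨hc'.trans hy1, hy2.trans hR⟩ hy1⟩

/-- If the transition matrix is primitive, then distinct labels have distinct itineraries: otherwise
all iterates would be monotone on the interval between them. -/
theorem itin_injective (hMIA : P.IsMIA) : Function.Injective P.itin := by
  have hN := P.three_le
  have key (x y : Fin N) (hxy : x < y) : P.itin x ≠ P.itin y := by
    intro he
    let j : Fin (N - 1) := ⟨x, by have := y.2; rw [Fin.lt_def] at hxy; omega⟩
    have hpow (k : ℕ) : ∀ i, 0 < (P.transitionMatrix ^ k) i j →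
        min ((P.perm ^ k) x) ((P.perm ^ k) y) ≤ stripL i ∧
          stripR i ≤ max ((P.perm ^ k) x) ((P.perm ^ k) y) := by
      induction k with
      | zero =>
        intro i hi
        have hij : i = j := by
          by_contra hij
          rw [pow_zero, Matrix.one_apply_ne hij] at hi
          exact absurd hi (lt_irrefl 0)
        subst hij
        simp only [pow_zero, Equiv.Perm.one_apply, min_eq_left hxy.le, max_eq_right hxy.le]
        rw [Fin.lt_def] at hxy
        simp only [Fin.le_def, stripL, stripR, j]
        omega
      | succ k ih =>
        intro i hi
        rw [pow_succ', Matrix.mul_apply] at hi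
        obtain ⟨l, -, hl⟩ := Finset.exists_ne_zero_of_sum_ne_zero hi.ne'
        obtain ⟨h1, h2⟩ := Nat.mul_ne_zero_iff.1 hl
        obtain ⟨h3, h4⟩ := ih l (Nat.pos_of_ne_zero h2)
        obtain ⟨h5, h6⟩ := P.transitionMatrix_pos (Nat.pos_of_ne_zero h1)
        have h7 : P.crit ≤ (P.perm ^ k) x ↔ P.crit ≤ (P.perm ^ k) y :=
          decide_eq_decide.1 (congrFun he k)
        rw [pow_succ', Equiv.Perm.mul_apply, Equiv.Perm.mul_apply]
        generalize (P.perm ^ k) x = u at *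
        generalize (P.perm ^ k) y = v at *
        have mono {a b : Fin N} (ha : a ≤ P.crit) (hb : b ≤ P.crit) (hab : a ≤ b) :
            P.perm a ≤ P.perm b := not_lt.1 fun h =>
          absurd ((P.perm_lt_perm_left hb ha).1 h) (not_lt.2 hab)
        have anti {a b : Fin N} (ha : P.crit ≤ a) (hb : P.crit ≤ b) (hab : a ≤ b) :
            P.perm b ≤ P.perm a := not_lt.1 fun h =>
          absurd ((P.perm_lt_perm_right ha hb).1 h) (not_lt.2 hab)
        have hlr : stripL l ≤ stripR l := by rw [Fin.le_def]; simp [stripL, stripR]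
        by_cases hu : P.crit ≤ u
        · have hv := h7.1 hu
          have hl : P.crit ≤ stripL l := (le_min hu hv).trans h3
          obtain ⟨h8, h9⟩ := h6 hl
          rcases le_total u v with huv | huv
          · rw [min_eq_left huv] at h3
            rw [max_eq_right huv] at h4
            exact ⟨(min_le_right _ _).trans ((anti (hl.trans hlr) hv h4).trans h8),
              h9.trans ((anti hu hl h3).trans (le_max_left _ _))⟩
          · rw [min_eq_right huv] at h3
            rw [max_eq_left huv] at h4
            exact ⟨(min_le_left _ _).trans ((anti (hl.trans hlr) hu h4).trans h8),
              h9.trans ((anti hv hl h3).trans (le_max_right _ _))⟩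
        · have hv : v ≤ P.crit := (not_le.1 fun h => hu (h7.2 h)).le
          have hu := (not_le.1 hu).le
          have hr : stripR l ≤ P.crit := h4.trans (max_le hu hv)
          obtain ⟨h8, h9⟩ := h5 hr
          rcases le_total u v with huv | huv
          · rw [min_eq_left huv] at h3
            rw [max_eq_right huv] at h4
            exact ⟨(min_le_left _ _).trans ((mono hu (hlr.trans hr) h3).trans h8),
              h9.trans ((mono hr hv h4).trans (le_max_right _ _))⟩
          · rw [min_eq_right huv] at h3
            rw [max_eq_left huv] at h4
            exact ⟨(min_le_right _ _).trans ((mono hv (hlr.trans hr) h3).trans h8),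
              h9.trans ((mono hr hu h4).trans (le_max_left _ _))⟩
    obtain ⟨-, k, -, hk⟩ := hMIA
    have h1 := (hpow k ⟨0, by omega⟩ (hk _ _)).1
    have h2 := (hpow k ⟨N - 2, by omega⟩ (hk _ _)).2
    have h3 : P.crit ≤ (P.perm ^ k) x ↔ P.crit ≤ (P.perm ^ k) y :=
      decide_eq_decide.1 (congrFun he k)
    have h4 : min ((P.perm ^ k) x) ((P.perm ^ k) y) ≤ P.first := h1.trans (by
      rw [Fin.le_def]; simp [stripL])
    have h5 : P.last ≤ max ((P.perm ^ k) x) ((P.perm ^ k) y) := le_trans (by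
      rw [Fin.le_def, P.val_last]; simp only [stripR]; omega) h2
    have h6 := P.first_lt_crit
    have h7 := P.crit_lt_last
    rcases min_le_iff.1 h4 with h4 | h4 <;> rcases le_max_iff.1 h5 with h5 | h5
    · exact absurd (h5.trans h4) (not_le.2 (h6.trans h7))
    · exact absurd (h3.2 (h7.le.trans h5)) (not_le.2 (h4.trans_lt h6))
    · exact absurd (h3.1 (h7.le.trans h5)) (not_le.2 (h4.trans_lt h6))
    · exact absurd (h5.trans h4) (not_le.2 (h6.trans h7))
  intro x y he
  rcases lt_trichotomy x y with h | h | h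
  · exact absurd he (key x y h)
  · exact h
  · exact absurd he.symm (key y x h)

theorem unimodalLT_itin_iff (hMIA : P.IsMIA) {i j : Fin N} :
    UnimodalLT (P.itin i) (P.itin j) ↔ i < j := by
  refine ⟨P.lt_of_unimodalLT, fun h => ?_⟩
  rcases unimodalLT_or_gt fun he => h.ne (P.itin_injective hMIA he) with h' | h'
  · exact h'
  · exact absurd (P.lt_of_unimodalLT h') h.asymm

/-- The kneading sequence of height `q` has the properties on which the study of its events rests.
-/
theorem isKneading {q : ℚ} (hq : 0 < q) (hh : height (P.itin P.last) = (q : ℝ)) :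
    IsKneading (P.itin P.last) N q.num.toNat q.den := by
  have h0 : P.itin P.last 0 = true := decide_eq_true P.crit_lt_last.le
  have h1 : P.itin P.last 1 = false := decide_eq_false (not_le.2 P.first_lt_crit)
  have hq2 := le_half_of_height hh
  exact
  { m_pos := toNat_num_pos hq
    le := two_mul_num_le hq hq2
    coprime := coprime_num hq
    three_le := P.three_le
    periodic := fun j => by
      have : (P.perm ^ (j + N)) P.last = (P.perm ^ j) P.last := P.orbit_add_N j
      rw [itin, itin, this]
    zero := h0
    one := h1
    last := by
      have : (P.perm ^ (N - 1)) P.last = P.crit := P.orbit_N_sub_one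
      rw [itin, this]
      exact decide_eq_true le_rfl
    maximal := fun k h => by
      rw [← P.itin_orbit] at h
      exact absurd (P.lt_of_unimodalLT h) (not_lt.2 (P.le_last _))
    lower := not_lt_lowerSeq_of_height h0 h1 hq hh
    upper := not_upperSeq_lt_of_height hq hh }

/-- If the period of the kneading sequence is `p`, then `N` divides `p`. -/
theorem dvd_of_periodic (hMIA : P.IsMIA) {p : ℕ}
    (h : ∀ j, P.itin P.last (j + p) = P.itin P.last j) : N ∣ p := by
  refine P.perm_pow_apply_eq.1 (P.itin_injective hMIA ?_ : (P.perm ^ p) P.last = P.last)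
  exact (P.itin_orbit p).trans (funext h)

/-! ### The strips that pass across a junction -/

theorem exists_change {p : ℕ → Prop} {a b : ℕ} (hab : a ≤ b) (ha : p a) (hb : ¬ p b) :
    ∃ k, a ≤ k ∧ k < b ∧ p k ∧ ¬ p (k + 1) := by
  induction b, hab using Nat.le_induction with
  | base => exact absurd ha hb
  | succ b hab ih =>
    by_cases h : p b
    · exact ⟨b, hab, by omega, h, hb⟩
    · obtain ⟨k, h1, h2, h3⟩ := ih h
      exact ⟨k, h1, by omega, h3⟩

theorem passes_upper_iff (i : Fin N) : P.passes (P.perm i) .upper ↔ i < P.crit := by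
  constructor
  · rintro ⟨k, hk, h1, h2⟩
    by_contra hi
    have hlr : P.crit ≤ stripR k := hk.trans (by rw [Fin.le_def]; simp [stripL, stripR])
    rw [P.perm_lt_perm_right hlr (not_lt.1 hi)] at h1
    rw [P.perm_lt_perm_right (not_lt.1 hi) hk] at h2
    rw [Fin.lt_def] at h1 h2
    simp only [stripL, stripR] at h1 h2
    omega
  · intro hi
    have h1 : P.perm i < P.perm P.crit :=
      lt_of_le_of_ne (P.le_last _) fun h => hi.ne (P.perm.injective h)
    obtain ⟨k, hk1, hk2, ⟨h3, h4⟩, h5⟩ := exists_change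
      (p := fun k => ∃ h : k < N, P.perm i < P.perm ⟨k, h⟩)
      (Fin.le_def.1 P.crit_lt_last.le) ⟨P.crit.2, h1⟩ (by
        rintro ⟨_, h⟩
        exact absurd h (not_lt.2 (P.first_le _)))
    have hlast := P.val_last
    refine ⟨⟨k, by omega⟩, hk1, ?_, h4⟩
    refine lt_of_le_of_ne (not_lt.1 fun h => h5 ⟨by omega, h⟩) fun h => ?_
    have := P.perm.injective h
    rw [← this, Fin.lt_def] at hi
    simp only [stripR] at hi
    omega

theorem passes_lower_iff (i : Fin N) : P.passes (P.perm i) .lower ↔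
    P.crit < i ∧ P.perm P.first < P.perm i := by
  constructor
  · rintro ⟨k, hk, h1, h2⟩
    have hlr : stripL k ≤ P.crit := le_trans (by rw [Fin.le_def]; simp [stripL, stripR]) hk
    refine ⟨?_, lt_of_le_of_lt (not_lt.1 fun h => ?_) h1⟩
    · by_contra hi
      rw [P.perm_lt_perm_left hlr (not_lt.1 hi)] at h1
      rw [P.perm_lt_perm_left (not_lt.1 hi) hk] at h2
      rw [Fin.lt_def] at h1 h2
      simp only [stripL, stripR] at h1 h2
      omega
    · rw [P.perm_lt_perm_left hlr P.first_lt_crit.le] at h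
      exact absurd h (not_lt.2 (P.first_le _))
  · rintro ⟨hi, h0⟩
    have h1 : P.perm i < P.perm P.crit :=
      lt_of_le_of_ne (P.le_last _) fun h => hi.ne' (P.perm.injective h)
    obtain ⟨k, hk1, hk2, ⟨h3, h4⟩, h5⟩ := exists_change
      (p := fun k => ∃ h : k < N, P.perm ⟨k, h⟩ < P.perm i)
      (Fin.le_def.1 P.first_lt_crit.le) ⟨P.first.2, h0⟩ (by
        rintro ⟨_, h⟩
        exact absurd h h1.asymm)
    have hcrit := P.crit.2
    have h6 := P.crit_lt_last
    have hlast := P.val_last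
    rw [Fin.lt_def] at h6
    refine ⟨⟨k, by omega⟩, hk2, h4, ?_⟩
    refine lt_of_le_of_ne (not_lt.1 fun h => h5 ⟨by omega, h⟩) fun h => ?_
    have := P.perm.injective h
    rw [this, Fin.lt_def] at hi
    simp only [stripR] at hi
    omega

end CriticalOrbit

/-! ### The edges joining the two switches -/

/-- The other level. -/
def Level.flip : Level → Level
  | .lower => .upper
  | .upper => .lower

theorem Level.flip_flip (l : Level) : l.flip.flip = l := by cases l <;> rfl

theorem Side.flip_flip (s : Side) : s.flip.flip = s := by cases s <;> rfl

/-- The level of the edge joining the two switches that accompanies loops at the switch `s` in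
all the basic configurations. -/
def Side.outer : Side → Level
  | .right => .upper
  | .left => .lower

theorem Side.outer_flip (s : Side) : s.flip.outer = s.outer.flip := by cases s <;> rfl

theorem Level.eq_outer_or (l : Level) (s : Side) : l = s.outer ∨ l = s.outer.flip := by
  cases l <;> cases s <;> simp [Side.outer, Level.flip]

theorem Level.block_injective {l l' : Level} {s s' : Side} (h : l.block s = l'.block s') :
    l = l' ∧ s = s' := by
  cases l <;> cases l' <;> cases s <;> cases s' <;> simp [Level.block] at h ⊢

theorem Level.block_ne (l : Level) (s s' : Side) : l.block s ≠ s'.block := by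
  cases l <;> cases s <;> cases s' <;> simp [Level.block, Side.block]

namespace CriticalOrbit

variable {f : UnimodalMap} {N : ℕ} (P : CriticalOrbit f N)

/-- The switch to which the loops in the junction `P.orbit r` are attached. -/
def sideAt : ℕ → Side
  | 0 => .left
  | r + 1 => P.lrType r

/-- The levels of the edges joining the two switches in the junction `P.orbit r`: they are the
images of those in the previous junction, and the pieces of the images of strips. -/
def edgesAt : ℕ → Level → Prop
  | 0 => fun _ => False
  | r + 1 => fun l =>
      edgesAt r (if P.orbit r < P.crit then l else l.flip) ∨ P.passes (P.orbit (r + 1)) l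

theorem sideAt_succ (r : ℕ) :
    P.sideAt (r + 1) = if P.orbit r < P.crit then P.sideAt r else (P.sideAt r).flip := by
  cases r with
  | zero => rw [orbit_zero, if_neg P.crit_lt_last.asymm]; rfl
  | succ r => rw [show P.orbit (r + 1) = (P.perm ^ r) P.first by
      rw [add_comm, P.orbit_add, orbit_one]]; rfl

theorem sideAt_eq_right_iff (r : ℕ) :
    P.sideAt r = .right ↔ ¬ Even (ones (P.itin P.last) r) := by
  induction r with
  | zero => simp [sideAt, ones]
  | succ r ih =>
    rw [sideAt_succ, ones_succ]
    have h : P.itin P.last r = decide (P.crit ≤ P.orbit r) := rfl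
    by_cases h1 : P.orbit r < P.crit
    · rw [h, if_pos h1, decide_eq_false (not_le.2 h1), ih]
      simp
    · rw [h, if_neg h1, decide_eq_true (not_lt.1 h1), Bool.toNat_true, Nat.even_add_one]
      rw [not_not, ← not_iff_not, ← ih]
      cases P.sideAt r <;> simp [Side.flip]

theorem not_passes_first (l : Level) : ¬ P.passes P.first l := by
  cases l
  · rintro ⟨k, -, h, -⟩
    exact absurd h (not_lt.2 (P.first_le _))
  · rintro ⟨k, -, h, -⟩
    exact absurd h (not_lt.2 (P.first_le _))

theorem not_passes_last (l : Level) : ¬ P.passes P.last l := by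
  cases l
  · rintro ⟨k, -, -, h⟩
    exact absurd h (not_lt.2 (P.le_last _))
  · rintro ⟨k, -, -, h⟩
    exact absurd h (not_lt.2 (P.le_last _))

theorem not_edgesAt_one (l : Level) : ¬ P.edgesAt 1 l := by
  rintro (h | h)
  · exact h
  · exact P.not_passes_first l h

theorem orbit_ne_crit {r : ℕ} (hr : r + 1 < N) : P.orbit r ≠ P.crit := by
  rw [← P.orbit_N_sub_one]
  exact fun h => by have := P.orbit_inj (by omega) (by omega) h; omega

/-- The first edge is created in the image of the first junction, and then it is carried along. -/
theorem edgesAt_outer {r : ℕ} (hr : 2 ≤ r) (hrN : r < N) : P.edgesAt r (P.sideAt r).outer := by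
  induction r, hr using Nat.le_induction with
  | base =>
    have h : P.orbit 1 < P.crit := P.first_lt_crit
    refine .inr ?_
    rw [sideAt_succ, if_pos h, P.orbit_succ]
    exact (P.passes_upper_iff _).2 h
  | succ r hr ih =>
    refine .inl ?_
    rw [sideAt_succ]
    split_ifs
    · exact ih (by omega)
    · rw [Side.outer_flip, Level.flip_flip]
      exact ih (by omega)

/-- The second edge is due to the events of the kneading sequence. -/
theorem edgesAt_inner_iff (hMIA : P.IsMIA) {r : ℕ} (hr : 1 ≤ r) (hrN : r < N) :
    P.edgesAt r (P.sideAt r).outer.flip ↔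
      ∃ k, 2 ≤ k ∧ k ≤ r ∧ Event (P.itin P.last) k := by
  induction r, hr using Nat.le_induction with
  | base =>
    refine ⟨fun h => absurd h (P.not_edgesAt_one _), ?_⟩
    rintro ⟨k, h1, h2, -⟩
    omega
  | succ r hr ih =>
    have h1 : P.edgesAt (r + 1) (P.sideAt (r + 1)).outer.flip ↔
        P.edgesAt r (P.sideAt r).outer.flip ∨
          P.passes (P.orbit (r + 1)) (P.sideAt (r + 1)).outer.flip := by
      rw [edgesAt]
      refine or_congr_left ?_
      rw [sideAt_succ]
      split_ifs
      · rfl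
      · rw [Side.outer_flip, Level.flip_flip]
    have h2 : P.passes (P.orbit (r + 1)) (P.sideAt (r + 1)).outer.flip ↔
        Event (P.itin P.last) (r + 1) := by
      have hs : P.itin P.last (r + 1 - 1) = decide (P.crit ≤ P.orbit r) := rfl
      have hσ := P.sideAt_eq_right_iff (r + 1)
      have hne := P.orbit_ne_crit hrN
      rw [Event, hs, ← hσ, ← P.itin_orbit 2, ← P.itin_orbit (r + 1), P.unimodalLT_itin_iff hMIA,
        ← not_not (a := Even _), ← hσ, decide_eq_false_iff_not, not_le, decide_eq_true_iff]
      cases P.sideAt (r + 1)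
      · simp only [Side.outer, Level.flip, P.orbit_succ r]
        rw [P.passes_upper_iff]
        simp
      · simp only [Side.outer, Level.flip, P.orbit_succ r]
        rw [P.passes_lower_iff, ← P.orbit_one, ← P.orbit_succ 1, lt_iff_le_and_ne]
        simp [hne.symm]
    rw [h1, h2, ih (by omega)]
    constructor
    · rintro (⟨k, hk1, hk2, hk⟩ | h)
      · exact ⟨k, hk1, by omega, hk⟩
      · exact ⟨r + 1, by omega, le_rfl, h⟩
    · rintro ⟨k, hk1, hk2, hk⟩
      rcases Nat.lt_or_eq_of_le hk2 with hk3 | rfl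
      · exact .inl ⟨k, hk1, by omega, hk⟩
      · exact .inr hk

theorem sideAt_eq_left_iff (r : ℕ) :
    P.sideAt r = .left ↔ Even (ones (P.itin P.last) r) := by
  rw [← not_iff_not, ← P.sideAt_eq_right_iff]
  cases P.sideAt r <;> simp

/-- For the least sequence of height `q` every `2`-junction has one edge joining its switches, and
the loops in the junction of the turning point are at the right switch. -/
theorem edgesAt_of_lhe (hMIA : P.IsMIA) {q : ℚ} (hq : 0 < q)
    (hh : height (P.itin P.last) = (q : ℝ)) (hs : P.itin P.last = lhe q) :
    P.sideAt (N - 1) = .right ∧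
      ∀ r, 1 ≤ r → r < N → ¬ P.edgesAt r (P.sideAt r).outer.flip := by
  have hK := P.isKneading hq hh
  rw [lhe_eq_lowerSeq hq (le_half_of_height hh)] at hs
  refine ⟨(P.sideAt_eq_right_iff _).2 (hK.not_even_ones_lowerSeq hs), fun r hr hrN => ?_⟩
  rw [P.edgesAt_inner_iff hMIA hr hrN]
  rintro ⟨k, hk, -, h⟩
  exact hK.not_event_lowerSeq hs hk h

theorem nbt_ne_lowerSeq {q : ℚ} (hq : 0 < q) (hq2 : q ≤ 1 / 2) :
    nbt q ≠ lowerSeq q.num.toNat q.den := by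
  have hm := toNat_num_pos hq
  have hle := two_mul_num_le hq hq2
  intro h
  have h1 := congrFun h (q.den - 1)
  rw [nbt_eq_upperSeq hq hq2 (by omega), upperSeq_n_sub_one hm hle (coprime_num hq),
    lowerSeq_n_sub_one hm hle] at h1
  exact absurd h1 (by simp)

/-- For `NBT(q)` every `2`-junction has one edge joining its switches, and the loops in the
junction of the turning point are at the left switch. -/
theorem edgesAt_of_nbt (hMIA : P.IsMIA) {q : ℚ} (hq : 0 < q)
    (hh : height (P.itin P.last) = (q : ℝ)) (hs : P.itin P.last = nbt q) :
    P.sideAt (N - 1) = .left ∧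
      ∀ r, 1 ≤ r → r < N → ¬ P.edgesAt r (P.sideAt r).outer.flip := by
  have hK := P.isKneading hq hh
  have hne : P.itin P.last ≠ lowerSeq q.num.toNat q.den := by
    rw [hs]; exact nbt_ne_lowerSeq hq (le_half_of_height hh)
  have h1 := hK.n_add_two_le hne
  have h2 : N = q.den + 2 := by
    refine le_antisymm (Nat.le_of_dvd (by omega) (P.dvd_of_periodic hMIA fun j => ?_)) h1
    rw [hs, nbt_add]
  refine ⟨(P.sideAt_eq_left_iff _).2 ?_, fun r hr hrN => ?_⟩
  · rw [show N - 1 = q.den + 1 by omega]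
    exact hK.even_ones_n_add_one hne
  · rw [P.edgesAt_inner_iff hMIA hr hrN]
    rintro ⟨k, hk, hkr, h⟩
    exact hK.not_event_of_le hne hk (by omega) h

/-- For all other sequences of height `q` the second edge appears first in the junction
`P.orbit (q.den + 2)`, and it is present in the junction of the turning point. -/
theorem edgesAt_of_ne (hMIA : P.IsMIA) {q : ℚ} (hq : 0 < q)
    (hh : height (P.itin P.last) = (q : ℝ)) (hl : P.itin P.last ≠ lhe q)
    (hn : P.itin P.last ≠ nbt q) :
    q.den + 3 ≤ N ∧
      ∀ r, 1 ≤ r → r < N → (P.edgesAt r (P.sideAt r).outer.flip ↔ q.den + 1 < r) := by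
  have hK := P.isKneading hq hh
  have hq2 := le_half_of_height hh
  rw [lhe_eq_lowerSeq hq hq2] at hl
  have h1 := hK.n_add_two_le hl
  refine ⟨?_, fun r hr hrN => ?_⟩
  · by_contra hN
    obtain rfl : N = q.den + 2 := by omega
    refine hn (eq_of_periodic (by omega) hK.periodic (nbt_add q) fun j hj => ?_)
    rcases Nat.lt_or_ge j (q.den + 1) with hj1 | hj1
    · rw [hK.eq_upperSeq_of_le hl j (by omega), nbt_eq_upperSeq hq hq2 (by omega)]
    · obtain rfl : j = q.den + 1 := by omega
      rw [nbt_den_add_one]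
      exact hK.last
  · rw [P.edgesAt_inner_iff hMIA hr hrN]
    constructor
    · rintro ⟨k, hk, hkr, h⟩
      by_contra hr
      exact hK.not_event_of_le hl hk (by omega) h
    · intro h
      exact ⟨q.den + 2, by omega, h, hK.event hl⟩

end CriticalOrbit

/-! ### Families of edges and weak maps between them -/

namespace JunctionTrack

/-- The part of planarity that is used to compare families of edges: the ends are totally ordered,
with those at the right switch first, and `pair` is an involution compatible with `enc`. -/
structure IsOrdered (G : JunctionTrack) : Prop where
  irrefl : ∀ d, ¬ G.lt d d
  trans : ∀ d e x, G.lt d e → G.lt e x → G.lt d x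
  total : ∀ d e, G.lt d e ∨ d = e ∨ G.lt e d
  pair_pair : ∀ d, G.pair (G.pair d) = d
  enc_pair : ∀ d, G.enc (G.pair d) ↔ G.enc d
  right_lt_left : ∀ d e, G.side d = .right → G.side e = .left → G.lt d e

theorem IsPlanar.isOrdered {G : JunctionTrack} (h : G.IsPlanar) : G.IsOrdered where
  irrefl := h.order.irrefl
  trans := h.order.trans
  total d e := by
    have := h.order.trichotomous d e
    tauto
  pair_pair := h.pair_pair
  enc_pair := h.enc_pair
  right_lt_left := h.right_lt_left

theorem IsOrdered.asymm {G : JunctionTrack} (h : G.IsOrdered) {d e : G.Dart} (hde : G.lt d e) :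
    ¬ G.lt e d := fun hed => h.irrefl d (h.trans d e d hde hed)

/-- A map between families of edges which preserves all data, but which may identify parallel
edges. -/
structure IsWeakMap (H G : JunctionTrack) (φ : H.Dart → G.Dart) : Prop where
  pair : ∀ d, φ (H.pair d) = G.pair (φ d)
  side : ∀ d, G.side (φ d) = H.side d
  lt : ∀ d e, H.lt d e → φ d = φ e ∨ G.lt (φ d) (φ e)
  enc : ∀ d, G.enc (φ d) ↔ H.enc d

variable {G H K : JunctionTrack}

theorem IsEmbedding.isWeakMap {φ : H.Dart → G.Dart} (h : IsEmbedding H G φ) :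
    IsWeakMap H G φ where
  pair := h.pair
  side := h.side
  lt d e hde := .inr ((h.lt d e).2 hde)
  enc := h.enc

theorem IsEmbedding.comp {φ : H.Dart → G.Dart} {ψ : K.Dart → H.Dart} (h : IsEmbedding H G φ)
    (h' : IsEmbedding K H ψ) : IsEmbedding K G (φ ∘ ψ) where
  injective := h.injective.comp h'.injective
  pair d := by simp [h'.pair, h.pair]
  side d := by simp [h'.side, h.side]
  lt d e := by simp [h'.lt, h.lt]
  enc d := by simp [h'.enc, h.enc]

theorem IsWeakMap.comp {φ : H.Dart → G.Dart} {ψ : K.Dart → H.Dart} (h : IsWeakMap H G φ)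
    (h' : IsWeakMap K H ψ) : IsWeakMap K G (φ ∘ ψ) where
  pair d := by simp [h'.pair, h.pair]
  side d := by simp [h'.side, h.side]
  lt d e hde := by
    rcases h'.lt d e hde with h1 | h1
    · exact .inl (congrArg φ h1)
    · exact h.lt _ _ h1
  enc d := by simp [h'.enc, h.enc]

/-- A weak map which identifies no ends is an embedding. -/
theorem IsWeakMap.isEmbedding {φ : H.Dart → G.Dart} (h : IsWeakMap H G φ) (hH : H.IsOrdered)
    (hG : G.IsOrdered) (hφ : Function.Injective φ) : IsEmbedding H G φ where
  injective := hφ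
  pair := h.pair
  side := h.side
  lt d e := by
    have key : ∀ d e, H.lt d e → G.lt (φ d) (φ e) := fun d e hde =>
      (h.lt d e hde).resolve_left fun h1 => hH.irrefl e (by rwa [hφ h1] at hde)
    refine ⟨fun hlt => ?_, key d e⟩
    rcases hH.total d e with h1 | rfl | h1
    · exact h1
    · exact absurd hlt (hG.irrefl _)
    · exact absurd hlt (hG.asymm (key _ _ h1))
  enc := h.enc

theorem IsWeakMap.rotate {φ : H.Dart → G.Dart} (h : IsWeakMap H G φ) :
    IsWeakMap H.rotate G.rotate φ where
  pair := h.pair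
  side d := congrArg Side.flip (h.side d)
  lt := fun (d e : H.Dart) (hde : if H.side d = H.side e then H.lt d e else H.side d = .left) => by
    change φ d = φ e ∨
      if G.side (φ d) = G.side (φ e) then G.lt (φ d) (φ e) else G.side (φ d) = .left
    rw [h.side, h.side]
    split_ifs at hde ⊢ with h1
    · exact h.lt d e hde
    · exact .inr hde
  enc := fun (d : H.Dart) => by
    change (if G.side (φ d) = G.side (G.pair (φ d)) then G.enc (φ d) else ¬ G.enc (φ d)) ↔
      if H.side d = H.side (H.pair d) then H.enc d else ¬ H.enc d
    rw [← h.pair, h.side, h.side, h.enc]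

theorem IsWeakMap.fold {φ : H.Dart → G.Dart} (h : IsWeakMap H G φ) :
    IsWeakMap H.fold G.fold φ := ⟨h.pair, fun _ => rfl, h.lt, h.enc⟩

theorem IsWeakMap.addThrough {φ : H.Dart → G.Dart} (h : IsWeakMap H G φ) (U : Level → Prop) :
    IsWeakMap (H.addThrough U) (G.addThrough U) (Sum.map φ id) where
  pair d := by rcases d with d | d <;> simp [JunctionTrack.addThrough, h.pair]
  side d := by rcases d with d | d <;> simp [JunctionTrack.addThrough, h.side]
  lt d e hde := by
    rcases d with d | d <;> rcases e with e | e <;>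
      simp only [JunctionTrack.addThrough, Sum.map_inl, Sum.map_inr, h.side, id_eq, reduceCtorEq,
        false_or, Sum.inl.injEq] at hde ⊢
    · exact h.lt d e hde
    all_goals first | exact hde | exact .inr hde
  enc d := by rcases d with d | d <;> simp [JunctionTrack.addThrough, h.enc]

theorem IsEmbedding.addThrough {φ : H.Dart → G.Dart} (h : IsEmbedding H G φ) (U : Level → Prop) :
    IsEmbedding (H.addThrough U) (G.addThrough U) (Sum.map φ id) where
  injective := Sum.map_injective.2 ⟨h.injective, Function.injective_id⟩
  pair d := by rcases d with d | d <;> simp [JunctionTrack.addThrough, h.pair]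
  side d := by rcases d with d | d <;> simp [JunctionTrack.addThrough, h.side]
  lt d e := by
    rcases d with d | d <;> rcases e with e | e <;>
      simp [JunctionTrack.addThrough, h.side, h.lt]
  enc d := by rcases d with d | d <;> simp [JunctionTrack.addThrough, h.enc]

theorem IsOrdered.rotate (h : G.IsOrdered) : G.rotate.IsOrdered where
  irrefl d := by simpa [JunctionTrack.rotate] using h.irrefl d
  trans d e x := by
    simp only [JunctionTrack.rotate]
    intro h1 h2
    have := h.trans d e x
    cases hd : G.side d <;> cases he : G.side e <;> cases hx : G.side x <;> simp_all
  total d e := by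
    simp only [JunctionTrack.rotate]
    have := h.total d e
    cases hd : G.side d <;> cases he : G.side e <;> simp_all
  pair_pair := h.pair_pair
  enc_pair := fun (d : G.Dart) => by
    change (if G.side (G.pair d) = G.side (G.pair (G.pair d)) then G.enc (G.pair d) else
      ¬ G.enc (G.pair d)) ↔ if G.side d = G.side (G.pair d) then G.enc d else ¬ G.enc d
    rw [h.pair_pair, h.enc_pair]
    simp only [eq_comm (a := G.side (G.pair d))]
  right_lt_left d e := by
    simp only [JunctionTrack.rotate]
    cases hd : G.side d <;> cases he : G.side e <;> simp [Side.flip]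

theorem IsOrdered.fold (h : G.IsOrdered) : G.fold.IsOrdered where
  irrefl := h.irrefl
  trans := h.trans
  total := h.total
  pair_pair := h.pair_pair
  enc_pair := h.enc_pair
  right_lt_left d e h1 := by simp [JunctionTrack.fold] at h1

theorem IsOrdered.addThrough (h : G.IsOrdered) (U : Level → Prop) :
    (G.addThrough U).IsOrdered where
  irrefl d := by
    rcases d with d | d
    · exact h.irrefl d
    · exact lt_irrefl _
  trans d e x := by
    have key {s s' : Side} {k : ℕ} (h1 : s.block < k) (h2 : k < s'.block) :
        s = .right ∧ s' = .left := by
      cases s <;> cases s' <;> simp [Side.block] at h1 h2 ⊢ <;> omega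
    have key' {d e : G.Dart} (hde : G.lt d e) : (G.side d).block ≤ (G.side e).block := by
      cases h1 : G.side d <;> cases h2 : G.side e <;> simp [Side.block]
      exact h.asymm hde (h.right_lt_left _ _ h2 h1)
    rcases d with d | d <;> rcases e with e | e <;> rcases x with x | x <;>
      simp only [JunctionTrack.addThrough] <;> intro h1 h2
    · exact h.trans _ _ _ h1 h2
    · exact (key' h1).trans_lt h2
    · exact h.right_lt_left _ _ (key h1 h2).1 (key h1 h2).2
    · exact h1.trans h2
    · exact h1.trans_le (key' h2)
    · exact h1.trans h2
    · exact h1.trans h2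
    · exact h1.trans h2
  total d e := by
    rcases d with d | ⟨⟨l, hl⟩, s⟩ <;> rcases e with e | ⟨⟨l', hl'⟩, s'⟩ <;>
      simp only [JunctionTrack.addThrough, reduceCtorEq, false_or, Sum.inl.injEq]
    · exact h.total d e
    · exact lt_or_gt_of_ne (Level.block_ne _ _ _).symm
    · exact lt_or_gt_of_ne (Level.block_ne _ _ _)
    · rcases lt_trichotomy (l.block s) (l'.block s') with h1 | h1 | h1
      · exact .inl h1
      · obtain ⟨rfl, rfl⟩ := Level.block_injective h1
        exact .inr (.inl rfl)
      · exact .inr (.inr h1)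
  pair_pair d := by
    rcases d with d | d <;> simp [JunctionTrack.addThrough, h.pair_pair, Side.flip_flip]
  enc_pair d := by
    rcases d with d | d <;> simp [JunctionTrack.addThrough, h.enc_pair]
  right_lt_left d e := by
    rcases d with d | ⟨⟨l, hl⟩, s⟩ <;> rcases e with e | ⟨⟨l', hl'⟩, s'⟩ <;>
      simp only [JunctionTrack.addThrough] <;> intro h1 h2
    · exact h.right_lt_left d e h1 h2
    · subst h2
      rw [h1]
      cases l' <;> simp [Side.block, Level.block]
    · subst h1
      rw [h2]
      cases l <;> simp [Side.block, Level.block]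
    · subst h1 h2
      cases l <;> cases l' <;> simp [Level.block]

/-! ### Amalgamation -/

theorem Parallel.pair (hG : G.IsOrdered) {d e : G.Dart} (h : G.Parallel d e) :
    G.Parallel (G.pair d) (G.pair e) := by
  obtain ⟨h1, h2, h3, h4, h5, h6, h7⟩ := h
  have hne : G.pair d ≠ G.pair e := fun h => h1 (by rw [← hG.pair_pair d, h, hG.pair_pair])
  refine ⟨hne, fun h => ?_, h4, by rw [hG.pair_pair, hG.pair_pair, h3], ?_, ?_, fun x => ?_⟩
  · rw [hG.pair_pair] at h
    exact h2 (by rw [← h, hG.pair_pair])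
  · rw [hG.enc_pair, hG.enc_pair, h5]
  · rw [hG.pair_pair, hG.pair_pair]
    have h8 := hG.total d e
    have h9 := hG.total (G.pair d) (G.pair e)
    have h10 := @IsOrdered.asymm _ hG d e
    have h11 := @IsOrdered.asymm _ hG (G.pair d) (G.pair e)
    tauto
  · rw [hG.pair_pair, hG.pair_pair]
    exact (h7 x).symm

theorem eqvGen_pair (hG : G.IsOrdered) {d e : G.Dart} (h : Relation.EqvGen G.Parallel d e) :
    Relation.EqvGen G.Parallel (G.pair d) (G.pair e) := by
  induction h with
  | rel d e h => exact .rel _ _ (h.pair hG)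
  | refl d => exact .refl _
  | symm d e _ ih => exact .symm _ _ ih
  | trans d e x _ _ ih ih' => exact .trans _ _ _ ih ih'

theorem eqvGen_side_enc {d e : G.Dart} (h : Relation.EqvGen G.Parallel d e) :
    G.side d = G.side e ∧ (G.enc d ↔ G.enc e) := by
  induction h with
  | rel d e h => exact ⟨h.2.2.1, h.2.2.2.2.1⟩
  | refl d => exact ⟨rfl, Iff.rfl⟩
  | symm d e _ ih => exact ⟨ih.1.symm, ih.2.symm⟩
  | trans d e x _ _ ih ih' => exact ⟨ih.1.trans ih'.1, ih.2.trans ih'.2⟩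

/-- An end which is not parallel to `d` is on the same side of all ends parallel to `d`. -/
theorem eqvGen_lt (hG : G.IsOrdered) {d e : G.Dart} (h : Relation.EqvGen G.Parallel d e)
    (x : G.Dart) : Relation.EqvGen G.Parallel d x ∨
      ((G.lt x d ↔ G.lt x e) ∧ (G.lt d x ↔ G.lt e x)) := by
  induction h with
  | rel d e h =>
    by_cases h1 : d = x
    · exact .inl (h1 ▸ .refl _)
    by_cases h2 : e = x
    · exact .inl (h2 ▸ .rel _ _ h)
    right
    have h3 := (h.2.2.2.2.2.2 x).1
    have h4 := hG.total d x
    have h5 := hG.total e x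
    have h6 := @IsOrdered.asymm _ hG d x
    have h7 := @IsOrdered.asymm _ hG e x
    rw [Between] at h3
    tauto
  | refl d => exact .inr ⟨Iff.rfl, Iff.rfl⟩
  | symm d e h ih =>
    rcases ih with ih | ih
    · exact .inl (.trans _ _ _ (.symm _ _ h) ih)
    · exact .inr ⟨ih.1.symm, ih.2.symm⟩
  | trans d e y h h' ih ih' =>
    rcases ih with ih | ih
    · exact .inl ih
    rcases ih' with ih' | ih'
    · exact .inl (.trans _ _ _ h ih')
    · exact .inr ⟨ih.1.trans ih'.1, ih.2.trans ih'.2⟩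

/-- If `H` is obtained from `G` by amalgamating parallel edges, then the map which takes each edge
to the edge with which it is amalgamated is a weak map. -/
theorem IsAmalgamation.exists_isWeakMap (hG : G.IsOrdered) (h : H.IsAmalgamation G) :
    ∃ ρ : G.Dart → H.Dart, IsWeakMap G H ρ ∧ Function.Surjective ρ := by
  obtain ⟨φ, hφ, h⟩ := h
  choose ρ hρ huniq using h
  have hρφ (x) : ρ (φ x) = x := (huniq (φ x) x (.refl _)).symm
  have heq {d e : G.Dart} (hde : Relation.EqvGen G.Parallel d e) : ρ d = ρ e :=
    huniq e _ (.trans _ _ _ (.symm _ _ hde) (hρ d))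
  refine ⟨ρ, ⟨fun d => ?_, fun d => ?_, fun d e hde => ?_, fun d => ?_⟩, fun x => ⟨_, hρφ x⟩⟩
  · refine (huniq _ _ ?_).symm
    simp only
    rw [hφ.pair]
    exact eqvGen_pair hG (hρ d)
  · rw [← hφ.side, (eqvGen_side_enc (hρ d)).1]
  · by_cases he : Relation.EqvGen G.Parallel d e
    · exact .inl (heq he)
    · right
      have h1 := (eqvGen_lt hG (hρ d) e).resolve_left he
      have h2 := (eqvGen_lt hG (hρ e) (φ (ρ d))).resolve_left fun h' =>
        he (.trans _ _ _ (hρ d) (.symm _ _ h'))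
      rw [← hφ.lt, ← h2.1, ← h1.2]
      exact hde
  · rw [← hφ.enc, (eqvGen_side_enc (hρ d)).2]

/-- A criterion for amalgamation, in terms of the map `ρ` which takes each end to its
representative. -/
theorem isAmalgamation_of_retraction {φ : H.Dart → G.Dart} (hφ : IsEmbedding H G φ)
    {ρ : G.Dart → H.Dart} (hρφ : ∀ x, ρ (φ x) = x) (h1 : ∀ d e, G.Parallel d e → ρ d = ρ e)
    (h2 : ∀ d, Relation.EqvGen G.Parallel d (φ (ρ d))) : H.IsAmalgamation G := by
  have h3 {d e : G.Dart} (h : Relation.EqvGen G.Parallel d e) : ρ d = ρ e := by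
    induction h with
    | rel d e h => exact h1 _ _ h
    | refl d => rfl
    | symm d e _ ih => exact ih.symm
    | trans d e x _ _ ih ih' => exact ih.trans ih'
  exact ⟨φ, hφ, fun d => ⟨ρ d, h2 d, fun y hy => by rw [h3 hy, hρφ]⟩⟩

theorem Equivalent.symm (h : H.Equivalent G) : G.Equivalent H := by
  obtain ⟨φ, hφ, hs⟩ := h
  choose ψ hψ using hs
  refine ⟨ψ, ⟨fun x y h => ?_, fun d => ?_, fun d => ?_, fun d e => ?_, fun d => ?_⟩, fun x => ?_⟩
  · rw [← hψ x, h, hψ]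
  · apply hφ.injective
    rw [hψ, hφ.pair, hψ]
  · rw [← hφ.side, hψ]
  · rw [← hφ.lt, hψ, hψ]
  · rw [← hφ.enc, hψ]
  · exact ⟨φ x, hφ.injective (hψ _)⟩

theorem Equivalent.trans (h : K.Equivalent H) (h' : H.Equivalent G) : K.Equivalent G := by
  obtain ⟨φ, hφ, hs⟩ := h
  obtain ⟨ψ, hψ, hs'⟩ := h'
  exact ⟨ψ ∘ φ, hψ.comp hφ, hs'.comp hs⟩

theorem Equivalent.refl (G : JunctionTrack) : G.Equivalent G :=
  ⟨id, ⟨Function.injective_id, fun _ => rfl, fun _ => rfl, fun _ _ => Iff.rfl, fun _ => Iff.rfl⟩,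
    Function.surjective_id⟩

theorem Equivalent.addThrough (h : H.Equivalent G) (U : Level → Prop) :
    (H.addThrough U).Equivalent (G.addThrough U) := by
  obtain ⟨φ, hφ, hs⟩ := h
  exact ⟨_, hφ.addThrough U, hs.sumMap Function.surjective_id⟩

theorem IsEmbedding.parallel_iff {φ : H.Dart → G.Dart} (h : IsEmbedding H G φ)
    (hs : Function.Surjective φ) {d e : H.Dart} : G.Parallel (φ d) (φ e) ↔ H.Parallel d e := by
  have hb (x d e) : G.Between (φ x) (φ d) (φ e) ↔ H.Between x d e := by
    simp only [Between, h.lt]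
  simp only [Parallel, ← h.pair, h.side, h.enc, h.lt, hs.forall, hb, h.injective.ne_iff]

theorem IsEmbedding.eqvGen {φ : H.Dart → G.Dart} (h : IsEmbedding H G φ)
    (hs : Function.Surjective φ) {d e : H.Dart} (hde : Relation.EqvGen H.Parallel d e) :
    Relation.EqvGen G.Parallel (φ d) (φ e) := by
  induction hde with
  | rel d e hp => exact .rel _ _ ((h.parallel_iff hs).2 hp)
  | refl d => exact .refl _
  | symm d e _ ih => exact .symm _ _ ih
  | trans d e x _ _ ih ih' => exact .trans _ _ _ ih ih'

theorem IsAmalgamation.congr {H' G' : JunctionTrack} (h : H.IsAmalgamation G)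
    (hH : H'.Equivalent H) (hG : G.Equivalent G') : H'.IsAmalgamation G' := by
  obtain ⟨φ, hφ, h⟩ := h
  obtain ⟨α, hα, hαs⟩ := hH
  obtain ⟨α', hα', hαs'⟩ := hG.symm
  obtain ⟨β, hβ, hβs⟩ := hG
  refine ⟨β ∘ φ ∘ α, hβ.comp (hφ.comp hα), fun d => ?_⟩
  obtain ⟨d, rfl⟩ := hβs d
  obtain ⟨x, hx, hu⟩ := h d
  obtain ⟨y, rfl⟩ := hαs x
  refine ⟨y, hβ.eqvGen hβs hx, fun z hz => ?_⟩
  have key {d e : G.Dart} (h : Relation.EqvGen G'.Parallel (β d) (β e)) :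
      Relation.EqvGen G.Parallel d e := by
    have : ∀ u v, Relation.EqvGen G'.Parallel u v → ∀ d e, u = β d → v = β e →
        Relation.EqvGen G.Parallel d e := by
      intro u v h
      induction h with
      | rel u v h =>
        rintro d e rfl rfl
        exact .rel _ _ ((hβ.parallel_iff hβs).1 h)
      | refl u =>
        rintro d e rfl h
        rw [hβ.injective h]
        exact .refl _
      | symm u v _ ih => exact fun d e hd he => .symm _ _ (ih e d he hd)
      | trans u v w _ _ ih ih' =>
        intro d e hd he
        obtain ⟨x, rfl⟩ := hβs v
        exact .trans _ _ _ (ih d x hd rfl) (ih' x e rfl he)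
    exact this _ _ h d e rfl rfl
  exact hα.injective (hu (α z) (key hz))

/-- If no two edges are parallel, there is nothing to amalgamate. -/
theorem Equivalent.isAmalgamation (h : H.Equivalent G) (hH : ∀ d e, ¬ H.Parallel d e) :
    H.IsAmalgamation G :=
  (isAmalgamation_of_retraction (φ := id) (ρ := id)
    ⟨Function.injective_id, fun _ => rfl, fun _ => rfl, fun _ _ => Iff.rfl, fun _ => Iff.rfl⟩
    (fun _ => rfl) (fun d e h => absurd h (hH d e)) fun _ => .refl _).congr (.refl H) h

end JunctionTrack

/-! ### Loops at one switch together with edges joining the switches -/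

namespace JunctionTrack

/-- The family `G` with all its ends at the switch `s`. -/
def atSwitch (G : JunctionTrack) (s : Side) : JunctionTrack := { G with side := fun _ => s }

/-- The loops of `G`, attached to the switch `s`, together with edges joining the two switches at
the levels given by `T`. -/
def model (G : JunctionTrack) (s : Side) (T : Level → Prop) : JunctionTrack :=
  (G.atSwitch s).addThrough T

/-- An end of a loop. -/
def IsLoop (G : JunctionTrack) (d : G.Dart) : Prop := G.side (G.pair d) = G.side d

variable {G H B : JunctionTrack}

theorem IsPlanar.atSwitch (h : (B.atSwitch .left).IsPlanar) (s : Side) :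
    (B.atSwitch s).IsPlanar :=
  { h with right_lt_left := fun _ _ h1 h2 => absurd (h1.symm.trans h2) (by simp) }

theorem parallel_atSwitch {s s' : Side} {d e : B.Dart} :
    (B.atSwitch s).Parallel d e ↔ (B.atSwitch s').Parallel d e := by
  simp only [Parallel, JunctionTrack.atSwitch, Between]

theorem finite_side : Finite Side :=
  Finite.of_injective (fun s : Side => match s with | .left => true | .right => false)
    (fun s s' h => by cases s <;> cases s' <;> simp at h ⊢)

theorem finite_level : Finite Level :=
  Finite.of_injective (fun s : Level => match s with | .lower => true | .upper => false)
    (fun s s' h => by cases s <;> cases s' <;> simp at h ⊢)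

theorem IsPlanar.model (h : (B.atSwitch .left).IsPlanar) (s : Side) (T : Level → Prop) :
    (B.model s T).IsPlanar := by
  replace h := h.atSwitch s
  have ho := h.isOrdered.addThrough T
  exact
  { countable := by
      have := finite_side
      have := finite_level
      have : Countable B.Dart := h.countable
      exact inferInstanceAs (Countable (B.Dart ⊕ ({l : Level // T l} × Side)))
    order :=
      { irrefl := ho.irrefl
        trans := ho.trans
        trichotomous := fun a b h1 h2 => by
          have := ho.total a b
          exact (this.resolve_left h1).resolve_right h2 }
    pair_pair := ho.pair_pair
    pair_ne := by
      rintro (d | ⟨l, d⟩) h'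
      · exact h.pair_ne d (Sum.inl.inj h')
      · have := (Prod.mk.inj (Sum.inr.inj h')).2
        cases d <;> simp [Side.flip] at this
    right_lt_left := ho.right_lt_left
    enc_pair := ho.enc_pair
    noncrossing := by
      rintro (d | ⟨⟨l, hl⟩, d⟩) (e | ⟨⟨l', hl'⟩, e⟩)
      · exact h.noncrossing d e
      · rintro ⟨h1, h2, h3⟩
        exact absurd (lt_trans h1 h2) (lt_irrefl _)
      · rintro ⟨h1, h2, h3⟩
        exact absurd (lt_trans h2 h3) (lt_irrefl _)
      · cases l <;> cases l' <;> cases d <;> cases e <;>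
          simp [JunctionTrack.model, addThrough, Level.block, Side.flip]
    enc_nested := by
      rintro (d | ⟨⟨l, hl⟩, d⟩) (e | ⟨⟨l', hl'⟩, e⟩)
      · exact h.enc_nested d e
      · intro h1 h2 h3 _
        exact absurd (lt_trans h1 (lt_trans h2 h3)) (lt_irrefl _)
      · cases l <;> cases d <;> cases s <;>
          simp [JunctionTrack.model, addThrough, Level.block, Side.flip, JunctionTrack.atSwitch,
            Side.block]
      · cases l <;> cases l' <;> cases d <;> cases e <;>
          simp [JunctionTrack.model, addThrough, Level.block, Side.flip]
    enc_disjoint := by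
      rintro (d | ⟨⟨l, hl⟩, d⟩) (e | ⟨⟨l', hl'⟩, e⟩)
      · exact h.enc_disjoint d e
      · cases l' <;> cases e <;> cases s <;>
          simp [JunctionTrack.model, addThrough, Level.block, Side.flip, JunctionTrack.atSwitch,
            Side.block]
      · cases l <;> cases d <;> cases s <;>
          simp [JunctionTrack.model, addThrough, Level.block, Side.flip, JunctionTrack.atSwitch,
            Side.block]
      · cases l <;> cases l' <;> cases d <;> cases e <;>
          simp [JunctionTrack.model, addThrough, Level.block, Side.flip] }

theorem model_not_parallel {s : Side} (h : ∀ d e, ¬ (B.atSwitch s).Parallel d e)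
    (T : Level → Prop) : ∀ d e, ¬ (B.model s T).Parallel d e := by
  rintro (d | ⟨⟨l, hl⟩, d⟩) (e | ⟨⟨l', hl'⟩, e⟩) ⟨h1, h2, h3, h4, h5, h6, h7⟩
  · exact h d e ⟨fun h => h1 (congrArg _ h), fun h => h2 (congrArg _ h), rfl, rfl, h5, h6,
      fun x => h7 (.inl x)⟩
  · simp only [JunctionTrack.model, addThrough, JunctionTrack.atSwitch] at h3 h4
    rw [← h3] at h4
    cases s <;> simp [Side.flip] at h4
  · simp only [JunctionTrack.model, addThrough, JunctionTrack.atSwitch] at h3 h4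
    rw [h3] at h4
    cases s <;> simp [Side.flip] at h4
  · simp only [JunctionTrack.model, addThrough] at h3 h5
    refine h1 ?_
    subst h3
    cases l <;> cases l' <;> first | rfl | simp at h5

theorem not_isLoop_inr (U : Level → Prop) (x : {l : Level // U l} × Side) :
    ¬ (G.addThrough U).IsLoop (.inr x) := by
  obtain ⟨l, s⟩ := x
  cases s <;> simp [IsLoop, addThrough, Side.flip]

theorem IsWeakMap.isLoop_iff {φ : H.Dart → G.Dart} (h : IsWeakMap H G φ) (d : H.Dart) :
    G.IsLoop (φ d) ↔ H.IsLoop d := by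
  rw [IsLoop, IsLoop, ← h.pair, h.side, h.side]

theorem IsWeakMap.model {φ : H.Dart → G.Dart}
    (h : IsWeakMap (H.atSwitch .left) (G.atSwitch .left) φ)
    (s : Side) (T : Level → Prop) : IsWeakMap (H.model s T) (G.model s T) (Sum.map φ id) :=
  IsWeakMap.addThrough (H := H.atSwitch s) (G := G.atSwitch s)
    ⟨h.pair, fun _ => rfl, h.lt, h.enc⟩ T

/-- The action of the rotation on the edges of `G.model s T`. -/
def turn (G : JunctionTrack) (s : Side) (T : Level → Prop) :
    (G.model s.flip fun l => T l.flip).Dart → (G.model s T).rotate.Dart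
  | .inl d => .inl d
  | .inr (⟨l, hl⟩, e) => .inr (⟨l.flip, hl⟩, e.flip)

/-- Rotating the family `G.model s T` gives a family of the same form. -/
theorem isEmbedding_turn (G : JunctionTrack) (s : Side) (T : Level → Prop) :
    IsEmbedding (G.model s.flip fun l => T l.flip) (G.model s T).rotate (turn G s T) ∧
        Function.Surjective (turn G s T) := by
  refine ⟨⟨?_, ?_, ?_, ?_, ?_⟩, ?_⟩
  · rintro (d | ⟨⟨l, hl⟩, d⟩) (e | ⟨⟨l', hl'⟩, e⟩) h
    · rw [Sum.inl.inj h]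
    · exact absurd h (by simp [turn])
    · exact absurd h (by simp [turn])
    · obtain ⟨h1, h2⟩ := Prod.mk.inj (Sum.inr.inj h)
      replace h1 := Subtype.mk.inj h1
      obtain rfl : l = l' := by rw [← l.flip_flip, h1, l'.flip_flip]
      obtain rfl : d = e := by rw [← d.flip_flip, h2, e.flip_flip]
      rfl
  · rintro (d | ⟨⟨l, hl⟩, d⟩)
    · rfl
    · rfl
  · rintro (d | ⟨⟨l, hl⟩, d⟩)
    · rfl
    · exact d.flip_flip
  · rintro (d | ⟨⟨l, hl⟩, d⟩) (e | ⟨⟨l', hl'⟩, e⟩)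
    · simp [JunctionTrack.model, addThrough, rotate, turn, JunctionTrack.atSwitch]
    · cases l' <;> cases e <;> cases s <;>
        simp [JunctionTrack.model, addThrough, rotate, turn, JunctionTrack.atSwitch, Level.block,
          Side.block, Side.flip, Level.flip]
    · cases l <;> cases d <;> cases s <;>
        simp [JunctionTrack.model, addThrough, rotate, turn, JunctionTrack.atSwitch, Level.block,
          Side.block, Side.flip, Level.flip]
    · cases l <;> cases d <;> cases l' <;> cases e <;>
        simp [JunctionTrack.model, addThrough, rotate, turn, JunctionTrack.atSwitch, Level.block,
          Side.flip, Level.flip]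
  · rintro (d | ⟨⟨l, hl⟩, d⟩)
    · simp [JunctionTrack.model, addThrough, rotate, turn, JunctionTrack.atSwitch]
    · cases l <;> cases d <;>
        simp [JunctionTrack.model, addThrough, rotate, turn, Side.flip, Level.flip]
  · rintro (d | ⟨⟨l, hl⟩, d⟩)
    · exact ⟨.inl d, rfl⟩
    · refine ⟨.inr (⟨l.flip, by simpa only [Level.flip_flip] using hl⟩, d.flip), ?_⟩
      exact congrArg Sum.inr (Prod.ext (Subtype.ext l.flip_flip) d.flip_flip)

variable {s : Side} {T U V : Level → Prop}

/-- The inclusion of the amalgamated family: where there are two parallel edges joining the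
switches, the old one is kept. -/
def keep (hV : ∀ l, V l ↔ T l ∨ U l) :
    (G.model s V).Dart → ((G.model s T).addThrough U).Dart
  | .inl d => .inl (.inl d)
  | .inr (⟨l, hl⟩, e) =>
      if h : T l then .inl (.inr (⟨l, h⟩, e))
      else .inr (⟨l, ((hV l).1 hl).resolve_left h⟩, e)

theorem keep_old (hV : ∀ l, V l ↔ T l ∨ U l) {l : Level} (hl : V l) (h : T l) (e : Side) :
    keep (G := G) (s := s) hV (.inr (⟨l, hl⟩, e)) = .inl (.inr (⟨l, h⟩, e)) := dif_pos h

theorem keep_new (hV : ∀ l, V l ↔ T l ∨ U l) {l : Level} (hl : V l) (h : ¬ T l) (e : Side) :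
    keep (G := G) (s := s) hV (.inr (⟨l, hl⟩, e)) =
      .inr (⟨l, ((hV l).1 hl).resolve_left h⟩, e) := dif_neg h

/-- The map that takes each edge to the edge with which it is amalgamated. -/
def merge (hV : ∀ l, V l ↔ T l ∨ U l) :
    ((G.model s T).addThrough U).Dart → (G.model s V).Dart
  | .inl (.inl d) => .inl d
  | .inl (.inr (⟨l, hl⟩, e)) => .inr (⟨l, (hV l).2 (.inl hl)⟩, e)
  | .inr (⟨l, hl⟩, e) => .inr (⟨l, (hV l).2 (.inr hl)⟩, e)

theorem merge_keep (hV : ∀ l, V l ↔ T l ∨ U l) (x : (G.model s V).Dart) :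
    merge hV (keep hV x) = x := by
  rcases x with d | ⟨⟨l, hl⟩, d⟩
  · rfl
  · by_cases h1 : T l
    · rw [keep_old hV hl h1]; rfl
    · rw [keep_new hV hl h1]; rfl

theorem isEmbedding_keep (hV : ∀ l, V l ↔ T l ∨ U l) :
    IsEmbedding (G.model s V) ((G.model s T).addThrough U) (keep hV) where
  injective := Function.LeftInverse.injective (merge_keep hV)
  pair := by
    rintro (d | ⟨⟨l, hl⟩, d⟩)
    · rfl
    · by_cases h1 : T l <;> simp [keep, h1, JunctionTrack.model, addThrough]
  side := by
    rintro (d | ⟨⟨l, hl⟩, d⟩)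
    · rfl
    · by_cases h1 : T l <;> simp [keep, h1, JunctionTrack.model, addThrough]
  lt := by
    rintro (d | ⟨⟨l, hl⟩, d⟩) (e | ⟨⟨l', hl'⟩, e⟩)
    · rfl
    · by_cases h1 : T l' <;> simp [keep, h1, JunctionTrack.model, addThrough]
    · by_cases h1 : T l <;> simp [keep, h1, JunctionTrack.model, addThrough]
    · by_cases h1 : T l <;> by_cases h2 : T l'
      · simp [keep, h1, h2, JunctionTrack.model, addThrough]
      · have h3 : l ≠ l' := fun h => h2 (h ▸ h1)
        cases l <;> cases l' <;> cases d <;> cases e <;>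
          simp [keep, h1, h2, JunctionTrack.model, addThrough, Level.block, Side.block] at h3 ⊢
      · have h3 : l ≠ l' := fun h => h1 (h ▸ h2)
        cases l <;> cases l' <;> cases d <;> cases e <;>
          simp [keep, h1, h2, JunctionTrack.model, addThrough, Level.block, Side.block] at h3 ⊢
      · simp [keep, h1, h2, JunctionTrack.model, addThrough]
  enc := by
    rintro (d | ⟨⟨l, hl⟩, d⟩)
    · rfl
    · by_cases h1 : T l <;> simp [keep, h1, JunctionTrack.model, addThrough]

/-- Adding edges outside a family which has already such edges amounts, after amalgamation, to
forming the union of the sets of levels. -/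
theorem isAmalgamation_keep (hV : ∀ l, V l ↔ T l ∨ U l)
    (hB : ∀ d e, ¬ (B.atSwitch s).Parallel d e) :
    (B.model s V).IsAmalgamation ((B.model s T).addThrough U) := by
  refine isAmalgamation_of_retraction (isEmbedding_keep hV) (merge_keep hV) ?_ ?_
  · have key (l l' : Level) (d e : Side) (h : d = e) (h' : l = .lower ↔ l' = .lower)
        (h1 : V l) (h2 : V l') :
        (.inr (⟨l, h1⟩, d) : (B.model s V).Dart) = .inr (⟨l', h2⟩, e) := by
      subst h
      obtain rfl : l = l' := by cases l <;> cases l' <;> simp at h' ⊢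
      rfl
    rintro ((d | ⟨⟨l, hl⟩, d⟩) | ⟨⟨l, hl⟩, d⟩) ((e | ⟨⟨l', hl'⟩, e⟩) | ⟨⟨l', hl'⟩, e⟩)
      ⟨h1, h2, h3, h4, h5, h6, h7⟩
    · exact absurd ⟨fun h => h1 (congrArg _ (congrArg _ h)),
        fun h => h2 (congrArg _ (congrArg _ h)), rfl, rfl, h5, h6,
        fun x => h7 (.inl (.inl x))⟩ (hB d e)
    all_goals first
      | exact key _ _ _ _ h3 h5 _ _
      | (simp only [JunctionTrack.model, addThrough, JunctionTrack.atSwitch] at h3 h4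
         subst h3
         cases s <;> simp [Side.flip] at h4)
      | (simp only [JunctionTrack.model, addThrough, JunctionTrack.atSwitch] at h3 h4
         subst h3
         cases d <;> simp [Side.flip] at h4)
  · rintro ((d | ⟨⟨l, hl⟩, d⟩) | ⟨⟨l, hl⟩, d⟩)
    · exact .refl _
    · rw [merge, keep_old hV _ hl]
      exact .refl _
    · by_cases h1 : T l
      · rw [merge, keep_old hV _ h1]
        refine .rel _ _ ⟨Sum.inr_ne_inl, Sum.inl_ne_inr, rfl, rfl, Iff.rfl, ?_, ?_⟩
        · cases l <;> cases d <;>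
            simp [JunctionTrack.model, addThrough, Level.block, Side.block, Side.flip]
        · rintro ((x | ⟨⟨l', hl'⟩, x⟩) | ⟨⟨l', hl'⟩, x⟩)
          · cases l <;> cases d <;> cases s <;>
              simp [JunctionTrack.model, addThrough, Level.block, Side.block, Side.flip, Between,
                JunctionTrack.atSwitch]
          · cases l <;> cases d <;> cases l' <;> cases x <;>
              simp [JunctionTrack.model, addThrough, Level.block, Side.block, Side.flip, Between]
          · cases l <;> cases d <;> cases l' <;> cases x <;>
              simp [JunctionTrack.model, addThrough, Level.block, Side.block, Side.flip, Between]
      · rw [merge, keep_new hV _ h1]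
        exact .refl _

theorem equivalent_addThrough_of_empty (hU : ∀ l, ¬ U l) : G.Equivalent (G.addThrough U) := by
  refine ⟨.inl, ⟨Sum.inl_injective, fun _ => rfl, fun _ => rfl, fun _ _ => Iff.rfl,
    fun _ => Iff.rfl⟩, ?_⟩
  rintro (d | ⟨⟨l, hl⟩, _⟩)
  · exact ⟨d, rfl⟩
  · exact absurd hl (hU l)

end JunctionTrack

/-! ### Unfolding an invariant track -/

open JunctionTrack

/-- The passage from a family `X` to the family `Y` obtained by adding edges outside `X` and
amalgamating. -/
theorem JunctionTrack.IsAmalgamation.exists_step {X Y : JunctionTrack} {U : Level → Prop}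
    (hX : X.IsOrdered) (h : Y.IsAmalgamation (X.addThrough U)) :
    ∃ c : X.Dart → Y.Dart, IsWeakMap X Y c ∧ (∀ y, Y.IsLoop y → ∃ x, X.IsLoop x ∧ c x = y) ∧
      ((∀ l, ¬ U l) → Function.Surjective c) ∧
      ∀ (G : JunctionTrack) (s : Side) (T : Level → Prop) (e : (G.model s T).Dart → X.Dart),
        IsWeakMap (G.model s T) X e →
          ∃ e' : (G.model s fun l => T l ∨ U l).Dart → Y.Dart,
            IsWeakMap (G.model s fun l => T l ∨ U l) Y e' ∧ ∀ g, e' (.inl g) = c (e (.inl g)) := by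
  obtain ⟨ρ, hρ, hs⟩ := h.exists_isWeakMap (hX.addThrough U)
  refine ⟨fun x => ρ (.inl x), ?_, fun y hy => ?_, fun hU y => ?_, fun G s T e he => ?_⟩
  · exact hρ.comp (H := X.addThrough U) (ψ := Sum.inl)
      ⟨fun _ => rfl, fun _ => rfl, fun _ _ h => .inr h, fun _ => Iff.rfl⟩
  · obtain ⟨x | x, rfl⟩ := hs y
    · exact ⟨x, (hρ.isLoop_iff _).1 hy, rfl⟩
    · exact absurd ((hρ.isLoop_iff _).1 hy) (not_isLoop_inr U x)
  · obtain ⟨x | x, rfl⟩ := hs y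
    · exact ⟨x, rfl⟩
    · exact absurd x.1.2 (hU _)
  · exact ⟨_, hρ.comp ((he.addThrough U).comp (isEmbedding_keep fun l => Iff.rfl).isWeakMap),
      fun g => rfl⟩

namespace CriticalOrbit

variable {f : UnimodalMap} {N : ℕ} (P : CriticalOrbit f N)

theorem rawImage_perm (τ : Track N) (i : Fin N) : P.rawImage τ (P.perm i) =
    (P.push i (τ i)).addThrough (P.passes (P.perm i)) := by
  rw [rawImage, Equiv.symm_apply_apply]

/-- The levels of the edges joining the switches, after one application of the map. -/
theorem edgesAt_succ (r : ℕ) : P.edgesAt (r + 1) = fun l =>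
    P.edgesAt r (if P.orbit r < P.crit then l else l.flip) ∨ P.passes (P.orbit (r + 1)) l := rfl

variable {P}

theorem IsInvariant.exists_step {τ : Track N} (h : P.IsInvariant τ) (i : Fin N) :
    ∃ q : (τ i).Dart → (τ (P.perm i)).Dart,
      (i ≠ P.crit → (∀ y, (τ (P.perm i)).IsLoop y → ∃ x, (τ i).IsLoop x ∧ q x = y) ∧
        ∀ (G : JunctionTrack) (s : Side) (T : Level → Prop) (e : (G.model s T).Dart → (τ i).Dart),
          IsWeakMap (G.model s T) (τ i) e →
          ∀ (s' : Side) (T' : Level → Prop), s' = (if i < P.crit then s else s.flip) →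
          (T' = fun l => T (if i < P.crit then l else l.flip) ∨ P.passes (P.perm i) l) →
          ∃ e' : (G.model s' T').Dart → (τ (P.perm i)).Dart,
            IsWeakMap (G.model s' T') (τ (P.perm i)) e' ∧ ∀ g, e' (.inl g) = q (e (.inl g))) ∧
      (i = P.crit → Function.Surjective q ∧ IsWeakMap (τ i).fold (τ (P.perm i)) q) := by
  have ho := (h.1.planar i).isOrdered
  have ha := h.2 (P.perm i)
  rw [P.rawImage_perm, push] at ha
  rcases lt_trichotomy i P.crit with hi | hi | hi
  · rw [if_pos hi] at ha
    obtain ⟨c, -, h1, -, h2⟩ := ha.exists_step ho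
    refine ⟨c, fun _ => ⟨h1, fun G s T e he s' T' hs hT => ?_⟩, fun h => absurd h hi.ne⟩
    simp only [if_pos hi] at hs hT
    subst hs hT
    exact h2 G _ T e he
  · rw [if_neg hi.not_lt, if_pos hi] at ha
    obtain ⟨c, h1, -, h2, -⟩ := ha.exists_step ho.fold
    refine ⟨c, fun h => absurd hi h, fun _ => ⟨h2 ?_, h1⟩⟩
    rw [hi]
    exact P.not_passes_last
  · rw [if_neg hi.asymm, if_neg hi.ne'] at ha
    obtain ⟨c, -, h1, -, h2⟩ := ha.exists_step ho.rotate
    refine ⟨c, fun _ => ⟨fun y hy => ?_, fun G s T e he s' T' hs hT => ?_⟩,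
      fun h => absurd h hi.ne'⟩
    · obtain ⟨x, hx, rfl⟩ := h1 y hy
      refine ⟨x, ?_, rfl⟩
      change ((τ i).side ((τ i).pair x)).flip = ((τ i).side x).flip at hx
      change (τ i).side ((τ i).pair x) = (τ i).side x
      rw [← Side.flip_flip ((τ i).side ((τ i).pair x)), hx, Side.flip_flip]
    · simp only [if_neg hi.asymm] at hs hT
      subst hs hT
      exact h2 G s.flip (fun l => T l.flip) (e ∘ turn G s T)
        (he.rotate.comp (isEmbedding_turn G s T).1.isWeakMap)

/-- The loops of an invariant track in the last junction, together with the edges that are forced,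
map to all junctions; and the return map of the last junction to itself is recovered by folding
the junction of the turning point. -/
theorem IsInvariant.exists_unfolding {τ : Track N} (h : P.IsInvariant τ) :
    ∃ (e : ∀ r, r < N → ((τ P.last).model (P.sideAt r) (P.edgesAt r)).Dart → (τ (P.orbit r)).Dart)
      (θ : (τ P.crit).Dart → (τ P.last).Dart)
      (c : ((τ P.last).model (P.sideAt (N - 1)) (P.edgesAt (N - 1))).Dart → (τ P.crit).Dart),
      (∀ r hr, IsWeakMap _ _ (e r hr)) ∧
      (∀ r hr y, (τ (P.orbit r)).IsLoop y → ∃ g, e r hr (.inl g) = y) ∧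
      (∀ r hr g g', e r hr (.inl g) = e r hr (.inl g') → θ (c (.inl g)) = θ (c (.inl g'))) ∧
      Function.Surjective θ ∧ IsWeakMap (τ P.crit).fold (τ P.last) θ ∧
      IsWeakMap ((τ P.last).model (P.sideAt (N - 1)) (P.edgesAt (N - 1))) (τ P.crit) c ∧
      ∀ y, (τ P.crit).IsLoop y → ∃ g, c (.inl g) = y := by
  choose q hq hqc using h.exists_step
  let Q : (Σ i, (τ i).Dart) → Σ i, (τ i).Dart := fun x => ⟨P.perm x.1, q x.1 x.2⟩
  have key (r : ℕ) (hr : r < N) :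
      ∃ e : ((τ P.last).model (P.sideAt r) (P.edgesAt r)).Dart → (τ (P.orbit r)).Dart,
        IsWeakMap _ _ e ∧ (∀ y, (τ (P.orbit r)).IsLoop y → ∃ g, e (.inl g) = y) ∧
        ∀ g, (⟨P.orbit r, e (.inl g)⟩ : Σ i, (τ i).Dart) = Q^[r] ⟨P.last, g⟩ := by
    induction r with
    | zero =>
      refine ⟨fun d => match d with
        | .inl g => g
        | .inr x => absurd x.1.2 id, ⟨?_, ?_, ?_, ?_⟩, fun y _ => ⟨y, rfl⟩, fun g => rfl⟩
      · rintro (g | ⟨⟨_, h⟩, _⟩)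
        · rfl
        · exact absurd h id
      · rintro (g | ⟨⟨_, h⟩, _⟩)
        · exact h.1.last_side g
        · exact absurd h id
      · rintro (g | ⟨⟨_, h⟩, _⟩) (g' | ⟨⟨_, h'⟩, _⟩) hlt
        · exact .inr hlt
        · exact absurd h' id
        · exact absurd h id
        · exact absurd h id
      · rintro (g | ⟨⟨_, h⟩, _⟩)
        · rfl
        · exact absurd h id
    | succ r ih =>
      obtain ⟨e, he, hl, hQ⟩ := ih (by omega)
      obtain ⟨h1, h2⟩ := hq _ (P.orbit_ne_crit hr)
      rw [P.orbit_succ]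
      obtain ⟨e', he', hg⟩ := h2 _ _ _ e he _ _ (P.sideAt_succ r)
        ((P.edgesAt_succ r).trans (by rw [P.orbit_succ]))
      refine ⟨e', he', fun y hy => ?_, fun g => ?_⟩
      · obtain ⟨x, hx, rfl⟩ := h1 y hy
        obtain ⟨g, rfl⟩ := hl x hx
        exact ⟨g, hg g⟩
      · rw [Function.iterate_succ_apply', ← hQ g, hg g]
  choose e he hl hQ using key
  have hN := P.three_le
  have hc := P.orbit_N_sub_one
  obtain ⟨hs, hθ⟩ := hqc P.crit rfl
  obtain ⟨c, hcw, hcl, hcQ⟩ :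
      ∃ c : ((τ P.last).model (P.sideAt (N - 1)) (P.edgesAt (N - 1))).Dart → (τ P.crit).Dart,
        IsWeakMap _ _ c ∧ (∀ y, (τ P.crit).IsLoop y → ∃ g, c (.inl g) = y) ∧
        ∀ g, (⟨P.crit, c (.inl g)⟩ : Σ i, (τ i).Dart) = Q^[N - 1] ⟨P.last, g⟩ :=
    hc ▸ ⟨_, he (N - 1) (by omega), hl (N - 1) (by omega), hQ (N - 1) (by omega)⟩
  refine ⟨e, q P.crit, c, he, hl, fun r hr g g' hgg => ?_, hs, hθ, hcw, hcl⟩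
  have h1 : Q^[r] ⟨P.last, g⟩ = Q^[r] ⟨P.last, g'⟩ := by rw [← hQ r hr, ← hQ r hr, hgg]
  have h2 : Q^[N - 1] ⟨P.last, g⟩ = Q^[N - 1] ⟨P.last, g'⟩ := by
    rw [show N - 1 = (N - 1 - r) + r by omega, Function.iterate_add_apply, h1,
      ← Function.iterate_add_apply]
  have h3 := (hcQ g).trans (h2.trans (hcQ g').symm)
  exact congrArg (q P.crit) (eq_of_heq (Sigma.mk.inj h3).2)

end CriticalOrbit

/-! ### The configuration generated by a return map -/

namespace JunctionTrack

/-- The family obtained from the empty one by iterating the following operation: put the family at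
the switch `s`, add the edges joining the two switches at the levels given by `T`, and fold the
junction. The end `(k, z)` is the end `z` of an added edge which has been carried along `k` times.
When two ends are compared that have been carried along a different number of times, it is the
position of the one that was added later which matters, relative to the switch `s`, where the
other one was at that time. -/
def tower (s : Side) (T : Level → Prop) : JunctionTrack where
  Dart := ℕ × ({l : Level // T l} × Side)
  pair d := (d.1, d.2.1, d.2.2.flip)
  side _ := .left
  lt d e :=
    if d.1 < e.1 then d.2.1.1.block d.2.2 < s.block
    else if e.1 < d.1 then s.block < e.2.1.1.block e.2.2
    else d.2.1.1.block d.2.2 < e.2.1.1.block e.2.2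
  enc d := d.2.1.1 = .lower

variable {s : Side} {T : Level → Prop} {G : JunctionTrack}

theorem isPlanar_tower (s : Side) (T : Level → Prop) : (tower s T).IsPlanar where
  countable := by
    have := finite_side
    have := finite_level
    exact inferInstanceAs (Countable (ℕ × ({l : Level // T l} × Side)))
  order :=
    { irrefl := by
        rintro ⟨k, z⟩
        simp [tower]
      trans := by
        rintro ⟨k, z⟩ ⟨l, w⟩ ⟨m, v⟩
        simp only [tower]
        split_ifs <;> omega
      trichotomous := by
        rintro ⟨k, ⟨l, hl⟩, e⟩ ⟨k', ⟨l', hl'⟩, e'⟩ h1 h2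
        simp only [tower] at h1 h2
        rcases lt_trichotomy k k' with hk | rfl | hk
        · rw [if_pos hk] at h1
          rw [if_neg hk.asymm, if_pos hk] at h2
          cases l <;> cases e <;> cases s <;> simp [Level.block, Side.block] at h1 h2
        · cases l <;> cases e <;> cases l' <;> cases e' <;>
            first | rfl | simp [Level.block] at h1 h2
        · rw [if_pos hk] at h2
          rw [if_neg hk.asymm, if_pos hk] at h1
          cases l' <;> cases e' <;> cases s <;> simp [Level.block, Side.block] at h1 h2 }
  pair_pair := fun d => Prod.ext rfl (Prod.ext rfl d.2.2.flip_flip)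
  pair_ne := by
    rintro ⟨k, l, e⟩ h
    have := (Prod.mk.inj (Prod.mk.inj h).2).2
    cases e <;> simp [Side.flip] at this
  right_lt_left _ _ h1 _ := by simp [tower] at h1
  enc_pair _ := Iff.rfl
  noncrossing := by
    rintro ⟨k, ⟨l, hl⟩, e⟩ ⟨k', ⟨l', hl'⟩, e'⟩
    simp only [tower]
    cases l <;> cases e <;> cases l' <;> cases e' <;> cases s <;>
      simp only [Level.block, Side.block, Side.flip] <;> split_ifs <;> omega
  enc_nested := by
    rintro ⟨k, ⟨l, hl⟩, e⟩ ⟨k', ⟨l', hl'⟩, e'⟩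
    simp only [tower]
    rcases lt_trichotomy k k' with hk | rfl | hk
    · cases l <;> cases e <;> cases l' <;> cases e' <;> cases s <;>
        simp [hk, Level.block, Side.block, Side.flip]
    · cases l <;> cases e <;> cases l' <;> cases e' <;> simp [Level.block, Side.flip]
    · cases l <;> cases e <;> cases l' <;> cases e' <;> cases s <;>
        simp [hk, hk.asymm, Level.block, Side.block, Side.flip]
  enc_disjoint := by
    rintro ⟨k, ⟨l, hl⟩, e⟩ ⟨k', ⟨l', hl'⟩, e'⟩
    simp only [tower]
    rcases lt_trichotomy k k' with hk | rfl | hk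
    · cases l <;> cases e <;> cases l' <;> cases e' <;> cases s <;>
        simp [hk, Level.block, Side.block, Side.flip]
    · cases l <;> cases e <;> cases l' <;> cases e' <;> simp [Level.block, Side.flip]
    · cases l <;> cases e <;> cases l' <;> cases e' <;> cases s <;>
        simp [hk, hk.asymm, Level.block, Side.block, Side.flip]

/-- Consecutive non-trivial loops are separated by a trivial bubble. -/
theorem tower_not_parallel (hT : T .upper) : ∀ d e, ¬ (tower s T).Parallel d e := by
  rintro ⟨k, ⟨l, hl⟩, e⟩ ⟨k', ⟨l', hl'⟩, e'⟩ ⟨h1, h2, -, -, h5, h6, h7⟩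
  have h8 := h7 (k, ⟨.upper, hT⟩, .right)
  have h9 := h7 (k', ⟨.upper, hT⟩, .right)
  simp only [Between, tower] at h1 h2 h5 h6 h8 h9
  obtain rfl : l = l' := by cases l <;> cases l' <;> simp at h5 ⊢
  rcases lt_trichotomy k k' with hk | rfl | hk
  · cases l <;> cases e <;> cases e' <;> cases s <;>
      simp [hk, hk.asymm, Level.block, Side.block, Side.flip] at h6 h8 h9
  · cases e <;> cases e' <;> simp [Side.flip] at h1 h2
  · cases l <;> cases e <;> cases e' <;> cases s <;>
      simp [hk, hk.asymm, Level.block, Side.block, Side.flip] at h6 h8 h9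

/-- The self-similarity of the configuration. -/
theorem tower_equivalent (s : Side) (T : Level → Prop) :
    ((tower s T).model s T).fold.Equivalent (tower s T) := by
  refine ⟨fun d => match d with
    | .inl (k, z) => (k + 1, z)
    | .inr z => (0, z), ⟨?_, ?_, ?_, ?_, ?_⟩, ?_⟩
  · rintro (⟨k, z⟩ | z) (⟨l, w⟩ | w) h
    · obtain ⟨h1, rfl⟩ := Prod.mk.inj h
      obtain rfl : k = l := by omega
      rfl
    · exact absurd (Prod.mk.inj h).1 (by omega)
    · exact absurd (Prod.mk.inj h).1 (by omega)
    · rw [(Prod.mk.inj h).2]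
  · rintro (⟨k, z⟩ | z) <;> rfl
  · rintro (⟨k, z⟩ | z) <;> rfl
  · rintro (⟨k, z⟩ | z) (⟨l, w⟩ | w) <;>
      simp [tower, fold, JunctionTrack.model, addThrough, JunctionTrack.atSwitch]
  · rintro (⟨k, z⟩ | z) <;> exact Iff.rfl
  · rintro ⟨_ | k, z⟩
    · exact ⟨.inr z, rfl⟩
    · exact ⟨.inl (k, z), rfl⟩

theorem IsWeakMap.iterate {ψ : G.Dart → G.Dart} (h : IsWeakMap G G ψ) (k : ℕ) :
    IsWeakMap G G ψ^[k] := by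
  induction k with
  | zero => exact ⟨fun _ => rfl, fun _ => rfl, fun _ _ h => .inr h, fun _ => Iff.rfl⟩
  | succ k ih => exact ih.comp h

section Return

variable {Θ : (G.model s T).Dart → G.Dart}

/-- The return map of a family at a left switch to itself. -/
theorem IsWeakMap.return (hΘ : IsWeakMap (G.model s T).fold G Θ) (hl : ∀ d, G.side d = .left) :
    IsWeakMap G G (fun d => Θ (.inl d)) :=
  ⟨fun d => hΘ.pair (.inl d), fun d => by rw [hl, hl], fun d e h => hΘ.lt (.inl d) (.inl e) h,
    fun d => hΘ.enc (.inl d)⟩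

/-- The added edges are not identified with one another: they differ by the position of the
puncture. -/
theorem IsWeakMap.inr_injective (hΘ : IsWeakMap (G.model s T).fold G Θ)
    (hp : ∀ d, G.pair d ≠ d) {z w : {l : Level // T l} × Side} (h : Θ (.inr z) = Θ (.inr w)) :
    z = w := by
  obtain ⟨⟨l, hl⟩, e⟩ := z
  obtain ⟨⟨l', hl'⟩, e'⟩ := w
  have h1 := (hΘ.enc (.inr (⟨l, hl⟩, e))).symm.trans
    ((iff_of_eq (congrArg G.enc h)).trans (hΘ.enc (.inr (⟨l', hl'⟩, e'))))
  change l = .lower ↔ l' = .lower at h1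
  obtain rfl : l = l' := by cases l <;> cases l' <;> simp at h1 ⊢
  by_cases h2 : e = e'
  · rw [h2]
  · have h3 : e' = e.flip := by cases e <;> cases e' <;> simp [Side.flip] at h2 ⊢
    subst h3
    exact absurd (h.trans (hΘ.pair (.inr (⟨l, hl⟩, e)))).symm (hp _)

/-- If a trivial bubble is added, then the old edges are not identified with added ones. Both ends
of an old edge lie at the switch `s`; if it were identified with an added edge, then one of its
ends would be identified with the end of the latter at the other switch, and the end of the bubble
at `s`, which lies between these two, would be identified with them. -/
theorem IsWeakMap.inl_ne_inr (hΘ : IsWeakMap (G.model s T).fold G Θ) (hG : G.IsPlanar)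
    (hT : T .upper) (g : G.Dart) (z : {l : Level // T l} × Side) : Θ (.inl g) ≠ Θ (.inr z) := by
  have ho := hG.isOrdered
  intro h
  have h' : Θ (.inl (G.pair g)) = Θ (.inr (z.1, z.2.flip)) :=
    (hΘ.pair (.inl g)).trans ((congrArg G.pair h).trans (hΘ.pair (.inr z)).symm)
  have hw : ∀ e, ∃ g', Θ (.inl g') = Θ (.inr (z.1, e)) := fun e => by
    by_cases he : e = z.2
    · exact ⟨g, he ▸ h⟩
    · refine ⟨G.pair g, ?_⟩
      rwa [show e = z.2.flip by cases e <;> cases hz : z.2 <;> simp [hz, Side.flip] at he ⊢]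
  obtain ⟨g', hg'⟩ := hw s.flip
  -- the end of the bubble at the switch `s` is between the ends that are compared
  have hu : Θ (.inr (⟨.upper, hT⟩, s)) = Θ (.inr (z.1, s.flip)) := by
    have key (x y : (G.model s T).Dart) (h1 : (G.model s T).lt x (.inr (⟨.upper, hT⟩, s)))
        (h2 : (G.model s T).lt (.inr (⟨.upper, hT⟩, s)) y) (h3 : Θ x = Θ y) :
        Θ (.inr (⟨.upper, hT⟩, s)) = Θ x := by
      rcases hΘ.lt _ _ h1 with h4 | h4
      · exact h4.symm
      · rcases hΘ.lt _ _ h2 with h5 | h5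
        · exact h5.trans h3.symm
        · rw [← h3] at h5
          exact absurd h5 (ho.asymm h4)
    obtain ⟨⟨l, hl⟩, e⟩ := z
    cases s
    · exact key _ (.inl g')
        (show l.block .right < Level.block .upper .left by cases l <;> decide)
        (show Level.block .upper .left < Side.block .left by decide) hg'.symm
    · exact (key (.inl g') (.inr (⟨l, hl⟩, .left))
        (show Side.block .right < Level.block .upper .right by decide)
        (show Level.block .upper .right < l.block .left by cases l <;> decide) hg').trans hg'
  have := (Prod.mk.inj (hΘ.inr_injective hG.pair_ne hu)).2
  cases s <;> simp [Side.flip] at this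

/-- The map from `tower s T` to a family with a return map: the end `(k, z)` is the image of the
added end `z` under the `k`-th iterate of the return map. -/
def unfold (Θ : (G.model s T).Dart → G.Dart) (d : (tower s T).Dart) : G.Dart :=
  (fun g => Θ (.inl g))^[d.1] (Θ (.inr d.2))

theorem unfold_succ (Θ : (G.model s T).Dart → G.Dart) (k : ℕ) (z : {l : Level // T l} × Side) :
    unfold Θ (k + 1, z) = Θ (.inl (unfold Θ (k, z))) :=
  Function.iterate_succ_apply' _ _ _

theorem unfold_add (Θ : (G.model s T).Dart → G.Dart) (k j : ℕ)
    (z : {l : Level // T l} × Side) :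
    unfold Θ (k + j, z) = (fun g => Θ (.inl g))^[k] (unfold Θ (j, z)) :=
  Function.iterate_add_apply _ _ _ _

theorem IsWeakMap.isWeakMap_unfold (hΘ : IsWeakMap (G.model s T).fold G Θ)
    (hl : ∀ d, G.side d = .left) : IsWeakMap (tower s T) G (unfold Θ) where
  pair d := (((hΘ.return hl).iterate d.1).comp hΘ).pair (.inr d.2)
  side d := hl _
  enc d := (((hΘ.return hl).iterate d.1).comp hΘ).enc (.inr d.2)
  lt := by
    rintro ⟨k, z⟩ ⟨l, w⟩ h
    simp only [tower] at h
    rcases lt_trichotomy k l with hk | rfl | hk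
    · rw [if_pos hk] at h
      obtain ⟨j, rfl⟩ := Nat.exists_eq_add_of_lt hk
      rw [add_assoc, unfold_add, unfold_succ]
      exact (((hΘ.return hl).iterate k).comp hΘ).lt (.inr z) (.inl _) h
    · rw [if_neg (lt_irrefl _), if_neg (lt_irrefl _)] at h
      exact (((hΘ.return hl).iterate k).comp hΘ).lt (.inr z) (.inr w) h
    · rw [if_neg hk.asymm, if_pos hk] at h
      obtain ⟨j, rfl⟩ := Nat.exists_eq_add_of_lt hk
      rw [add_assoc, unfold_add, unfold_succ]
      exact (((hΘ.return hl).iterate l).comp hΘ).lt (.inl _) (.inr w) h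

theorem IsWeakMap.unfold_injective (hΘ : IsWeakMap (G.model s T).fold G Θ) (hG : G.IsPlanar)
    (hl : ∀ d, G.side d = .left) (hT : T .upper) : Function.Injective (unfold Θ) := by
  have key (k j : ℕ) (z w : {l : Level // T l} × Side) :
      unfold Θ (k + j + 1, w) ≠ unfold Θ (k, z) := by
    rw [add_assoc, unfold_add, unfold_succ]
    exact (((hΘ.return hl).iterate k).comp hΘ).inl_ne_inr hG hT _ z
  rintro ⟨k, z⟩ ⟨l, w⟩ h
  rcases lt_trichotomy k l with hk | rfl | hk
  · obtain ⟨j, rfl⟩ := Nat.exists_eq_add_of_lt hk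
    exact absurd h.symm (key _ _ _ _)
  · exact congrArg (Prod.mk k) ((((hΘ.return hl).iterate k).comp hΘ).inr_injective hG.pair_ne h)
  · obtain ⟨j, rfl⟩ := Nat.exists_eq_add_of_lt hk
    exact absurd h (key _ _ _ _)

/-- If the return map is surjective, and `G` is not larger than the tower, then it is not larger
than the image of the tower. Indeed, an end `x` which is not in this image lies in the images of
all iterates of the return map. If `x` corresponds to the end `(l, w)` of the tower, then all ends
`(k, w)` of the tower are mapped to one and the same side of `x`, but those with `k > l` lie on
the other side of `(l, w)`. -/
theorem IsWeakMap.unfold_surjective (hΘ : IsWeakMap (G.model s T).fold G Θ) (hG : G.IsPlanar)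
    (hl : ∀ d, G.side d = .left) (hT : T .upper) (hs : Function.Surjective Θ)
    {ψ : G.Dart → (tower s T).Dart} (hψ : IsEmbedding G (tower s T) ψ) :
    Function.Surjective (unfold Θ) := by
  intro x
  by_contra hx
  have hback (k : ℕ) : ∃ y, (∀ d, unfold Θ d ≠ y) ∧ (fun g => Θ (.inl g))^[k] y = x := by
    induction k with
    | zero => exact ⟨x, fun d h => hx ⟨d, h⟩, rfl⟩
    | succ k ih =>
      obtain ⟨y, hy, hxy⟩ := ih
      obtain ⟨g | z, rfl⟩ := hs y
      · exact ⟨g, fun d h => hy (d.1 + 1, d.2)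
          ((unfold_succ Θ d.1 d.2).trans (by rw [← h]; rfl)), hxy⟩
      · exact absurd rfl (hy (0, z))
  obtain ⟨⟨l, w⟩, hw⟩ : ∃ y, y = ψ x := ⟨_, rfl⟩
  -- an end of the form `(k, w)` which is mapped by `ψ` to a late end
  obtain ⟨k, hk⟩ : ∃ k, l < (ψ (unfold Θ (k, w))).1 := by
    by_contra! hle
    have := finite_side
    have := finite_level
    have hf : Set.Finite {y : ℕ × ({l : Level // T l} × Side) | y.1 ≤ l} := by
      have := (Set.finite_Iic l).prod (Set.finite_univ (α := {l : Level // T l} × Side))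
      exact this.subset fun y hy => ⟨hy, trivial⟩
    refine Set.infinite_univ (α := ℕ) (Set.Finite.of_finite_image (hf.subset ?_)
      (f := fun k => ψ (unfold Θ (k, w))) ?_)
    · rintro _ ⟨k, -, rfl⟩
      exact hle k
    · intro k _ k' _ h
      exact (Prod.mk.inj (hΘ.unfold_injective hG hl hT (hψ.injective h))).1
  obtain ⟨y, -, hy⟩ := hback (k + 1)
  have hΘk := ((hΘ.return hl).iterate k).comp hΘ
  have hxy : x = ((fun g => Θ (.inl g))^[k] ∘ Θ) (.inl y) := by
    rw [← hy, Function.iterate_succ_apply]; rfl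
  have hne : x ≠ _ := fun h => hΘk.inl_ne_inr hG hT y w (hxy.symm.trans h)
  have hbl := Level.block_ne w.1.1 w.2 s
  rcases lt_or_gt_of_ne hbl with hb | hb
  · have h1 : G.lt (unfold Θ (k, w)) x :=
      hxy ▸ (hΘk.lt (.inr w) (.inl y) hb).resolve_left fun h => hne (hxy.trans h.symm)
    have h2 := (hψ.lt _ _).2 h1
    rw [← hw] at h2
    simp only [tower] at h2
    rw [if_neg hk.asymm, if_pos hk] at h2
    omega
  · have h1 : G.lt x (unfold Θ (k, w)) :=
      hxy ▸ (hΘk.lt (.inl y) (.inr w) hb).resolve_left fun h => hne (hxy.trans h)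
    have h2 := (hψ.lt _ _).2 h1
    rw [← hw] at h2
    simp only [tower] at h2
    rw [if_pos hk] at h2
    omega

end Return

end JunctionTrack

/-! ### Minimal solutions of the return equation -/

namespace JunctionTrack

/-- `B` is the minimal family of loops in the last junction which is reproduced, when the edges at
the levels given by `T` are added to it at the switch `s` and the junction is folded. Minimality
says that it is mapped, without identifications, to every family `G` with a return map; the
composition with the return map is required to be injective because the loops in the other
junctions are determined by those in the last one up to what the return map identifies. The final
clause says that `G` is the image of `B` if it is equivalent to a part of `B` and is reproduced
entirely by the return map and the added edges. -/
structure IsMinimalReturn (s : Side) (T : Level → Prop) (B : JunctionTrack) : Prop where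
  planar : B.IsPlanar
  side_eq : ∀ d, B.side d = .left
  not_parallel : ∀ d e, ¬ B.Parallel d e
  isAmalgamation : B.IsAmalgamation (B.model s T).fold
  exists_map : ∀ (G : JunctionTrack) (Θ : (G.model s T).Dart → G.Dart), G.IsPlanar →
    (∀ d, G.side d = .left) → IsWeakMap (G.model s T).fold G Θ →
      ∃ b : B.Dart → G.Dart, IsWeakMap B G b ∧ Function.Injective (fun d => Θ (.inl (b d))) ∧
        ((∃ ψ, IsEmbedding G B ψ) → Function.Surjective Θ → Function.Surjective b)

variable {s : Side} {T : Level → Prop} {B : JunctionTrack}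

theorem isMinimalReturn_tower (hT : T .upper) : IsMinimalReturn s T (tower s T) where
  planar := isPlanar_tower s T
  side_eq _ := rfl
  not_parallel := tower_not_parallel hT
  isAmalgamation := (tower_equivalent s T).symm.isAmalgamation (tower_not_parallel hT)
  exists_map G Θ hG hl hΘ := by
    refine ⟨_, hΘ.isWeakMap_unfold hl, fun d e h => ?_, ?_⟩
    · have h1 : unfold Θ (d.1 + 1, d.2) = unfold Θ (e.1 + 1, e.2) :=
        (unfold_succ Θ d.1 d.2).trans (h.trans (unfold_succ Θ e.1 e.2).symm)
      have h2 := Prod.mk.inj (hΘ.unfold_injective hG hl hT h1)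
      exact Prod.ext (by omega) h2.2
    · rintro ⟨ψ, hψ⟩ hs
      exact hΘ.unfold_surjective hG hl hT hs hψ

theorem isPlanar_bubbleBP : (bubbleBP .left).IsPlanar where
  countable := inferInstanceAs (Countable Bool)
  order :=
    { irrefl := by rintro (_ | _) <;> simp [bubbleBP]
      trans := by rintro (_ | _) (_ | _) (_ | _) <;> simp [bubbleBP]
      trichotomous := by rintro (_ | _) (_ | _) <;> simp [bubbleBP] }
  pair_pair := by rintro (_ | _) <;> rfl
  pair_ne := by rintro (_ | _) <;> simp [bubbleBP]
  right_lt_left _ _ h _ := by simp [bubbleBP] at h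
  enc_pair _ := Iff.rfl
  noncrossing := by rintro (_ | _) (_ | _) <;> simp [bubbleBP]
  enc_nested := by rintro (_ | _) (_ | _) <;> simp [bubbleBP]
  enc_disjoint := by rintro (_ | _) (_ | _) <;> simp [bubbleBP]

/-- If only one edge is added, and it passes below the puncture, then it becomes a loop which is
parallel to the old one. -/
theorem isMinimalReturn_bubbleBP (hT : T .lower) (hT' : ¬ T .upper) :
    IsMinimalReturn .left T (bubbleBP .left) where
  planar := isPlanar_bubbleBP
  side_eq _ := rfl
  not_parallel := by rintro (_ | _) (_ | _) ⟨h1, h2, -⟩ <;> simp [bubbleBP] at h1 h2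
  isAmalgamation := by
    let φ : (bubbleBP .left).Dart → ((bubbleBP .left).model .left T).fold.Dart
      | false => .inr (⟨.lower, hT⟩, .right)
      | true => .inr (⟨.lower, hT⟩, .left)
    let ρ : ((bubbleBP .left).model .left T).fold.Dart → (bubbleBP .left).Dart
      | .inl d => d
      | .inr (_, .right) => false
      | .inr (_, .left) => true
    have hφ : IsEmbedding (bubbleBP .left) ((bubbleBP .left).model .left T).fold φ := by
      refine ⟨?_, ?_, ?_, ?_, ?_⟩
      · exact Function.LeftInverse.injective (g := ρ) (by rintro (_ | _) <;> rfl)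
      · rintro (_ | _) <;> rfl
      · rintro (_ | _) <;> rfl
      · rintro (_ | _) (_ | _) <;>
          simp [φ, bubbleBP, fold, JunctionTrack.model, addThrough, Level.block]
      · rintro (_ | _) <;> simp [φ, bubbleBP, fold, JunctionTrack.model, addThrough]
    refine isAmalgamation_of_retraction hφ (ρ := ρ) ?_ ?_ ?_
    · rintro (_ | _) <;> rfl
    · rintro ((_ | _) | ⟨⟨_ | _, hl⟩, _ | _⟩) ((_ | _) | ⟨⟨_ | _, hl'⟩, _ | _⟩)
        ⟨h1, h2, -, -, -, -, h7⟩ <;> first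
        | rfl
        | exact absurd hl hT'
        | exact absurd hl' hT'
        | (have h8 := h7 (.inl false)
           have h9 := h7 (.inl true)
           simp [bubbleBP, fold, JunctionTrack.model, addThrough, Level.block, Side.block,
            JunctionTrack.atSwitch, Side.flip, Between] at h1 h2 h8 h9)
    · rintro ((_ | _) | ⟨⟨_ | _, hl⟩, _ | _⟩)
      · refine .rel _ _ ⟨Sum.inl_ne_inr, Sum.inr_ne_inl, rfl, rfl, ?_, ?_, ?_⟩
        · simp [φ, ρ, bubbleBP, fold, JunctionTrack.model, addThrough, JunctionTrack.atSwitch]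
        · simp [φ, ρ, bubbleBP, fold, JunctionTrack.model, addThrough, JunctionTrack.atSwitch,
            Level.block, Side.block, Side.flip]
        · rintro ((_ | _) | ⟨⟨_ | _, hl⟩, _ | _⟩) <;> first
          | exact absurd hl hT'
          | simp [φ, ρ, bubbleBP, fold, JunctionTrack.model, addThrough, JunctionTrack.atSwitch,
            Level.block, Side.block, Side.flip, Between]
      · refine .rel _ _ ⟨Sum.inl_ne_inr, Sum.inr_ne_inl, rfl, rfl, ?_, ?_, ?_⟩
        · simp [φ, ρ, bubbleBP, fold, JunctionTrack.model, addThrough, JunctionTrack.atSwitch]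
        · simp [φ, ρ, bubbleBP, fold, JunctionTrack.model, addThrough, JunctionTrack.atSwitch,
            Level.block, Side.block, Side.flip]
        · rintro ((_ | _) | ⟨⟨_ | _, hl⟩, _ | _⟩) <;> first
          | exact absurd hl hT'
          | simp [φ, ρ, bubbleBP, fold, JunctionTrack.model, addThrough, JunctionTrack.atSwitch,
            Level.block, Side.block, Side.flip, Between]
      · exact .refl _
      · exact .refl _
      · exact absurd hl hT'
      · exact absurd hl hT'
  exists_map G Θ hG hl hΘ := by
    let b : (bubbleBP .left).Dart → G.Dart
      | false => Θ (.inr (⟨.lower, hT⟩, .right))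
      | true => Θ (.inr (⟨.lower, hT⟩, .left))
    have hb : IsWeakMap (bubbleBP .left) G b := by
      refine ⟨?_, fun d => hl _, ?_, ?_⟩
      · rintro (_ | _)
        · exact hΘ.pair (.inr (⟨.lower, hT⟩, .right))
        · exact hΘ.pair (.inr (⟨.lower, hT⟩, .left))
      · rintro (_ | _) (_ | _) h
        · simp [bubbleBP] at h
        · exact hΘ.lt (.inr (⟨.lower, hT⟩, .right)) (.inr (⟨.lower, hT⟩, .left))
            (show Level.block .lower .right < Level.block .lower .left by decide)
        · simp [bubbleBP] at h
        · simp [bubbleBP] at h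
      · rintro (_ | _)
        · exact (hΘ.enc (.inr (⟨.lower, hT⟩, .right))).trans (iff_of_true rfl trivial)
        · exact (hΘ.enc (.inr (⟨.lower, hT⟩, .left))).trans (iff_of_true rfl trivial)
    -- a map which respects the pairing cannot identify the two ends
    have key {c : (bubbleBP .left).Dart → G.Dart} (hc : IsWeakMap (bubbleBP .left) G c) :
        Function.Injective c := by
      have h1 : c true ≠ c false := fun h => hG.pair_ne (c false) ((hc.pair false).symm.trans h)
      rintro (_ | _) (_ | _) h
      · rfl
      · exact absurd h.symm h1
      · exact absurd h h1
      · rfl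
    refine ⟨b, hb, key ((hΘ.return hl).comp hb), ?_⟩
    rintro ⟨ψ, hψ⟩ - x
    have : Finite (bubbleBP .left).Dart := inferInstanceAs (Finite Bool)
    obtain ⟨d, hd⟩ := Finite.surjective_of_injective (hψ.injective.comp (key hb)) (ψ x)
    exact ⟨d, hψ.injective hd⟩

/-! ### The towers are basic configurations -/

theorem tower_equivalent_bouquetS (hT : T .upper) (hT' : ¬ T .lower) :
    (tower .right T).Equivalent (bouquetS .left) := by
  refine ⟨fun d => (d.1, match d.2.2 with | .right => false | .left => true),
    ⟨?_, ?_, ?_, ?_, ?_⟩, ?_⟩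
  · rintro ⟨k, ⟨_ | _, hl⟩, _ | _⟩ ⟨k', ⟨_ | _, hl'⟩, _ | _⟩ h <;> first
      | exact absurd hl hT'
      | exact absurd hl' hT'
      | (obtain ⟨rfl, h2⟩ := Prod.mk.inj h
         first | rfl | simp at h2)
  · rintro ⟨k, z, _ | _⟩ <;> rfl
  · rintro ⟨k, z, _ | _⟩ <;> rfl
  · rintro ⟨k, ⟨_ | _, hl⟩, _ | _⟩ ⟨k', ⟨_ | _, hl'⟩, _ | _⟩ <;> first
      | exact absurd hl hT'
      | exact absurd hl' hT'
      | (rcases lt_trichotomy k k' with hk | rfl | hk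
         · simp [tower, bouquetS, hk, hk.ne, hk.asymm, Level.block, Side.block]
         · simp [tower, bouquetS, Level.block]
         · simp [tower, bouquetS, hk, hk.ne', hk.asymm, Level.block, Side.block])
  · rintro ⟨k, ⟨_ | _, hl⟩, e⟩
    · exact absurd hl hT'
    · simp [tower, bouquetS]
  · rintro ⟨k, _ | _⟩
    · exact ⟨(k, ⟨.upper, hT⟩, .right), rfl⟩
    · exact ⟨(k, ⟨.upper, hT⟩, .left), rfl⟩

theorem tower_equivalent_loopsW_plus (hT : ∀ l, T l) :
    (tower .right T).Equivalent (loopsW .plus .left) := by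
  let p : Side → Bool := fun e => match e with | .right => false | .left => true
  refine ⟨fun d => match d.2.1.1 with
    | .lower => .loop d.1 (p d.2.2)
    | .upper => .bubble d.1 (p d.2.2), ⟨?_, ?_, ?_, ?_, ?_⟩, ?_⟩
  · rintro ⟨k, ⟨_ | _, hl⟩, _ | _⟩ ⟨k', ⟨_ | _, hl'⟩, _ | _⟩ h <;>
      (change @Eq WDart _ _ at h; simp [p] at h; try rw [h])
  · rintro ⟨k, ⟨_ | _, hl⟩, _ | _⟩ <;> rfl
  · rintro ⟨k, z, _ | _⟩ <;> rfl
  · rintro ⟨k, ⟨_ | _, hl⟩, _ | _⟩ ⟨k', ⟨_ | _, hl'⟩, _ | _⟩ <;>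
      simp only [tower, loopsW, loopsWPlus, p, WDart.key, Prod.lex_def,
        Level.block, Side.block] <;>
      split_ifs <;> simp <;> omega
  · rintro ⟨k, ⟨_ | _, hl⟩, e⟩ <;> simp [tower, loopsW, loopsWPlus]
  · rintro (⟨k, _ | _⟩ | ⟨k, _ | _⟩)
    · exact ⟨(k, ⟨.lower, hT _⟩, .right), rfl⟩
    · exact ⟨(k, ⟨.lower, hT _⟩, .left), rfl⟩
    · exact ⟨(k, ⟨.upper, hT _⟩, .right), rfl⟩
    · exact ⟨(k, ⟨.upper, hT _⟩, .left), rfl⟩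

theorem tower_equivalent_loopsW_minus (hT : ∀ l, T l) :
    (tower .left T).Equivalent (loopsW .minus .left) := by
  let p : Side → Bool := fun e => match e with | .right => true | .left => false
  refine ⟨fun d => match d.2.1.1 with
    | .lower => .loop d.1 (p d.2.2)
    | .upper => .bubble d.1 (p d.2.2), ⟨?_, ?_, ?_, ?_, ?_⟩, ?_⟩
  · rintro ⟨k, ⟨_ | _, hl⟩, _ | _⟩ ⟨k', ⟨_ | _, hl'⟩, _ | _⟩ h <;>
      (change @Eq WDart _ _ at h; simp [p] at h; try rw [h])
  · rintro ⟨k, ⟨_ | _, hl⟩, _ | _⟩ <;> rfl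
  · rintro ⟨k, z, _ | _⟩ <;> rfl
  · rintro ⟨k, ⟨_ | _, hl⟩, _ | _⟩ ⟨k', ⟨_ | _, hl'⟩, _ | _⟩ <;>
      simp only [tower, loopsW, loopsWPlus, reflect, p, WDart.key, Prod.lex_def, Level.block,
        Side.block] <;>
      split_ifs <;> simp <;> omega
  · rintro ⟨k, ⟨_ | _, hl⟩, e⟩ <;> simp [tower, loopsW, loopsWPlus, reflect]
  · rintro (⟨k, _ | _⟩ | ⟨k, _ | _⟩)
    · exact ⟨(k, ⟨.lower, hT _⟩, .left), rfl⟩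
    · exact ⟨(k, ⟨.lower, hT _⟩, .right), rfl⟩
    · exact ⟨(k, ⟨.upper, hT _⟩, .left), rfl⟩
    · exact ⟨(k, ⟨.upper, hT _⟩, .right), rfl⟩

end JunctionTrack

namespace JunctionTrack

variable {s : Side} {T : Level → Prop} {B G H : JunctionTrack}

theorem equivalent_atSwitch (h : ∀ d, B.side d = s) : B.Equivalent (B.atSwitch s) :=
  ⟨id, ⟨Function.injective_id, fun _ => rfl, fun d => (h d).symm, fun _ _ => Iff.rfl,
    fun _ => Iff.rfl⟩, Function.surjective_id⟩

theorem Equivalent.model (h : H.Equivalent G) (s : Side) (T : Level → Prop) :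
    (H.model s T).Equivalent (G.model s T) := by
  obtain ⟨φ, hφ, hs⟩ := h
  exact Equivalent.addThrough (H := H.atSwitch s) (G := G.atSwitch s)
    ⟨φ, ⟨hφ.injective, hφ.pair, fun _ => rfl, hφ.lt, hφ.enc⟩, hs⟩ T

theorem IsMinimalReturn.isPlanar_atSwitch (hB : IsMinimalReturn s T B) :
    (B.atSwitch .left).IsPlanar :=
  { hB.planar with right_lt_left := fun _ _ h _ => by simp [JunctionTrack.atSwitch] at h }

theorem IsMinimalReturn.not_parallel_atSwitch (hB : IsMinimalReturn s T B) (s' : Side)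
    (d e : B.Dart) : ¬ (B.atSwitch s').Parallel d e := by
  rw [parallel_atSwitch (s' := .left)]
  rintro ⟨h1, h2, -, -, h5⟩
  exact hB.not_parallel d e ⟨h1, h2, by rw [hB.side_eq, hB.side_eq],
    by rw [hB.side_eq, hB.side_eq], h5⟩

/-- An end of an edge joining the switches is determined by its side and by the position of the
puncture relative to the edge. -/
theorem model_inr_ext {x y : {l : Level // T l} × Side}
    (h1 : (G.model s T).side (.inr x) = (G.model s T).side (.inr y))
    (h2 : (G.model s T).enc (.inr x) ↔ (G.model s T).enc (.inr y)) : x = y := by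
  obtain ⟨⟨l, hl⟩, e⟩ := x
  obtain ⟨⟨l', hl'⟩, e'⟩ := y
  change e = e' at h1
  change l = .lower ↔ l' = .lower at h2
  subst h1
  cases l <;> cases l' <;> first | rfl | simp at h2

/-- If `H` is part of a family of the form `B.model s T`, then all its edges joining the switches
come from any family `G.model s T` that is mapped to `H`. -/
theorem IsWeakMap.exists_inr {e : (G.model s T).Dart → H.Dart} (he : IsWeakMap (G.model s T) H e)
    {ψ : H.Dart → (B.model s T).Dart} (hψ : IsEmbedding H (B.model s T) ψ) {y : H.Dart}
    (hy : ¬ H.IsLoop y) : ∃ z, e (.inr z) = y := by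
  have hw := hψ.isWeakMap
  rcases h1 : ψ y with d | z
  · refine absurd ?_ hy
    rw [← hw.isLoop_iff, h1]
    rfl
  · refine ⟨z, hψ.injective ?_⟩
    rcases h2 : ψ (e (.inr z)) with d | w
    · refine absurd ?_ (not_isLoop_inr (G := G.atSwitch s) T z)
      refine (he.isLoop_iff (.inr z)).1 ((hw.isLoop_iff _).1 ?_)
      rw [h2]
      rfl
    · rw [h1]
      refine congrArg Sum.inr (model_inr_ext (G := B) (s := s) ?_ ?_)
      · rw [← h2, hw.side]
        exact he.side (.inr z)
      · rw [← h2, hw.enc]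
        exact he.enc (.inr z)

end JunctionTrack

/-! ### The invariant track -/

open JunctionTrack

namespace CriticalOrbit

variable {f : UnimodalMap} {N : ℕ} (P : CriticalOrbit f N)

/-- The number of steps from the last junction to the junction `i`. -/
def time (i : Fin N) : ℕ := (P.exists_orbit i).choose

theorem time_lt (i : Fin N) : P.time i < N := (P.exists_orbit i).choose_spec.1

theorem orbit_time (i : Fin N) : P.orbit (P.time i) = i := (P.exists_orbit i).choose_spec.2

theorem time_orbit {r : ℕ} (hr : r < N) : P.time (P.orbit r) = r :=
  P.orbit_inj (P.time_lt _) hr (P.orbit_time _)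

/-- The loops `B` of the last junction are carried along to all junctions, together with the edges
joining the switches which are formed on the way. -/
def modelTrack (B : JunctionTrack) : Track N := fun i =>
  B.model (P.sideAt (P.time i)) (P.edgesAt (P.time i))

theorem modelTrack_orbit (B : JunctionTrack) {r : ℕ} (hr : r < N) :
    P.modelTrack B (P.orbit r) = B.model (P.sideAt r) (P.edgesAt r) := by
  rw [modelTrack, P.time_orbit hr]

theorem modelTrack_last (B : JunctionTrack) :
    P.modelTrack B P.last = B.model .left fun _ => False := by
  have h := P.modelTrack_orbit B (r := 0) (by have := P.three_le; omega)
  rwa [orbit_zero] at h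

variable {P} {B : JunctionTrack}

theorem model_last_equivalent
    (hB : IsMinimalReturn (P.sideAt (N - 1)) (P.edgesAt (N - 1)) B) :
    (P.modelTrack B P.last).Equivalent B := by
  rw [P.modelTrack_last]
  exact ((equivalent_atSwitch hB.side_eq).trans
    (equivalent_addThrough_of_empty fun _ => id)).symm

theorem isInvariant_modelTrack
    (hB : IsMinimalReturn (P.sideAt (N - 1)) (P.edgesAt (N - 1)) B) :
    P.IsInvariant (P.modelTrack B) := by
  have hN := P.three_le
  refine ⟨⟨fun i => hB.isPlanar_atSwitch.model _ _, fun d => ?_, fun d => ?_, fun i =>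
    model_not_parallel (hB.not_parallel_atSwitch _) _⟩, fun j => ?_⟩
  · have h := P.modelTrack_orbit B (r := 1) (by omega)
    rw [orbit_one] at h
    revert d
    rw [h]
    rintro (d | x)
    · rfl
    · exact absurd x.1.2 (P.not_edgesAt_one _)
  · revert d
    rw [P.modelTrack_last]
    rintro (d | x)
    · rfl
    · exact absurd x.1.2 id
  · obtain ⟨r, hr, hrj⟩ := P.exists_orbit (P.perm.symm j)
    obtain rfl : j = P.perm (P.orbit r) := by rw [hrj, Equiv.apply_symm_apply]
    rw [P.rawImage_perm, P.modelTrack_orbit B hr, push]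
    by_cases hr1 : r + 1 < N
    · rw [← P.orbit_succ, P.modelTrack_orbit B hr1, P.sideAt_succ]
      have hne := P.orbit_ne_crit hr1
      by_cases hlt : P.orbit r < P.crit
      · rw [if_pos hlt, if_pos hlt]
        refine isAmalgamation_keep (fun l => ?_) (hB.not_parallel_atSwitch _)
        simp only [P.edgesAt_succ, if_pos hlt]
      · rw [if_neg hlt, if_neg hlt, if_neg hne]
        have h1 : (B.model (P.sideAt r).flip fun l => P.edgesAt r l.flip).Equivalent
          (B.model (P.sideAt r) (P.edgesAt r)).rotate := ⟨_, isEmbedding_turn _ _ _⟩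
        refine (isAmalgamation_keep (fun l => ?_) (hB.not_parallel_atSwitch _)).congr (.refl _)
          (h1.addThrough _)
        simp only [P.edgesAt_succ, if_neg hlt]
    · obtain rfl : r = N - 1 := by omega
      have hc := P.orbit_N_sub_one
      rw [hc, if_neg (lt_irrefl _), if_pos rfl]
      exact hB.isAmalgamation.congr (model_last_equivalent hB)
        (equivalent_addThrough_of_empty P.not_passes_last)

/-- The model track is part of every invariant track `τ`, and it is equivalent to `τ` if `τ` is part
of it. -/
theorem IsInvariant.exists_isEmbedding
    (hB : IsMinimalReturn (P.sideAt (N - 1)) (P.edgesAt (N - 1)) B) {τ : Track N}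
    (h : P.IsInvariant τ) {r : ℕ} (hr : r < N) :
    ∃ φ, IsEmbedding (P.modelTrack B (P.orbit r)) (τ (P.orbit r)) φ ∧
      ((∀ i, ∃ ψ, IsEmbedding (τ i) (P.modelTrack B i) ψ) → Function.Surjective φ) := by
  have hN := P.three_le
  obtain ⟨e, θ, c, he, hel, heq, hθs, hθ, hc, hcl⟩ := h.exists_unfolding
  have hl := h.1.last_side
  obtain ⟨b, hb, hbi, hbs⟩ := hB.exists_map (τ P.last) (θ ∘ c) (h.1.planar _) hl (hθ.comp hc.fold)
  have hb' : IsWeakMap (B.atSwitch .left) ((τ P.last).atSwitch .left) b :=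
    ⟨hb.pair, fun _ => rfl, hb.lt, hb.enc⟩
  -- the loops of `B` in the last junction are carried to the junction `P.orbit r`
  have hw := (he r hr).comp (hb'.model (P.sideAt r) (P.edgesAt r))
  rw [P.modelTrack_orbit B hr]
  refine ⟨_, hw.isEmbedding (hB.isPlanar_atSwitch.model _ _).isOrdered
    (h.1.planar _).isOrdered ?_, fun hψ => ?_⟩
  · have hne (d : B.Dart) (x) : (e r hr ∘ Sum.map b id) (.inl d) ≠
        (e r hr ∘ Sum.map b id) (.inr x) := fun h1 =>
      not_isLoop_inr (G := B.atSwitch (P.sideAt r)) (P.edgesAt r) x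
        ((hw.isLoop_iff (.inr x)).1 (h1 ▸ (hw.isLoop_iff (.inl d)).2 rfl))
    rintro (d | x) (d' | x') h1
    · exact congrArg Sum.inl (hbi (heq r hr _ _ h1))
    · exact absurd h1 (hne d x')
    · exact absurd h1.symm (hne d' x)
    · refine congrArg Sum.inr (model_inr_ext (G := B) (s := P.sideAt r) ?_ ?_)
      · exact (hw.side (.inr x)).symm.trans ((congrArg _ h1).trans (hw.side (.inr x')))
      · exact (hw.enc (.inr x)).symm.trans ((iff_of_eq (congrArg _ h1)).trans (hw.enc (.inr x')))
  · have hcs : Function.Surjective c := by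
      intro y
      by_cases hy : (τ P.crit).IsLoop y
      · obtain ⟨g, rfl⟩ := hcl y hy
        exact ⟨_, rfl⟩
      · have hm := P.modelTrack_orbit B (r := N - 1) (by omega)
        rw [P.orbit_N_sub_one] at hm
        obtain ⟨ψ, hψ⟩ : ∃ ψ, IsEmbedding (τ P.crit)
          (B.model (P.sideAt (N - 1)) (P.edgesAt (N - 1))) ψ := hm ▸ hψ P.crit
        obtain ⟨z, hz⟩ := hc.exists_inr hψ hy
        exact ⟨_, hz⟩
    have hbs' : Function.Surjective b := by
      refine hbs ?_ (hθs.comp hcs)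
      obtain ⟨ψ, hψ⟩ := hψ P.last
      obtain ⟨χ, hχ, -⟩ := model_last_equivalent hB
      exact ⟨_, hχ.comp hψ⟩
    intro y
    by_cases hy : (τ (P.orbit r)).IsLoop y
    · obtain ⟨g, rfl⟩ := hel r hr y hy
      obtain ⟨d, rfl⟩ := hbs' g
      exact ⟨.inl d, rfl⟩
    · obtain ⟨ψ, hψ⟩ : ∃ ψ, IsEmbedding (τ (P.orbit r))
        (B.model (P.sideAt r) (P.edgesAt r)) ψ := P.modelTrack_orbit B hr ▸ hψ (P.orbit r)
      obtain ⟨z, hz⟩ := (he r hr).exists_inr hψ hy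
      exact ⟨.inr z, hz⟩

theorem isTheInvariantTrack_modelTrack
    (hB : IsMinimalReturn (P.sideAt (N - 1)) (P.edgesAt (N - 1)) B) :
    P.IsTheInvariantTrack (P.modelTrack B) := by
  refine ⟨isInvariant_modelTrack hB, fun τ' h i => ?_⟩
  obtain ⟨r, hr, rfl⟩ := P.exists_orbit i
  obtain ⟨φ, hφ, -⟩ := h.exists_isEmbedding hB hr
  exact ⟨φ, hφ⟩

/-- The invariant track is the model track: each of them is part of the other. -/
theorem IsTheInvariantTrack.equivalent
    (hB : IsMinimalReturn (P.sideAt (N - 1)) (P.edgesAt (N - 1)) B) {τ : Track N}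
    (h : P.IsTheInvariantTrack τ) {r : ℕ} (hr : r < N) :
    (τ (P.orbit r)).Equivalent (B.model (P.sideAt r) (P.edgesAt r)) := by
  obtain ⟨φ, hφ, hs⟩ := h.1.exists_isEmbedding hB hr
  rw [← P.modelTrack_orbit B hr]
  exact Equivalent.symm ⟨φ, hφ, hs (h.2 _ (isInvariant_modelTrack hB))⟩

/-! ### Types of junctions -/

theorem loops_model (t : BasicType) (s : Side) (T : Level → Prop) :
    (t.loops .left).model s T = (t.loops s).addThrough T := by
  rcases t with _ | _ | (_ | _) | (_ | _) <;> cases s <;> rfl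

/-- The edges joining the switches in `P.orbit r` are those of the configuration `t`, provided
that the second of them is present exactly for `V₃`. -/
theorem hasType_orbit {τ : Track N} {t : BasicType} {r : ℕ} (hr : r < N)
    (h : (τ (P.orbit r)).Equivalent ((t.loops (P.sideAt r)).addThrough (P.edgesAt r)))
    (h1 : r ≤ 1 → ∀ ε, t ≠ .V3 ε)
    (h2 : 2 ≤ r → (P.edgesAt r (P.sideAt r).outer.flip ↔ ∃ ε, t = .V3 ε)) :
    P.HasType τ (P.orbit r) t := by
  obtain rfl | rfl | hr2 : r = 0 ∨ r = 1 ∨ 2 ≤ r := by omega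
  · exact .inr (.inl ⟨P.orbit_zero, h1 (by omega),
      h.trans (equivalent_addThrough_of_empty fun _ => id).symm⟩)
  · exact .inl ⟨P.orbit_one, h1 le_rfl,
      h.trans (equivalent_addThrough_of_empty P.not_edgesAt_one).symm⟩
  · have hE : P.edgesAt r = t.through (P.sideAt r) := by
      funext l
      refine propext ?_
      have ho := P.edgesAt_outer hr2 hr
      have hi := h2 hr2
      rcases l.eq_outer_or (P.sideAt r) with rfl | rfl
      · refine iff_of_true ho ?_
        rcases t with _ | _ | _ | _ <;> cases P.sideAt r <;> trivial
      · rw [hi]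
        rcases t with _ | _ | _ | _ <;> cases P.sideAt r <;>
          simp [BasicType.through, Side.outer, Level.flip]
    rw [hE] at h
    have hmem : P.orbit r ∈ P.sideSet (P.sideAt r) := by
      obtain ⟨k, rfl⟩ : ∃ k, r = k + 1 := ⟨r - 1, by omega⟩
      refine ⟨k, by omega, by omega, ?_, rfl⟩
      rw [add_comm, P.orbit_add, orbit_one]
    cases hs : P.sideAt r
    · rw [hs] at h hmem
      exact .inr (.inr (.inr ⟨hmem, h⟩))
    · rw [hs] at h hmem
      exact .inr (.inr (.inl ⟨hmem, h⟩))

end CriticalOrbit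

/-! ### The three cases -/

open JunctionTrack

namespace CriticalOrbit

variable {f : UnimodalMap} {N : ℕ} {P : CriticalOrbit f N}

theorem IsTheInvariantTrack.hasType {B : JunctionTrack} {t : BasicType}
    (hB : IsMinimalReturn (P.sideAt (N - 1)) (P.edgesAt (N - 1)) B)
    (ht : B.Equivalent (t.loops .left)) {τ : Track N} (h : P.IsTheInvariantTrack τ) {r : ℕ}
    (hr : r < N) (h1 : r ≤ 1 → ∀ ε, t ≠ .V3 ε)
    (h2 : 2 ≤ r → (P.edgesAt r (P.sideAt r).outer.flip ↔ ∃ ε, t = .V3 ε)) :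
    P.HasType τ (P.orbit r) t := by
  refine hasType_orbit hr ?_ h1 h2
  rw [← loops_model]
  exact (h.equivalent hB hr).trans (ht.model _ _)

/-- In the junction of the turning point the switches are joined only by an edge passing above, so
only trivial bubbles are created. -/
theorem exists_isMinimalReturn_of_lhe (hMIA : P.IsMIA) {q : ℚ} (hq : 0 < q)
    (hh : height (P.itin P.last) = (q : ℝ)) (hs : P.itin P.last = lhe q) :
    ∃ B, IsMinimalReturn (P.sideAt (N - 1)) (P.edgesAt (N - 1)) B ∧
      ∀ τ, P.IsTheInvariantTrack τ → ∀ i, P.HasType τ i .S := by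
  have hN := P.three_le
  obtain ⟨hR, hE⟩ := P.edgesAt_of_lhe hMIA hq hh hs
  have ho := P.edgesAt_outer (r := N - 1) (by omega) (by omega)
  have hi := hE (N - 1) (by omega) (by omega)
  rw [hR] at ho hi
  have hB : IsMinimalReturn (P.sideAt (N - 1)) (P.edgesAt (N - 1))
      (tower .right (P.edgesAt (N - 1))) := hR ▸ isMinimalReturn_tower ho
  refine ⟨_, hB, fun τ hτ i => ?_⟩
  obtain ⟨r, hr, rfl⟩ := P.exists_orbit i
  refine hτ.hasType (t := .S) hB (tower_equivalent_bouquetS ho hi) hr (fun _ _ => by simp)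
    fun h => ?_
  simpa using hE r (by omega) hr

/-- In the junction of the turning point the switches are joined only by an edge passing below, so
only loops containing the puncture are created, and these are parallel. -/
theorem exists_isMinimalReturn_of_nbt (hMIA : P.IsMIA) {q : ℚ} (hq : 0 < q)
    (hh : height (P.itin P.last) = (q : ℝ)) (hs : P.itin P.last = nbt q) :
    ∃ B, IsMinimalReturn (P.sideAt (N - 1)) (P.edgesAt (N - 1)) B ∧
      ∀ τ, P.IsTheInvariantTrack τ → ∀ i, P.HasType τ i .BP := by
  have hN := P.three_le
  obtain ⟨hL, hE⟩ := P.edgesAt_of_nbt hMIA hq hh hs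
  have ho := P.edgesAt_outer (r := N - 1) (by omega) (by omega)
  have hi := hE (N - 1) (by omega) (by omega)
  rw [hL] at ho hi
  have hB : IsMinimalReturn (P.sideAt (N - 1)) (P.edgesAt (N - 1)) (bubbleBP .left) :=
    hL ▸ isMinimalReturn_bubbleBP ho hi
  refine ⟨_, hB, fun τ hτ i => ?_⟩
  obtain ⟨r, hr, rfl⟩ := P.exists_orbit i
  refine hτ.hasType (t := .BP) hB (.refl _) hr (fun _ _ => by simp) fun h => ?_
  simpa using hE r (by omega) hr

/-- The junction of the turning point has edges passing above and below, so in each step a loop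
containing the puncture and a trivial bubble are created. -/
theorem exists_isMinimalReturn_of_ne (hMIA : P.IsMIA) {q : ℚ} (hq : 0 < q)
    (hh : height (P.itin P.last) = (q : ℝ)) (hl : P.itin P.last ≠ lhe q)
    (hn : P.itin P.last ≠ nbt q) :
    ∃ B, IsMinimalReturn (P.sideAt (N - 1)) (P.edgesAt (N - 1)) B ∧
      ∀ τ, P.IsTheInvariantTrack τ → ∃ ε : Sgn,
        ((ε = .plus ∧ P.crit ∈ P.sideSet .right) ∨ (ε = .minus ∧ P.crit ∈ P.sideSet .left)) ∧
        ∀ r, r ≤ N - 1 →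
          (r ≤ q.den + 1 → P.HasType τ (P.orbit r) (.W ε)) ∧
          (q.den + 1 < r → P.HasType τ (P.orbit r) (.V3 ε)) := by
  have hN := P.three_le
  obtain ⟨hqN, hE⟩ := P.edgesAt_of_ne hMIA hq hh hl hn
  have ho := P.edgesAt_outer (r := N - 1) (by omega) (by omega)
  have hi := (hE (N - 1) (by omega) (by omega)).2 (by omega)
  have hT (l : Level) : P.edgesAt (N - 1) l := by
    rcases l.eq_outer_or (P.sideAt (N - 1)) with h | h
    · rwa [h]
    · rwa [h]
  have hB : IsMinimalReturn (P.sideAt (N - 1)) (P.edgesAt (N - 1))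
      (tower (P.sideAt (N - 1)) (P.edgesAt (N - 1))) := isMinimalReturn_tower (hT _)
  have hmem : P.crit ∈ P.sideSet (P.sideAt (N - 1)) := by
    refine ⟨N - 2, by omega, le_rfl, ?_, ?_⟩
    · rw [← P.orbit_N_sub_one, show N - 1 = 1 + (N - 2) by omega, P.orbit_add, orbit_one]
    · rw [show N - 1 = N - 2 + 1 by omega]
      rfl
  have key (ε : Sgn) (hε : (tower (P.sideAt (N - 1)) (P.edgesAt (N - 1))).Equivalent
      (loopsW ε .left)) (τ : Track N) (hτ : P.IsTheInvariantTrack τ) (r : ℕ) (hr : r ≤ N - 1) :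
      (r ≤ q.den + 1 → P.HasType τ (P.orbit r) (.W ε)) ∧
        (q.den + 1 < r → P.HasType τ (P.orbit r) (.V3 ε)) := by
    refine ⟨fun h => ?_, fun h => ?_⟩
    · refine hτ.hasType hB (t := .W ε) hε (by omega) (fun _ _ => by simp) fun h2 => ?_
      rw [hE r (by omega) (by omega)]
      simpa using h
    · refine hτ.hasType hB (t := .V3 ε) hε (by omega) (fun h3 => by omega) fun h2 => ?_
      rw [hE r (by omega) (by omega)]
      simpa using h
  refine ⟨_, hB, fun τ hτ => ?_⟩
  cases hs : P.sideAt (N - 1)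
  · rw [hs] at key hmem
    exact ⟨.minus, .inr ⟨rfl, hmem⟩, key _ (tower_equivalent_loopsW_minus hT) τ hτ⟩
  · rw [hs] at key hmem
    exact ⟨.plus, .inl ⟨rfl, hmem⟩, key _ (tower_equivalent_loopsW_plus hT) τ hτ⟩

end CriticalOrbit

end UnimodalTrack

end

open UnimodalTrack
theorem mainTheorem3 (f : UnimodalMap) (N : ℕ) (P : CriticalOrbit f N) (hMIA : P.IsMIA)
    (s : ℕ → Bool) (hs : f.kneadingSequence = s)
    (q : ℚ) (hq : 0 < q) (hheight : height s = (q : ℝ)) :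
    (∃ τ : Track N, P.IsTheInvariantTrack τ) ∧
    ∀ τ : Track N, P.IsTheInvariantTrack τ →
      (s = lhe q → ∀ i, P.HasType τ i .S) ∧
      (s = nbt q → ∀ i, P.HasType τ i .BP) ∧
      (s ≠ lhe q → s ≠ nbt q →
        ∃ ε : Sgn,
          ((ε = .plus ∧ P.crit ∈ P.sideSet .right) ∨ (ε = .minus ∧ P.crit ∈ P.sideSet .left)) ∧
          ∀ r, r ≤ N - 1 →
            (r ≤ q.den + 1 → P.HasType τ ((P.perm ^ r) P.last) (.W ε)) ∧
            (q.den + 1 < r → P.HasType τ ((P.perm ^ r) P.last) (.V3 ε))) := by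
  rw [P.kneadingSequence_eq] at hs
  subst hs
  refine ⟨?_, fun τ hτ => ⟨fun h => ?_, fun h => ?_, fun hl hn => ?_⟩⟩
  · by_cases hl : P.itin P.last = lhe q
    · obtain ⟨B, hB, -⟩ := CriticalOrbit.exists_isMinimalReturn_of_lhe hMIA hq hheight hl
      exact ⟨_, CriticalOrbit.isTheInvariantTrack_modelTrack hB⟩
    · by_cases hn : P.itin P.last = nbt q
      · obtain ⟨B, hB, -⟩ := CriticalOrbit.exists_isMinimalReturn_of_nbt hMIA hq hheight hn
        exact ⟨_, CriticalOrbit.isTheInvariantTrack_modelTrack hB⟩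
      · obtain ⟨B, hB, -⟩ := CriticalOrbit.exists_isMinimalReturn_of_ne hMIA hq hheight hl hn
        exact ⟨_, CriticalOrbit.isTheInvariantTrack_modelTrack hB⟩
  · obtain ⟨B, -, hB⟩ := CriticalOrbit.exists_isMinimalReturn_of_lhe hMIA hq hheight h
    exact hB τ hτ
  · obtain ⟨B, -, hB⟩ := CriticalOrbit.exists_isMinimalReturn_of_nbt hMIA hq hheight h
    exact hB τ hτ
  · obtain ⟨B, -, hB⟩ := CriticalOrbit.exists_isMinimalReturn_of_ne hMIA hq hheight hl hn
    exact hB τ hτ
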